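/- **Definitions.** Let $T$ be a string of length $n$ with positions $0,\dots,n-1$. Let $\mathrm{lpf}(b)$ be the largest $\ell$ such that $T[b..b+\ell)$ also occurs at some position smaller than $b$ (and $0$ for $b=0$), and let $\mathrm{lmocc}(b,\ell)$ be the smallest position $j<b$ with $T[j..j+\ell)=T[b..b+\ell)$, if there is one. An *LZ-like encoding* of $T$ splits $T$ into consecutive phrases; a phrase of length $1$ is encoded as $(1,c)$, where $c$ is its symbol, and a phrase of length $\ell\ge 2$ starting at $b$ is encoded as $(\ell,s)$, where $s<b$ and $T[s..s+\ell)=T[b..b+\ell)$ (overlap is allowed). The height of a position $i$ is $0$ if its phrase has length $1$; if it lies in a phrase $(\ell,s)$ starting at $b$, it is $1$ plus the height of position $s+((i-b)\bmod(b-s))$. An encoding is *$h$-bounded* if all heights are at most $h$. The *$h$-bounded LZHB1 encoding* of $T$ is built greedily from left to right. If the next phrase starts at $b$, let $s=\mathrm{lmocc}(b,\mathrm{lpf}(b))$ (if it exists) and let $\ell$ be the largest number with $\ell\le\mathrm{lpf}(b)$ such that copying $\ell$ symbols from $s$ gives the positions $b,\dots,b+\ell-1$ heights at most $h$. The phrase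 is $(\ell,s)$ if $\ell\ge2$, and $(1,T[b])$ otherwise (also if $s$ does not exist). The machine model is the unit-cost word RAM with $w$-bit words, with the usual arithmetic, bitwise and comparison operations and finitely many zero-initialized arrays; space is counted in words. Each symbol is represented injectively by a machine word. A task on strings of length $n$ is solved in $O(n)$ time and space if there are one program and one constant $c$ such that, for every $n$, every input string of length $n$ and every $w$ with $2^w\ge c(n+1)$ for which the codes of the symbols of the string are less than $2^w$, the program solves the task within $c(n+1)$ steps using arrays of $c(n+1)$ words. An alphabet (a linearly ordered set of symbols, which may depend on $n$) is *linearly sortable* if the positions of a string of length $n$ over it can be sorted by their symbols in $O(n)$ time and space. **Theorem.** Let $h\ge0$ be a constant and let a linearly sortable alphabet be given. For every string $T$ over the alphabet, the $h$-bounded LZHB1 encoding of $T$ is an $h$-bounded LZ-like encoding of $T$, and for strings $T$ of length $n$ over the alphabet it can be computed in $O(n)$ time and space, where the program and the constant depend only on $h$ and the alphabet. -/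

import Mathlib

namespace HBLZ

universe u

/-! ### Strings, longest previous factors, leftmost occurrences

Positions of a string `T` of length `n` are numbered `0, …, n - 1`. -/

/-- `T[j..j+l) = T[i..i+l)`, both factors lying inside `T`. -/
def SameFactor {α : Type u} (T : List α) (j i l : ℕ) : Prop :=
  j + l ≤ T.length ∧ i + l ≤ T.length ∧ ∀ k < l, T[j + k]? = T[i + k]?

instance {α : Type u} [DecidableEq α] (T : List α) (j i l : ℕ) :
    Decidable (SameFactor T j i l) := by
  unfold SameFactor; infer_instance

/-- Length of the longest previous factor of position `i`: the largest `l` such that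
`T[i..i+l)` also occurs at some `j < i`; it is `0` for the first position. -/
def lpf {α : Type u} [DecidableEq α] (T : List α) (i : ℕ) : ℕ :=
  Nat.findGreatest (fun l => ∃ j < i, SameFactor T j i l) T.length

/-- The least `j < i` at which `T[i..i+l)` occurs, if there is one. -/
def lmocc {α : Type u} [DecidableEq α] (T : List α) (i l : ℕ) : Option ℕ :=
  (List.range i).find? fun j => decide (SameFactor T j i l)

/-! ### LZ-like encodings and their heights -/

/-- `lit c` is the phrase `(1, c)`; `copy len src` is the phrase `(len, src)`. -/
inductive Phrase (α : Type u) : Type u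
  | lit (c : α) : Phrase α
  | copy (len src : ℕ) : Phrase α

/-- First component of a phrase: its length. -/
def Phrase.len {α : Type u} : Phrase α → ℕ
  | .lit _ => 1
  | .copy l _ => l

/-- Second component of a phrase as a machine word: the symbol or the source. -/
def Phrase.second {α : Type u} (code : α → ℕ) : Phrase α → ℕ
  | .lit c => code c
  | .copy _ s => s

/-- `H` lists the heights of the positions before `b = H.length`. The heights of the
positions `b + k`, `k < len`, of a phrase that starts at `b`: the position of a literal has
height `0`; position `b + k` of `(len, s)` refers to position `s + (k mod (b - s)) < b`. -/
def Phrase.newHeights {α : Type u} (H : List ℕ) : Phrase α → List ℕ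
  | .lit _ => [0]
  | .copy l s => (List.range l).map fun k => H.getD (s + k % (H.length - s)) 0 + 1

/-- The heights of all positions under an encoding, from left to right. -/
def heights {α : Type u} (E : List (Phrase α)) : List ℕ :=
  E.foldl (fun H p => H ++ p.newHeights H) []

/-- `p` is a correct phrase of an LZ-like encoding of `T` starting at position `b`. -/
def Phrase.ValidAt {α : Type u} (T : List α) (b : ℕ) : Phrase α → Prop
  | .lit c => T[b]? = some c
  | .copy l s => 2 ≤ l ∧ s < b ∧ SameFactor T s b l

/-- `E` is an LZ-like encoding of `T`. -/
def IsLZLike {α : Type u} (T : List α) (E : List (Phrase α)) : Prop :=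
  (E.map Phrase.len).sum = T.length ∧
    ∀ (j : ℕ) (p : Phrase α), E[j]? = some p →
      p.ValidAt T ((E.take j).map Phrase.len).sum

/-- `E` is an `h`-bounded LZ-like encoding of `T`. -/
def IsHBounded {α : Type u} (h : ℕ) (T : List α) (E : List (Phrase α)) : Prop :=
  IsLZLike T E ∧ ∀ x ∈ heights E, x ≤ h

/-! ### The encoding LZHB1 -/

/-- The LZHB1 phrase that starts at position `b = H.length`, where `H` lists the heights of
the positions before `b`. The source `s` is the leftmost occurrence of the longest previous
factor at `b`, and the length is the largest `l ≤ lpf T b` such that copying `l` symbols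
from `s` creates no height above `h`; phrases of length `1` are literals. -/
def nextPhrase {α : Type u} [DecidableEq α] (h : ℕ) (T : List α) (H : List ℕ)
    (hb : H.length < T.length) : Phrase α :=
  match lmocc T H.length (lpf T H.length) with
  | none => .lit T[H.length]
  | some s =>
    let l := Nat.findGreatest
      (fun l => ∀ x ∈ (Phrase.copy l s : Phrase α).newHeights H, x ≤ h) (lpf T H.length)
    if 2 ≤ l then .copy l s else .lit T[H.length]

theorem nextPhrase_pos {α : Type u} [DecidableEq α] (h : ℕ) (T : List α) (H : List ℕ)
    (hb : H.length < T.length) : 0 < ((nextPhrase h T H hb).newHeights H).length := by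
  unfold nextPhrase
  split
  · simp [Phrase.newHeights]
  · dsimp only
    split
    · rename_i hl
      simp only [Phrase.newHeights, List.length_map, List.length_range]
      exact lt_of_lt_of_le Nat.zero_lt_two hl
    · simp [Phrase.newHeights]

/-- The LZHB1 phrases from position `H.length` on. -/
def lzhb1From {α : Type u} [DecidableEq α] (h : ℕ) (T : List α) (H : List ℕ) :
    List (Phrase α) :=
  if hb : H.length < T.length then
    nextPhrase h T H hb :: lzhb1From h T (H ++ (nextPhrase h T H hb).newHeights H)
  else []
termination_by T.length - H.length
decreasing_by
  have := nextPhrase_pos h T H hb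
  rw [List.length_append]; omega

/-- The `h`-bounded LZHB1 encoding of `T`. -/
def lzhb1 {α : Type u} [DecidableEq α] (h : ℕ) (T : List α) : List (Phrase α) :=
  lzhb1From h T []

/-! ### The word RAM

A unit-cost machine with `w`-bit words, presented as a while language. A program uses
finitely many scalar registers and finitely many random-access arrays of words. -/

/-- Binary word operations. -/
inductive Op : Type
  | add | sub | mul | div | rem | band | bor | bxor | shl | shr | lt | eq

/-- Value of a word operation, modulo `2 ^ w`; a comparison returns `1` or `0`. -/
def Op.eval (w : ℕ) : Op → ℕ → ℕ → ℕ
  | .add, a, b => (a + b) % 2 ^ w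
  | .sub, a, b => (a + (2 ^ w - b)) % 2 ^ w
  | .mul, a, b => (a * b) % 2 ^ w
  | .div, a, b => (a / b) % 2 ^ w
  | .rem, a, b => (a % b) % 2 ^ w
  | .band, a, b => (a &&& b) % 2 ^ w
  | .bor, a, b => (a ||| b) % 2 ^ w
  | .bxor, a, b => (a ^^^ b) % 2 ^ w
  | .shl, a, b => (a * 2 ^ b) % 2 ^ w
  | .shr, a, b => (a / 2 ^ b) % 2 ^ w
  | .lt, a, b => if a < b then 1 % 2 ^ w else 0
  | .eq, a, b => if a = b then 1 % 2 ^ w else 0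

/-- Contents of the registers and of the arrays. -/
structure State : Type where
  var : ℕ → ℕ
  arr : ℕ → ℕ → ℕ

/-- Expressions: a constant, a register, an array cell, a word operation. -/
inductive Expr : Type
  | const (k : ℕ) : Expr
  | var (x : ℕ) : Expr
  | read (a : ℕ) (e : Expr) : Expr
  | op (o : Op) (e₁ e₂ : Expr) : Expr

/-- Value of an expression. -/
def Expr.eval (w : ℕ) (s : State) : Expr → ℕ
  | .const k => k % 2 ^ w
  | .var x => s.var x
  | .read a e => s.arr a (e.eval w s)
  | .op o e₁ e₂ => o.eval w (e₁.eval w s) (e₂.eval w s)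

/-- Number of unit-time steps that the evaluation of an expression takes. -/
def Expr.cost : Expr → ℕ
  | .const _ => 1
  | .var _ => 1
  | .read _ e => e.cost + 1
  | .op _ e₁ e₂ => e₁.cost + e₂.cost + 1

/-- Every array cell read by the evaluation has an index below `S`. -/
def Expr.Safe (w S : ℕ) (s : State) : Expr → Prop
  | .const _ => True
  | .var _ => True
  | .read _ e => e.Safe w S s ∧ e.eval w s < S
  | .op _ e₁ e₂ => e₁.Safe w S s ∧ e₂.Safe w S s

/-- Programs. `assign x e` is `x := e`; `write a i e` is `a[i] := e`; conditions hold
when their value is not `0`. -/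
inductive Cmd : Type
  | skip : Cmd
  | assign (x : ℕ) (e : Expr) : Cmd
  | write (a : ℕ) (i e : Expr) : Cmd
  | seq (p q : Cmd) : Cmd
  | ite (e : Expr) (p q : Cmd) : Cmd
  | loop (e : Expr) (p : Cmd) : Cmd

/-- Store `v` in register `x`. -/
def State.setVar (s : State) (x v : ℕ) : State :=
  { s with var := Function.update s.var x v }

/-- Store `v` in cell `i` of array `a`. -/
def State.setArr (s : State) (a i v : ℕ) : State :=
  { s with arr := Function.update s.arr a (Function.update (s.arr a) i v) }

/-- `Exec w S p s t s'`: with `w`-bit words and arrays of `S` cells each, program `p`, started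
in state `s`, halts in state `s'` after `t` steps. An access beyond an array has no
execution. -/
inductive Exec (w S : ℕ) : Cmd → State → ℕ → State → Prop
  | skip (s : State) : Exec w S .skip s 1 s
  | assign (s : State) (x : ℕ) (e : Expr) (he : e.Safe w S s) :
      Exec w S (.assign x e) s (e.cost + 1) (s.setVar x (e.eval w s))
  | write (s : State) (a : ℕ) (i e : Expr) (hi : i.Safe w S s) (he : e.Safe w S s)
      (hS : i.eval w s < S) :
      Exec w S (.write a i e) s (i.cost + e.cost + 1)
        (s.setArr a (i.eval w s) (e.eval w s))
  | seq {p q : Cmd} {s s' s'' : State} {t t' : ℕ} (hp : Exec w S p s t s')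
      (hq : Exec w S q s' t' s'') : Exec w S (.seq p q) s (t + t') s''
  | ite_true {e : Expr} {p q : Cmd} {s s' : State} {t : ℕ} (hs : e.Safe w S s)
      (he : e.eval w s ≠ 0) (hp : Exec w S p s t s') :
      Exec w S (.ite e p q) s (e.cost + 1 + t) s'
  | ite_false {e : Expr} {p q : Cmd} {s s' : State} {t : ℕ} (hs : e.Safe w S s)
      (he : e.eval w s = 0) (hq : Exec w S q s t s') :
      Exec w S (.ite e p q) s (e.cost + 1 + t) s'
  | loop_true {e : Expr} {p : Cmd} {s s' s'' : State} {t t' : ℕ} (hs : e.Safe w S s)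
      (he : e.eval w s ≠ 0) (hp : Exec w S p s t s')
      (hl : Exec w S (.loop e p) s' t' s'') :
      Exec w S (.loop e p) s (e.cost + 1 + t + t') s''
  | loop_false {e : Expr} {p : Cmd} {s : State} (hs : e.Safe w S s)
      (he : e.eval w s = 0) : Exec w S (.loop e p) s (e.cost + 1) s

/-- Initial state: the input word sequence in array `0`, its length in register `0`,
everything else `0`. -/
def initState (x : List ℕ) : State where
  var v := if v = 0 then x.length else 0
  arr a i := if a = 0 then x.getD i 0 else 0

/-- Linear time and space for strings over an alphabet that may depend on the length `n` of
the string, with symbols represented by machine words through `code`. A single program and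
a single constant `c` serve all strings and all word lengths `w ≥ log₂ (c (n + 1))` for
which the symbols of the string are `w`-bit words; the program halts within `c (n + 1)`
steps, its arrays have `c (n + 1)` cells, and its final state satisfies `Post`. -/
def LinearTimeSpace (A : ℕ → Type u) (code : (n : ℕ) → A n ↪ ℕ)
    (Post : (n : ℕ) → List (A n) → State → Prop) : Prop :=
  ∃ (P : Cmd) (c : ℕ), ∀ (n w : ℕ) (T : List (A n)), T.length = n →
    c * (n + 1) ≤ 2 ^ w → (∀ a ∈ T, code n a < 2 ^ w) →
    ∃ (t : ℕ) (s : State),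
      Exec w (c * (n + 1)) P (initState (T.map (code n))) t s ∧
      t ≤ c * (n + 1) ∧ Post n T s

/-- Array `1` holds the positions of `T` in an order in which the symbols at these positions
are nondecreasing. -/
def IsSortOutput {α : Type u} [LinearOrder α] (T : List α) (s : State) : Prop :=
  ∃ σ : Equiv.Perm (Fin T.length),
    (∀ i : Fin T.length, s.arr 1 i = σ i) ∧ Monotone fun i => T.get (σ i)

/-- The alphabet is linearly sortable: the positions of a string of length `n` can be sorted
by their symbols in `O(n)` time and space. -/
def LinearlySortable (A : ℕ → Type u) [∀ n, LinearOrder (A n)]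
    (code : (n : ℕ) → A n ↪ ℕ) : Prop :=
  LinearTimeSpace A code fun _ T s => IsSortOutput T s

/-- Register `0` holds the number of phrases of `E`; arrays `1` and `2` hold the first and
second components of the phrases. -/
def IsEncodingOutput {α : Type u} (code : α → ℕ) (E : List (Phrase α)) (s : State) : Prop :=
  s.var 0 = E.length ∧
    ∀ (j : ℕ) (hj : j < E.length), s.arr 1 j = E[j].len ∧ s.arr 2 j = E[j].second code

end HBLZ

/-!
The first claim is an induction along the greedy construction: a chosen phrase is a factor that
occurs at its source, and its length was limited so that no height exceeds `h`
(`isHBounded_lzhb1`).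

For linear time it suffices to know, for every position `b`, the length of its longest previous
factor and the leftmost occurrence of this factor. The greedy scan then extends the current phrase
symbol by symbol as long as the height of the source position is below `h`, with constant work per
symbol, because the heights of all positions before the phrase are known (`greedyScan_runs`).

Both tables are read off the suffix array, which is computed for the string of the ranks of the
symbols. The suffix array is built by sorting the suffixes at positions not divisible by `3`
through the suffix array of a string of at most `2 n / 3 + 1` names of triples, and then merging
in the remaining suffixes (`suffixArray_runs`). The recursion is unrolled into a loop over levels
whose strings lie one after another in a single array, so that their total length bounds both time
and space. Longest common prefixes of neighbouring suffixes follow by Kasai's algorithm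
(`kasai_runs`).

A scan of the suffix array with a stack keeps a division of the scanned entries into blocks
separated by common prefixes of increasing length; merging the two topmost blocks, with least
positions `s < b`, happens at the moment when the common prefix `d` between them is a local
maximum. Hence `d` is the length of the longest previous factor at `b`, the factor occurs at `s`,
and nothing longer than `d` at `s` occurs before `s` (`StackInv.isParent`). Following these
links from left to right gives leftmost occurrences: if the longest previous factor at `s` is as
long as that at `b`, both are the same word and have the same leftmost occurrence, and otherwise
`s` is itself the leftmost occurrence (`leftmost_runs`).

The sorting program that the hypothesis on the alphabet provides is run on a copy of the input,
with its registers and arrays renumbered so that it does not interfere with the rest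
(`Exec.shift`). Programs are verified with weakest preconditions for loop-free code, in which
arithmetic is that of `ℕ` under the obligation that nothing overflows, and with invariants and
potentials for loops (`Cmd.wp.runs`, `Runs.loop`).
-/

namespace HBLZ

/-! ### Verification of word RAM programs -/

instance : Add Expr := ⟨.op .add⟩
instance : Sub Expr := ⟨.op .sub⟩
instance : Mul Expr := ⟨.op .mul⟩
instance : Div Expr := ⟨.op .div⟩
instance : Mod Expr := ⟨.op .rem⟩
instance (k : ℕ) : OfNat Expr k := ⟨.const k⟩

-- Notation for programs: `♯x` is register `x`, and `a ⊙ e` is the cell of array `a` at `e`.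
prefix:max "♯" => Expr.var
infixr:90 " ⊙ " => Expr.read
infix:50 " <ₑ " => Expr.op Op.lt
infix:50 " =ₑ " => Expr.op Op.eq
infixr:30 " ;; " => Cmd.seq
infix:40 " ≔ " => Cmd.assign

/-- The number of `w`-bit words, kept folded so that arithmetic tactics see an atom. -/
def wordCap (w : ℕ) : ℕ := 2 ^ w

/-- Value of a word operation computed in `ℕ`; the bit operations are not used. -/
def Op.val : Op → ℕ → ℕ → ℕ
  | .add, a, b => a + b
  | .sub, a, b => a - b
  | .mul, a, b => a * b
  | .div, a, b => a / b
  | .rem, a, b => a % b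
  | .lt, a, b => if a < b then 1 else 0
  | .eq, a, b => if a = b then 1 else 0
  | _, _, _ => 0

/-- A condition under which a word operation agrees with `Op.val`. -/
def Op.OK (W : ℕ) : Op → ℕ → ℕ → Prop
  | .add, a, b => a + b < W
  | .sub, a, b => b ≤ a ∧ a < W
  | .mul, a, b => a * b < W
  | .div, a, _ => a < W
  | .rem, a, _ => a < W
  | .lt, _, _ => True
  | .eq, _, _ => True
  | _, _, _ => False

/-- Value of an expression computed in `ℕ`. -/
def Expr.val (s : State) : Expr → ℕ
  | .const k => k
  | .var x => s.var x
  | .read a e => s.arr a (e.val s)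
  | .op o e₁ e₂ => o.val (e₁.val s) (e₂.val s)

/-- No operation of the expression overflows and all cells read exist. -/
def Expr.OK (w S : ℕ) (s : State) : Expr → Prop
  | .const k => k < wordCap w
  | .var _ => True
  | .read _ e => e.OK w S s ∧ e.val s < S
  | .op o e₁ e₂ => e₁.OK w S s ∧ e₂.OK w S s ∧ o.OK (wordCap w) (e₁.val s) (e₂.val s)

theorem Op.eval_eq_val {w : ℕ} (hw : 1 < wordCap w) {o : Op} {a b : ℕ}
    (h : o.OK (wordCap w) a b) : o.eval w a b = o.val a b := by
  unfold wordCap at *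
  cases o <;> simp only [Op.OK, Op.eval, Op.val] at *
  · exact Nat.mod_eq_of_lt h
  · rw [show a + (2 ^ w - b) = (a - b) + 2 ^ w by omega, Nat.add_mod_right]
    exact Nat.mod_eq_of_lt (by omega)
  · exact Nat.mod_eq_of_lt h
  · exact Nat.mod_eq_of_lt (lt_of_le_of_lt (Nat.div_le_self _ _) h)
  · exact Nat.mod_eq_of_lt (lt_of_le_of_lt (Nat.mod_le _ _) h)
  · rw [Nat.mod_eq_of_lt hw]
  · rw [Nat.mod_eq_of_lt hw]

theorem Expr.eval_eq_val {w S : ℕ} (hw : 1 < wordCap w) {s : State} {e : Expr}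
    (h : e.OK w S s) : e.Safe w S s ∧ e.eval w s = e.val s := by
  induction e with
  | const k => exact ⟨trivial, Nat.mod_eq_of_lt h⟩
  | var x => exact ⟨trivial, rfl⟩
  | read a e ih =>
    obtain ⟨h1, h2⟩ := ih h.1
    exact ⟨⟨h1, by rw [h2]; exact h.2⟩, by simp only [Expr.eval, Expr.val, h2]⟩
  | op o e₁ e₂ ih₁ ih₂ =>
    obtain ⟨h1, h2⟩ := ih₁ h.1
    obtain ⟨h3, h4⟩ := ih₂ h.2.1
    exact ⟨⟨h1, h3⟩, by simp only [Expr.eval, Expr.val, h2, h4]; exact Op.eval_eq_val hw h.2.2⟩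

section simpLemmas
variable {w S : ℕ} {s : State}

@[simp] theorem Expr.val_add (a b : Expr) : (a + b).val s = a.val s + b.val s := rfl
@[simp] theorem Expr.val_sub (a b : Expr) : (a - b).val s = a.val s - b.val s := rfl
@[simp] theorem Expr.val_mul (a b : Expr) : (a * b).val s = a.val s * b.val s := rfl
@[simp] theorem Expr.val_div (a b : Expr) : (a / b).val s = a.val s / b.val s := rfl
@[simp] theorem Expr.val_mod (a b : Expr) : (a % b).val s = a.val s % b.val s := rfl
@[simp] theorem Expr.val_lt (a b : Expr) :
    (a <ₑ b).val s = if a.val s < b.val s then 1 else 0 := rfl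
@[simp] theorem Expr.val_eq (a b : Expr) :
    (a =ₑ b).val s = if a.val s = b.val s then 1 else 0 := rfl
@[simp] theorem Expr.val_ofNat (k : ℕ) :
    (no_index (OfNat.ofNat k : Expr)).val s = (OfNat.ofNat k : ℕ) := rfl
@[simp] theorem Expr.val_const (k : ℕ) : (Expr.const k).val s = k := rfl
@[simp] theorem Expr.val_var (x : ℕ) : (♯x).val s = s.var x := rfl
@[simp] theorem Expr.val_read (a : ℕ) (e : Expr) : (a ⊙ e).val s = s.arr a (e.val s) := rfl

@[simp] theorem Expr.OK_add (a b : Expr) : (a + b).OK w S s ↔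
    a.OK w S s ∧ b.OK w S s ∧ a.val s + b.val s < wordCap w := Iff.rfl
@[simp] theorem Expr.OK_sub (a b : Expr) : (a - b).OK w S s ↔
    a.OK w S s ∧ b.OK w S s ∧ b.val s ≤ a.val s ∧ a.val s < wordCap w := Iff.rfl
@[simp] theorem Expr.OK_mul (a b : Expr) : (a * b).OK w S s ↔
    a.OK w S s ∧ b.OK w S s ∧ a.val s * b.val s < wordCap w := Iff.rfl
@[simp] theorem Expr.OK_div (a b : Expr) : (a / b).OK w S s ↔
    a.OK w S s ∧ b.OK w S s ∧ a.val s < wordCap w := Iff.rfl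
@[simp] theorem Expr.OK_mod (a b : Expr) : (a % b).OK w S s ↔
    a.OK w S s ∧ b.OK w S s ∧ a.val s < wordCap w := Iff.rfl
@[simp] theorem Expr.OK_lt (a b : Expr) : (a <ₑ b).OK w S s ↔ a.OK w S s ∧ b.OK w S s :=
  ⟨fun h => ⟨h.1, h.2.1⟩, fun h => ⟨h.1, h.2, trivial⟩⟩
@[simp] theorem Expr.OK_eq (a b : Expr) : (a =ₑ b).OK w S s ↔ a.OK w S s ∧ b.OK w S s :=
  ⟨fun h => ⟨h.1, h.2.1⟩, fun h => ⟨h.1, h.2, trivial⟩⟩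
@[simp] theorem Expr.OK_ofNat (k : ℕ) :
    (no_index (OfNat.ofNat k : Expr)).OK w S s ↔ (OfNat.ofNat k : ℕ) < wordCap w := Iff.rfl
@[simp] theorem Expr.OK_const (k : ℕ) : (Expr.const k).OK w S s ↔ k < wordCap w := Iff.rfl
@[simp] theorem Expr.OK_var (x : ℕ) : (♯x).OK w S s ↔ True := Iff.rfl
@[simp] theorem Expr.OK_read (a : ℕ) (e : Expr) :
    (a ⊙ e).OK w S s ↔ e.OK w S s ∧ e.val s < S := Iff.rfl

@[simp] theorem Expr.cost_add (a b : Expr) : (a + b).cost = a.cost + b.cost + 1 := rfl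
@[simp] theorem Expr.cost_sub (a b : Expr) : (a - b).cost = a.cost + b.cost + 1 := rfl
@[simp] theorem Expr.cost_mul (a b : Expr) : (a * b).cost = a.cost + b.cost + 1 := rfl
@[simp] theorem Expr.cost_div (a b : Expr) : (a / b).cost = a.cost + b.cost + 1 := rfl
@[simp] theorem Expr.cost_mod (a b : Expr) : (a % b).cost = a.cost + b.cost + 1 := rfl
@[simp] theorem Expr.cost_ofNat (k : ℕ) : (no_index (OfNat.ofNat k : Expr)).cost = 1 := rfl
attribute [simp] Expr.cost

@[simp] theorem State.var_setVar (x v y : ℕ) :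
    (s.setVar x v).var y = if y = x then v else s.var y := by
  simp [State.setVar, Function.update_apply]
@[simp] theorem State.arr_setVar (x v : ℕ) : (s.setVar x v).arr = s.arr := rfl
@[simp] theorem State.var_setArr (a i v : ℕ) : (s.setArr a i v).var = s.var := rfl
theorem State.arr_setArr (a i v b : ℕ) :
    (s.setArr a i v).arr b = if b = a then Function.update (s.arr a) i v else s.arr b := by
  simp [State.setArr, Function.update_apply]
@[simp] theorem State.arr_setArr_apply (a i v b j : ℕ) :
    (s.setArr a i v).arr b j = if b = a ∧ j = i then v else s.arr b j := by
  rw [State.arr_setArr]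
  by_cases h : b = a
  · subst h; simp [Function.update_apply]
  · simp [h]

end simpLemmas

/-- Register `x` is assigned somewhere in the program. -/
def Cmd.modV (x : ℕ) : Cmd → Bool
  | .skip => false
  | .assign y _ => x == y
  | .write _ _ _ => false
  | .seq p q => p.modV x || q.modV x
  | .ite _ p q => p.modV x || q.modV x
  | .loop _ p => p.modV x

/-- Array `a` is written somewhere in the program. -/
def Cmd.modA (a : ℕ) : Cmd → Bool
  | .skip => false
  | .assign _ _ => false
  | .write b _ _ => a == b
  | .seq p q => p.modA a || q.modA a
  | .ite _ p q => p.modA a || q.modA a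
  | .loop _ p => p.modA a

/-- The states agree on all registers and arrays that `p` does not modify. -/
structure Frame (p : Cmd) (s s' : State) : Prop where
  var : ∀ x, p.modV x = false → s'.var x = s.var x
  arr : ∀ a, p.modA a = false → s'.arr a = s.arr a

theorem Frame.rfl {p : Cmd} {s : State} : Frame p s s :=
  ⟨fun _ _ => Eq.refl _, fun _ _ => Eq.refl _⟩

theorem Frame.trans {p : Cmd} {s s' s'' : State} (h : Frame p s s') (h' : Frame p s' s'') :
    Frame p s s'' :=
  ⟨fun x hx => (h'.var x hx).trans (h.var x hx), fun a ha => (h'.arr a ha).trans (h.arr a ha)⟩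

theorem Frame.of_exec {w S : ℕ} {p : Cmd} {s s' : State} {t : ℕ} (h : Exec w S p s t s') :
    Frame p s s' := by
  induction h with
  | skip s => exact .rfl
  | assign s x e he =>
    refine ⟨fun y hy => ?_, fun a _ => Eq.refl _⟩
    simp only [Cmd.modV, beq_eq_false_iff_ne] at hy
    simp [hy]
  | write s a i e hi he hS =>
    refine ⟨fun y _ => Eq.refl _, fun b hb => ?_⟩
    simp only [Cmd.modA, beq_eq_false_iff_ne] at hb
    simp [State.arr_setArr, hb]
  | seq _ _ ih ih' =>
    exact ⟨fun x hx => by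
        simp only [Cmd.modV, Bool.or_eq_false_iff] at hx; rw [ih'.var x hx.2, ih.var x hx.1],
      fun x hx => by
        simp only [Cmd.modA, Bool.or_eq_false_iff] at hx; rw [ih'.arr x hx.2, ih.arr x hx.1]⟩
  | ite_true _ _ _ ih =>
    exact ⟨fun x hx => ih.var x (by simp only [Cmd.modV, Bool.or_eq_false_iff] at hx; exact hx.1),
      fun x hx => ih.arr x (by simp only [Cmd.modA, Bool.or_eq_false_iff] at hx; exact hx.1)⟩
  | ite_false _ _ _ ih =>
    exact ⟨fun x hx => ih.var x (by simp only [Cmd.modV, Bool.or_eq_false_iff] at hx; exact hx.2),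
      fun x hx => ih.arr x (by simp only [Cmd.modA, Bool.or_eq_false_iff] at hx; exact hx.2)⟩
  | loop_true _ _ _ _ ih ih' =>
    exact Frame.trans ⟨fun x hx => ih.var x hx, fun x hx => ih.arr x hx⟩ ih'
  | loop_false _ _ => exact .rfl

/-- Some execution of `p` from `s` takes at most `t` steps and ends in a state satisfying `Q`. -/
def Runs (w S : ℕ) (p : Cmd) (s : State) (t : ℕ) (Q : State → Prop) : Prop :=
  ∃ t' s', Exec w S p s t' s' ∧ t' ≤ t ∧ Q s'

theorem Runs.imp {w S : ℕ} {p : Cmd} {s : State} {t t' : ℕ} {P Q : State → Prop}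
    (h : Runs w S p s t P) (ht : t ≤ t') (hQ : ∀ s', Frame p s s' → P s' → Q s') :
    Runs w S p s t' Q := by
  obtain ⟨t₁, s₁, he, h1, h2⟩ := h
  exact ⟨t₁, s₁, he, h1.trans ht, hQ _ (.of_exec he) h2⟩

/-- The second program may be analysed with the knowledge of what the first one left unchanged. -/
theorem Runs.seq {w S : ℕ} {p q : Cmd} {s : State} {t t₁ : ℕ} {P Q : State → Prop}
    (hp : Runs w S p s t₁ P) (ht : t₁ ≤ t)
    (hq : ∀ s', Frame p s s' → P s' → Runs w S q s' (t - t₁) Q) : Runs w S (p ;; q) s t Q := by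
  obtain ⟨t₂, s₂, he, h1, h2⟩ := hp
  obtain ⟨t₃, s₃, he', h1', h2'⟩ := hq _ (.of_exec he) h2
  exact ⟨_, _, .seq he he', by omega, h2'⟩

/-- Weakest precondition of a program without loops, arithmetic being done in `ℕ` under the
obligation that nothing overflows. -/
def Cmd.wp (w S : ℕ) : Cmd → State → (State → Prop) → Prop
  | .skip, s, Q => Q s
  | .assign x e, s, Q => e.OK w S s ∧ Q (s.setVar x (e.val s))
  | .write a i e, s, Q => i.OK w S s ∧ e.OK w S s ∧ i.val s < S ∧ Q (s.setArr a (i.val s) (e.val s))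
  | .seq p q, s, Q => p.wp w S s fun s' => q.wp w S s' Q
  | .ite e p q, s, Q => e.OK w S s ∧ (e.val s ≠ 0 → p.wp w S s Q) ∧ (e.val s = 0 → q.wp w S s Q)
  | .loop _ _, _, _ => False

theorem Cmd.wp.mono {w S : ℕ} {p : Cmd} : ∀ {s : State} {P Q : State → Prop},
    (∀ s, P s → Q s) → p.wp w S s P → p.wp w S s Q := by
  induction p with
  | skip => intro s P Q hPQ h; exact hPQ _ h
  | assign y e => intro s P Q hPQ h; exact ⟨h.1, hPQ _ h.2⟩
  | write a j e => intro s P Q hPQ h; exact ⟨h.1, h.2.1, h.2.2.1, hPQ _ h.2.2.2⟩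
  | seq p q ihp ihq => intro s P Q hPQ h; exact ihp (fun s h => ihq hPQ h) h
  | ite e p q ihp ihq =>
    intro s P Q hPQ h
    exact ⟨h.1, fun he => ihp hPQ (h.2.1 he), fun he => ihq hPQ (h.2.2 he)⟩
  | loop e p => intro s P Q _ h; exact h.elim

theorem Cmd.wp.frame {w S : ℕ} {q : Cmd} : ∀ {s : State} {Q : State → Prop},
    q.wp w S s Q → q.wp w S s fun s' => Q s' ∧ Frame q s s' := by
  induction q with
  | skip => intro s Q h; exact ⟨h, .rfl⟩
  | assign y e =>
    intro s Q h
    refine ⟨h.1, h.2, fun z hz => ?_, fun _ _ => rfl⟩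
    simp only [Cmd.modV, beq_eq_false_iff_ne] at hz
    simp [hz]
  | write a j e =>
    intro s Q h
    refine ⟨h.1, h.2.1, h.2.2.1, h.2.2.2, fun _ _ => rfl, fun z hz => ?_⟩
    simp only [Cmd.modA, beq_eq_false_iff_ne] at hz
    simp [State.arr_setArr, hz]
  | seq p q ihp ihq =>
    intro s Q h
    refine Cmd.wp.mono (p := p) ?_ (ihp h)
    rintro s' ⟨h1, h2⟩
    refine Cmd.wp.mono ?_ (ihq h1)
    rintro s'' ⟨h3, h4⟩
    refine ⟨h3, fun z hz => ?_, fun z hz => ?_⟩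
    · simp only [Cmd.modV, Bool.or_eq_false_iff] at hz
      rw [h4.var z hz.2, h2.var z hz.1]
    · simp only [Cmd.modA, Bool.or_eq_false_iff] at hz
      rw [h4.arr z hz.2, h2.arr z hz.1]
  | ite e p q ihp ihq =>
    intro s Q h
    refine ⟨h.1, fun he => Cmd.wp.mono ?_ (ihp (h.2.1 he)),
      fun he => Cmd.wp.mono ?_ (ihq (h.2.2 he))⟩
    all_goals
      rintro s' ⟨h1, h2⟩
      refine ⟨h1, fun z hz => ?_, fun z hz => ?_⟩
    · simp only [Cmd.modV, Bool.or_eq_false_iff] at hz; exact h2.var z hz.1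
    · simp only [Cmd.modA, Bool.or_eq_false_iff] at hz; exact h2.arr z hz.1
    · simp only [Cmd.modV, Bool.or_eq_false_iff] at hz; exact h2.var z hz.2
    · simp only [Cmd.modA, Bool.or_eq_false_iff] at hz; exact h2.arr z hz.2
  | loop e p => intro s Q h; exact h.elim

theorem Cmd.wp.seq {w S : ℕ} {p q : Cmd} {s : State} {P Q : State → Prop} (h : p.wp w S s P)
    (h' : ∀ s', Frame p s s' → P s' → q.wp w S s' Q) : (p ;; q).wp w S s Q :=
  Cmd.wp.mono (p := p) (fun _ h => h' _ h.2 h.1) h.frame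

/-- Maximal running time of a program without loops. -/
def Cmd.cost : Cmd → ℕ
  | .skip => 1
  | .assign _ e => e.cost + 1
  | .write _ i e => i.cost + e.cost + 1
  | .seq p q => p.cost + q.cost
  | .ite e p q => e.cost + 1 + max p.cost q.cost
  | .loop _ _ => 0

theorem Cmd.wp.runs_cost {w S : ℕ} (hw : 1 < wordCap w) {p : Cmd} :
    ∀ {s : State} {Q : State → Prop}, p.wp w S s Q → Runs w S p s p.cost Q := by
  induction p with
  | skip => intro s Q h; exact ⟨_, _, .skip s, le_rfl, h⟩
  | assign x e =>
    intro s Q h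
    obtain ⟨h1, h2⟩ := Expr.eval_eq_val hw h.1
    exact ⟨_, _, .assign s x e h1, le_rfl, by rw [h2]; exact h.2⟩
  | write a i e =>
    intro s Q h
    obtain ⟨h1, h2⟩ := Expr.eval_eq_val hw h.1
    obtain ⟨h3, h4⟩ := Expr.eval_eq_val hw h.2.1
    exact ⟨_, _, .write s a i e h1 h3 (by rw [h2]; exact h.2.2.1), le_rfl,
      by rw [h2, h4]; exact h.2.2.2⟩
  | seq p q ihp ihq =>
    intro s Q h
    refine Runs.seq (ihp h) (Nat.le_add_right _ _) fun s' _ h' => (ihq h').imp ?_ fun _ _ h => h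
    simp only [Cmd.cost]; omega
  | ite e p q ihp ihq =>
    intro s Q h
    obtain ⟨h1, h2⟩ := Expr.eval_eq_val hw h.1
    by_cases he : e.val s = 0
    · obtain ⟨t, s', hx, ht, hQ⟩ := ihq (h.2.2 he)
      exact ⟨_, _, .ite_false h1 (h2.trans he) hx, by simp only [Cmd.cost]; omega, hQ⟩
    · obtain ⟨t, s', hx, ht, hQ⟩ := ihp (h.2.1 he)
      exact ⟨_, _, .ite_true h1 (by rwa [h2]) hx, by simp only [Cmd.cost]; omega, hQ⟩
  | loop e p => intro s Q h; exact h.elim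

theorem Cmd.wp.runs {w S : ℕ} (hw : 1 < wordCap w) {p : Cmd} {s : State} {t : ℕ}
    {Q : State → Prop} (h : p.wp w S s Q) (ht : p.cost ≤ t) : Runs w S p s t Q :=
  (h.runs_cost hw).imp ht fun _ _ h => h

/-- Loops are analysed with a potential `Φ` that pays for the time of the iterations. -/
theorem Runs.loop {w S : ℕ} (hw : 1 < wordCap w) {e : Expr} {p : Cmd} {s₀ : State}
    (I : State → Prop) (Φ : State → ℕ) (h₀ : I s₀)
    (h : ∀ s, Frame p s₀ s → I s → e.OK w S s ∧ e.cost + 1 ≤ Φ s ∧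
      (e.val s ≠ 0 → ∃ t, Runs w S p s t fun s' => I s' ∧ e.cost + 1 + t + Φ s' ≤ Φ s)) :
    Runs w S (.loop e p) s₀ (Φ s₀) fun s' => I s' ∧ e.val s' = 0 := by
  have key : ∀ (m : ℕ) (s : State), Φ s ≤ m → Frame p s₀ s → I s →
      Runs w S (.loop e p) s (Φ s) fun s' => I s' ∧ e.val s' = 0 := by
    intro m
    induction m with
    | zero => intro s hm hf hI; have := (h s hf hI).2.1; omega
    | succ m ih =>
      intro s hm hf hI
      obtain ⟨h1, h2, h3⟩ := h s hf hI
      obtain ⟨h4, h5⟩ := Expr.eval_eq_val hw h1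
      by_cases he : e.val s = 0
      · exact ⟨_, _, .loop_false h4 (h5.trans he), h2, hI, he⟩
      · obtain ⟨t, t₁, s₁, hx, ht, hI', hΦ⟩ := h3 he
        obtain ⟨t₂, s₂, hx', ht', hQ⟩ := ih s₁ (by omega) (hf.trans (.of_exec hx)) hI'
        exact ⟨_, _, .loop_true h4 (by rwa [h5]) hx hx', by omega, hQ⟩
  exact key _ s₀ le_rfl .rfl h₀

/-- A loop whose body has no loops runs in time proportional to a decreasing measure. -/
theorem Runs.while {w S : ℕ} (hw : 1 < wordCap w) {e : Expr} {p : Cmd} {s₀ : State} {t : ℕ}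
    (I : State → Prop) (μ : State → ℕ) (h₀ : I s₀)
    (h : ∀ s, Frame p s₀ s → I s → e.OK w S s ∧
      (e.val s ≠ 0 → p.wp w S s fun s' => I s' ∧ μ s' + 1 ≤ μ s))
    (ht : (μ s₀ + 1) * (e.cost + 1 + p.cost) ≤ t) :
    Runs w S (.loop e p) s₀ t fun s' => I s' ∧ e.val s' = 0 := by
  refine (Runs.loop hw I (fun s => (μ s + 1) * (e.cost + 1 + p.cost)) h₀ ?_).imp ht
    fun _ _ h => h
  intro s hf hI
  obtain ⟨h1, h2⟩ := h s hf hI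
  refine ⟨h1, by nlinarith, fun he => ⟨p.cost, ((h2 he).runs_cost hw).imp le_rfl ?_⟩⟩
  rintro s' _ ⟨h3, h4⟩
  refine ⟨h3, ?_⟩
  calc _ = (μ s' + 1 + 1) * (e.cost + 1 + p.cost) := by ring
    _ ≤ _ := Nat.mul_le_mul_right _ (by omega)

/-- `for i := 0, …, N - 1 do p`, where `N` is the content of register `x`. -/
def Cmd.forTo (i x : ℕ) (p : Cmd) : Cmd :=
  i ≔ 0 ;; .loop (♯i <ₑ ♯x) (p ;; i ≔ ♯i + 1)

/-- A counting loop whose body has no loops and changes neither the index nor the bound. `J j` holds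
before the iteration with index `j`. -/
theorem Runs.forTo {w S : ℕ} (hw : 1 < wordCap w) {i x : ℕ} {p : Cmd} {s₀ : State} {N t : ℕ}
    (hN : s₀.var x = N) (J : ℕ → State → Prop) (hix : x ≠ i) (hpx : p.modV x = false)
    (hpi : p.modV i = false) (hNw : N < wordCap w)
    (h₀ : J 0 (s₀.setVar i 0))
    (h : ∀ (j : ℕ) (s : State), j < N → Frame (i ≔ 0 ;; p) s₀ s → s.var i = j → J j s →
      p.wp w S s fun s' => J (j + 1) (s'.setVar i (j + 1)))
    (ht : (N + 2) * (p.cost + 9) ≤ t) :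
    Runs w S (.forTo i x p) s₀ t fun s' => J N s' := by
  have hfx : ∀ {s}, Frame (i ≔ 0 ;; p) s₀ s → s.var x = N := fun hf =>
    (hf.var x (by simp [Cmd.modV, hix, hpx])).trans hN
  refine Runs.seq (P := fun s => s = s₀.setVar i 0) (t₁ := 2)
    (Cmd.wp.runs hw ⟨by simp; omega, by simp⟩ (by simp [Cmd.cost])) (by nlinarith) ?_
  rintro s₁ - rfl
  refine (Runs.while hw (t := t - 2)
    (fun s => Frame (i ≔ 0 ;; p) s₀ s ∧ s.var i ≤ N ∧ J (s.var i) s) (fun s => N - s.var i)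
    ⟨⟨?_, ?_⟩, by simp, by simpa using h₀⟩ ?_ ?_).imp le_rfl ?_
  · intro y hy
    simp only [Cmd.modV, Bool.or_eq_false_iff, beq_eq_false_iff_ne] at hy
    simp [hy.1]
  · intro a _; rfl
  · rintro s - ⟨hf, hi, hJ⟩
    refine ⟨by simp, fun he => ?_⟩
    have hlt : s.var i < N := by
      have := hfx hf
      by_contra hc
      simp [this, hc] at he
    have hwp := h _ s hlt hf rfl hJ
    refine Cmd.wp.mono (p := p) ?_ (Cmd.wp.frame hwp)
    rintro s' ⟨hJ', hf'⟩
    have hi' : s'.var i = s.var i := hf'.var i hpi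
    refine ⟨by simp; omega, ⟨hf.trans ⟨fun y hy => ?_, fun a ha => ?_⟩, ?_, ?_⟩, ?_⟩
    · simp only [Cmd.modV, Bool.or_eq_false_iff, beq_eq_false_iff_ne] at hy
      simp [hy.1, hf'.var y hy.2]
    · exact hf'.arr a (by simpa [Cmd.modA] using ha)
    · simp; omega
    · simpa [hi'] using hJ'
    · simp; omega
  · simp only [State.var_setVar, if_true, Cmd.cost, Expr.cost]
    have : (N - 0 + 1) * (1 + 1 + 1 + 1 + (p.cost + (1 + 1 + 1 + 1))) + 2
        ≤ (N + 2) * (p.cost + 9) := by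
      rw [Nat.sub_zero]; nlinarith [Nat.zero_le p.cost]
    omega
  · rintro s - ⟨⟨hf, hi, hJ⟩, he⟩
    have : s.var i = N := by
      have := hfx hf
      by_contra hc
      have hlt : s.var i < N := by omega
      simp [this, hlt] at he
    rwa [this] at hJ

/-- The expression reads array `a`. -/
def Expr.reads (a : ℕ) : Expr → Bool
  | .const _ => false
  | .var _ => false
  | .read b e => a == b || e.reads a
  | .op _ e₁ e₂ => e₁.reads a || e₂.reads a

theorem Expr.val_congr {w S : ℕ} {s s' : State} {e : Expr} (hv : s'.var = s.var)
    (ha : ∀ a, e.reads a = true → s'.arr a = s.arr a) :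
    e.val s' = e.val s ∧ (e.OK w S s → e.OK w S s') := by
  induction e with
  | const k => exact ⟨rfl, id⟩
  | var x => exact ⟨by simp [hv], id⟩
  | read a e ih =>
    obtain ⟨h1, h2⟩ := ih fun b hb => ha b (by simp [Expr.reads, hb])
    exact ⟨by simp [h1, ha a (by simp [Expr.reads])], fun h => ⟨h2 h.1, by rw [h1]; exact h.2⟩⟩
  | op o e₁ e₂ ih₁ ih₂ =>
    obtain ⟨h1, h2⟩ := ih₁ fun b hb => ha b (by simp [Expr.reads, hb])
    obtain ⟨h3, h4⟩ := ih₂ fun b hb => ha b (by simp [Expr.reads, hb])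
    exact ⟨by simp only [Expr.val, h1, h3], fun h => ⟨h2 h.1, h4 h.2.1, by
      rw [h1, h3]; exact h.2.2⟩⟩

/-- `a[j] := e(j)` for all `j` below the content of register `1`; the index `j` is in
register `2`. -/
def tab (a : ℕ) (e : Expr) : Cmd := .forTo 2 1 (.write a ♯2 e)

theorem tab_runs {w S : ℕ} (hw : 1 < wordCap w) (hS : S ≤ wordCap w) {a : ℕ} {e : Expr}
    {s : State} {N t : ℕ} (hN : s.var 1 = N) (hNS : N < S) (hr : e.reads a = false)
    (hOK : ∀ j < N, e.OK w S (s.setVar 2 j)) (ht : (N + 2) * (e.cost + 11) ≤ t) :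
    Runs w S (tab a e) s t fun s' =>
      (∀ j < N, s'.arr a j = e.val (s.setVar 2 j)) ∧ ∀ j, N ≤ j → s'.arr a j = s.arr a j := by
  refine (Runs.forTo hw hN (fun j s' => (∀ k < j, s'.arr a k = e.val (s.setVar 2 k)) ∧
    ∀ k, j ≤ k → s'.arr a k = s.arr a k) (by decide) rfl rfl (by omega) (by simp) ?_ ?_)
  · rintro j s' hj hf hi ⟨h1, h2⟩
    have hv : s'.var = (s.setVar 2 j).var := by
      funext x
      by_cases hx : x = 2
      · subst hx; simp [hi]
      · simp only [State.var_setVar, if_neg hx]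
        exact hf.var x (by simp [Cmd.modV]; omega)
    have hc := Expr.val_congr (w := w) (S := S) (e := e) hv fun b hb => hf.arr b (by
      simp only [Cmd.modA, Bool.false_or, beq_eq_false_iff_ne]
      rintro rfl; simp [hr] at hb)
    refine ⟨trivial, hc.2 (hOK j hj), by simp; omega, fun k hk => ?_, fun k hk => ?_⟩
    · simp only [State.arr_setVar, Expr.val_var, hi, State.arr_setArr_apply, true_and, hc.1]
      split_ifs with h
      · rw [h]
      · exact h1 k (by omega)
    · simp only [State.arr_setVar, Expr.val_var, hi, State.arr_setArr_apply, true_and]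
      rw [if_neg (by omega)]
      exact h2 k (by omega)
  · simp only [Cmd.cost, Expr.cost]
    calc _ = (N + 2) * (e.cost + 11) := by ring
      _ ≤ _ := ht

/-! ### Renaming registers and arrays -/

/-- The expression with all registers and arrays renumbered upwards by `K`. -/
def Expr.shift (K : ℕ) : Expr → Expr
  | .const k => .const k
  | .var x => .var (x + K)
  | .read a e => .read (a + K) (e.shift K)
  | .op o e₁ e₂ => .op o (e₁.shift K) (e₂.shift K)

/-- The program with all registers and arrays renumbered upwards by `K`. -/
def Cmd.shift (K : ℕ) : Cmd → Cmd
  | .skip => .skip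
  | .assign x e => .assign (x + K) (e.shift K)
  | .write a i e => .write (a + K) (i.shift K) (e.shift K)
  | .seq p q => .seq (p.shift K) (q.shift K)
  | .ite e p q => .ite (e.shift K) (p.shift K) (q.shift K)
  | .loop e p => .loop (e.shift K) (p.shift K)

/-- State `r` contains a copy of state `s`, moved up by `K`. -/
def ShiftRel (K : ℕ) (s r : State) : Prop :=
  (∀ x, r.var (x + K) = s.var x) ∧ ∀ a, r.arr (a + K) = s.arr a

theorem Expr.cost_shift (K : ℕ) (e : Expr) : (e.shift K).cost = e.cost := by
  induction e <;> simp_all [Expr.shift]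

theorem Expr.shift_eval {w S S' K : ℕ} (hS : S ≤ S') {s r : State} (h : ShiftRel K s r)
    {e : Expr} (he : e.Safe w S s) :
    (e.shift K).Safe w S' r ∧ (e.shift K).eval w r = e.eval w s := by
  induction e with
  | const k => exact ⟨trivial, rfl⟩
  | var x => exact ⟨trivial, h.1 x⟩
  | read a e ih =>
    obtain ⟨h1, h2⟩ := ih he.1
    exact ⟨⟨h1, by rw [h2]; exact he.2.trans_le hS⟩, by
      simp only [Expr.shift, Expr.eval, h2, h.2]⟩
  | op o e₁ e₂ ih₁ ih₂ =>
    obtain ⟨h1, h2⟩ := ih₁ he.1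
    obtain ⟨h3, h4⟩ := ih₂ he.2
    exact ⟨⟨h1, h3⟩, by simp only [Expr.shift, Expr.eval, h2, h4]⟩

/-- A renumbered program simulates the original one and leaves the numbers below `K` alone. -/
theorem Exec.shift {w S S' K : ℕ} (hS : S ≤ S') {p : Cmd} {s s' : State} {t : ℕ}
    (h : Exec w S p s t s') : ∀ {r : State}, ShiftRel K s r →
      ∃ r', Exec w S' (p.shift K) r t r' ∧ ShiftRel K s' r' ∧
        (∀ x < K, r'.var x = r.var x) ∧ ∀ a < K, r'.arr a = r.arr a := by
  induction h with
  | skip s => intro r hr; exact ⟨r, .skip r, hr, fun _ _ => rfl, fun _ _ => rfl⟩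
  | assign s x e he =>
    intro r hr
    obtain ⟨h1, h2⟩ := Expr.shift_eval hS hr he
    have hx := Exec.assign r (x + K) _ h1
    rw [Expr.cost_shift] at hx
    refine ⟨_, hx,
      ⟨fun y => ?_, fun a => hr.2 a⟩, fun y hy => ?_, fun _ _ => rfl⟩
    · simp [h2, hr.1]
    · simp only [State.var_setVar]; rw [if_neg (by omega)]
  | write s a i e hi he hlt =>
    intro r hr
    obtain ⟨h1, h2⟩ := Expr.shift_eval hS hr hi
    obtain ⟨h3, h4⟩ := Expr.shift_eval hS hr he
    have hx := Exec.write r (a + K) _ _ h1 h3 (by rw [h2]; exact hlt.trans_le hS)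
    rw [Expr.cost_shift, Expr.cost_shift] at hx
    refine ⟨_, hx,
      ⟨fun y => hr.1 y, fun b => ?_⟩, fun _ _ => rfl, fun b hb => ?_⟩
    · simp [State.arr_setArr, h2, h4, hr.2]
    · rw [State.arr_setArr, if_neg (by omega)]
  | seq _ _ ih ih' =>
    intro r hr
    obtain ⟨r1, h1, h2, h3, h4⟩ := ih hr
    obtain ⟨r2, h5, h6, h7, h8⟩ := ih' h2
    exact ⟨r2, .seq h1 h5, h6, fun x hx => (h7 x hx).trans (h3 x hx),
      fun x hx => (h8 x hx).trans (h4 x hx)⟩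
  | @ite_true e p q s s' t hs he _ ih =>
    intro r hr
    obtain ⟨h1, h2⟩ := Expr.shift_eval hS hr hs
    obtain ⟨r1, h3, h4⟩ := ih hr
    have hx := Exec.ite_true (q := Cmd.shift K q) h1 (by rwa [h2]) h3
    rw [Expr.cost_shift] at hx
    exact ⟨r1, hx, h4⟩
  | @ite_false e p q s s' t hs he _ ih =>
    intro r hr
    obtain ⟨h1, h2⟩ := Expr.shift_eval hS hr hs
    obtain ⟨r1, h3, h4⟩ := ih hr
    have hx := Exec.ite_false (p := Cmd.shift K p) h1 (by rwa [h2]) h3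
    rw [Expr.cost_shift] at hx
    exact ⟨r1, hx, h4⟩
  | loop_true hs he _ _ ih ih' =>
    intro r hr
    obtain ⟨h1, h2⟩ := Expr.shift_eval hS hr hs
    obtain ⟨r1, h3, h4, h5, h6⟩ := ih hr
    obtain ⟨r2, h7, h8, h9, h10⟩ := ih' h4
    have hx := Exec.loop_true h1 (by rwa [h2]) h3 h7
    rw [Expr.cost_shift] at hx
    exact ⟨r2, hx, h8,
      fun x hx => (h9 x hx).trans (h5 x hx), fun x hx => (h10 x hx).trans (h6 x hx)⟩
  | @loop_false e p s hs he =>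
    intro r hr
    obtain ⟨h1, h2⟩ := Expr.shift_eval hS hr hs
    have hx := Exec.loop_false (p := Cmd.shift K p) h1 (by rwa [h2])
    rw [Expr.cost_shift] at hx
    exact ⟨r, hx, hr, fun _ _ => rfl, fun _ _ => rfl⟩

/-! ### Stable counting sort -/

/-- The permutation `p` of `0, …, N - 1` sorts the keys stably. -/
structure StablePerm (N : ℕ) (key p : ℕ → ℕ) : Prop where
  lt : ∀ i < N, p i < N
  sorted : ∀ i j, i < j → j < N → key (p i) < key (p j) ∨ key (p i) = key (p j) ∧ p i < p j

/-- The place at which stable sorting puts the element with index `j`. -/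
def sortPos (N : ℕ) (key : ℕ → ℕ) (j : ℕ) : ℕ :=
  Nat.count (fun i => key i < key j) N + Nat.count (fun i => key i = key j) j

theorem count_lt_succ (key : ℕ → ℕ) (v N : ℕ) :
    Nat.count (fun i => key i < v + 1) N =
      Nat.count (fun i => key i < v) N + Nat.count (fun i => key i = v) N := by
  induction N with
  | zero => simp
  | succ N ih =>
    simp only [Nat.count_succ, ih]
    split_ifs <;> omega

theorem sortPos_lt_count {N : ℕ} {key : ℕ → ℕ} {j : ℕ} (hj : j < N) :
    sortPos N key j < Nat.count (fun i => key i < key j + 1) N := by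
  rw [count_lt_succ, sortPos]
  have := Nat.count_strict_mono (p := fun i => key i = key j) rfl hj
  omega

theorem sortPos_lt {N : ℕ} {key : ℕ → ℕ} {j : ℕ} (hj : j < N) : sortPos N key j < N :=
  (sortPos_lt_count hj).trans_le (Nat.count_le _)

theorem sortPos_mono {N : ℕ} {key : ℕ → ℕ} {i j : ℕ} (hi : i < N)
    (h : key i < key j ∨ key i = key j ∧ i < j) : sortPos N key i < sortPos N key j := by
  rcases h with h | ⟨h, hij⟩
  · refine (sortPos_lt_count hi).trans_le (le_trans ?_ (Nat.le_add_right _ _))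
    exact Nat.count_mono_left fun x hx => by omega
  · have := Nat.count_strict_mono (p := fun x => key x = key j) h hij
    simp only [sortPos, h]; omega

theorem sortPos_inj {N : ℕ} {key : ℕ → ℕ} {i j : ℕ} (hi : i < N) (hj : j < N)
    (h : sortPos N key i = sortPos N key j) : i = j := by
  by_contra hne
  rcases lt_trichotomy (key i) (key j) with h1 | h1 | h1
  · exact (sortPos_mono hi (.inl h1)).ne h
  · rcases Nat.lt_or_gt_of_ne hne with h2 | h2
    · exact (sortPos_mono hi (.inr ⟨h1, h2⟩)).ne h
    · exact (sortPos_mono hj (.inr ⟨h1.symm, h2⟩)).ne' h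
  · exact (sortPos_mono hj (.inl h1)).ne' h

/-- An injective map of an initial segment into itself is onto. -/
theorem exists_of_injOn {N : ℕ} {f : ℕ → ℕ} (hf : ∀ i < N, f i < N)
    (hinj : ∀ i < N, ∀ j < N, f i = f j → i = j) {k : ℕ} (hk : k < N) : ∃ i < N, f i = k := by
  have h := Finset.surjOn_of_injOn_of_card_le (s := Finset.range N) (t := Finset.range N) f
    (fun i hi => by simpa using hf i (by simpa using hi))
    (fun i hi j hj h => hinj i (by simpa using hi) j (by simpa using hj) h) le_rfl
  obtain ⟨i, hi, h⟩ := h (show k ∈ (↑(Finset.range N) : Set ℕ) by simpa using hk)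
  exact ⟨i, by simpa using hi, h⟩

/-- Sorting by `sortPos` is a stable permutation. -/
theorem exists_stablePerm (N : ℕ) (key : ℕ → ℕ) :
    ∃ p, StablePerm N key p ∧ ∀ i < N, sortPos N key (p i) = i := by
  have h : ∀ k, ∃ i, k < N → i < N ∧ sortPos N key i = k := fun k => by
    by_cases hk : k < N
    · obtain ⟨i, hi⟩ := exists_of_injOn (f := sortPos N key) (fun i hi => sortPos_lt hi)
        (fun i hi j hj h => sortPos_inj hi hj h) hk
      exact ⟨i, fun _ => hi⟩
    · exact ⟨0, fun h => absurd h hk⟩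
  choose p hp using h
  refine ⟨p, ⟨fun i hi => (hp i hi).1, fun i j hij hj => ?_⟩, fun i hi => (hp i hi).2⟩
  have hi := hij.trans hj
  by_contra hc
  have hne : p i ≠ p j := fun h => by
    have := (hp i hi).2; rw [h, (hp j hj).2] at this; omega
  have := sortPos_mono (N := N) (key := key) (i := p j) (j := p i) (hp j hj).1 (by omega)
  rw [(hp i hi).2, (hp j hj).2] at this
  omega

theorem StablePerm.inj {N : ℕ} {key p : ℕ → ℕ} (h : StablePerm N key p) {i j : ℕ} (hi : i < N)
    (hj : j < N) (hij : p i = p j) : i = j := by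
  by_contra hne
  rcases Nat.lt_or_gt_of_ne hne with h1 | h1
  · have := h.sorted i j h1 hj; rw [hij] at this; omega
  · have := h.sorted j i h1 hi; rw [hij] at this; omega

theorem StablePerm.surj {N : ℕ} {key p : ℕ → ℕ} (h : StablePerm N key p) {k : ℕ} (hk : k < N) :
    ∃ i < N, p i = k :=
  exists_of_injOn h.lt (fun _ hi _ hj => h.inj hi hj) hk

/-- Stable counting sort. Register `1` holds the number of elements and register `3` the maximal
key; array `3` holds the elements and array `4` their keys. Array `5` is used for the counters
and array `6` for the result, which is copied back to array `3`. -/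
def countingSort : Cmd :=
  4 ≔ ♯3 + 2 ;;
  .forTo 2 4 (.write 5 ♯2 0) ;;
  .forTo 2 1 (.write 5 (4 ⊙ ♯2 + 1) (5 ⊙ (4 ⊙ ♯2 + 1) + 1)) ;;
  4 ≔ ♯3 + 1 ;;
  .forTo 2 4 (.write 5 (♯2 + 1) (5 ⊙ (♯2 + 1) + 5 ⊙ ♯2)) ;;
  .forTo 2 1 (.write 6 (5 ⊙ (4 ⊙ ♯2)) (3 ⊙ ♯2) ;;
    .write 5 (4 ⊙ ♯2) (5 ⊙ (4 ⊙ ♯2) + 1)) ;;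
  tab 3 (6 ⊙ ♯2)

theorem countingSort_runs {w S : ℕ} (hw : 1 < wordCap w) (hS : S ≤ wordCap w) {s : State}
    {N K : ℕ} (hN : s.var 1 = N) (hK : s.var 3 = K) (hNS : N < S) (hKS : K + 2 < S)
    (hkey : ∀ i < N, s.arr 4 i ≤ K) :
    Runs w S countingSort s (200 * (N + K + 3)) fun s' =>
      ∃ p, StablePerm N (s.arr 4) p ∧ ∀ i < N, s'.arr 3 i = s.arr 3 (p i) := by
  obtain ⟨p, hp, hpos⟩ := exists_stablePerm N (s.arr 4)
  have hcN : ∀ (q : ℕ → Prop) [DecidablePred q] (j : ℕ), Nat.count q j ≤ j :=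
    fun q _ j => Nat.count_le q
  refine Runs.seq (P := fun s1 => s1.var 4 = K + 2) (t₁ := 10)
    (Cmd.wp.runs hw ?_ (by simp [Cmd.cost])) (by omega) fun s1 f1 h1 => ?_
  · simp [Cmd.wp, hK]; omega
  refine Runs.seq (t₁ := 20 * (K + 4)) (Runs.forTo hw h1 (fun j s' => ∀ v < j, s'.arr 5 v = 0)
    (by decide) rfl rfl (by omega) (by simp) ?_ ?_) (by omega) fun s2 f2 h2 => ?_
  · intro j s' hj hf hi hJ
    simp only [Cmd.wp, Expr.OK_var, Expr.OK_ofNat, Expr.val_var, Expr.val_ofNat, hi,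
      State.arr_setVar, State.arr_setArr_apply, true_and]
    refine ⟨by omega, by omega, fun v hv => ?_⟩
    split_ifs with h
    · rfl
    · exact hJ v (by omega)
  · simp [Cmd.cost]; omega
  have e2 : s2.arr 4 = s.arr 4 := (f2.arr 4 rfl).trans (f1.arr 4 rfl)
  have n2 : s2.var 1 = N := ((f2.var 1 rfl).trans (f1.var 1 rfl)).trans hN
  refine Runs.seq (t₁ := 30 * (N + 2)) (Runs.forTo hw n2 (fun j s' => s'.arr 5 0 = 0 ∧
    ∀ v ≤ K, s'.arr 5 (v + 1) = Nat.count (fun i => s.arr 4 i = v) j)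
    (by decide) rfl rfl (by omega) ?_ ?_ ?_) (by omega) fun s3 f3 h3 => ?_
  · exact ⟨h2 0 (by omega), fun v hv => by simpa using h2 (v + 1) (by omega)⟩
  · rintro j s' hj hf hi ⟨hJ0, hJ⟩
    have e : s'.arr 4 = s.arr 4 := (hf.arr 4 rfl).trans e2
    have := hkey j hj
    have hc := hcN (fun i => s.arr 4 i = s.arr 4 j) j
    simp only [Cmd.wp, Expr.OK_add, Expr.OK_read, Expr.val_add, Expr.val_read, Expr.OK_var,
      Expr.OK_ofNat, Expr.val_var, Expr.val_ofNat, hi, e, hJ _ this,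
      State.arr_setVar, State.arr_setArr_apply, true_and]
    refine ⟨by omega, by omega, by omega, by simpa using hJ0, fun v hv => ?_⟩
    rw [Nat.count_succ]
    split_ifs with h h' h'
    · simp at h; subst h; rfl
    · omega
    · omega
    · simpa using hJ v hv
  · simp [Cmd.cost]; omega
  refine Runs.seq (P := fun s1 => s1.var 4 = K + 1 ∧ s1.arr = s3.arr) (t₁ := 10)
    (Cmd.wp.runs hw ?_ (by simp [Cmd.cost])) (by omega) fun s4 f4 h4 => ?_
  · have : s3.var 3 = K := by rw [f3.var 3 rfl, f2.var 3 rfl, f1.var 3 rfl, hK]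
    simp [Cmd.wp, this]; omega
  refine Runs.seq (t₁ := 30 * (K + 3)) (Runs.forTo hw h4.1 (fun j s' =>
    (∀ v ≤ j, s'.arr 5 v = Nat.count (fun i => s.arr 4 i < v) N) ∧
    ∀ v, j ≤ v → v ≤ K → s'.arr 5 (v + 1) = Nat.count (fun i => s.arr 4 i = v) N)
    (by decide) rfl rfl (by omega) ?_ ?_ ?_) (by omega) fun s5 f5 h5 => ?_
  · simp only [State.arr_setVar, h4.2]
    refine ⟨fun v hv => ?_, fun v _ hv => h3.2 v hv⟩
    obtain rfl : v = 0 := by omega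
    simpa using h3.1
  · rintro j s' hj hf hi ⟨hJ0, hJ⟩
    have hc := hcN (fun i => s.arr 4 i < j + 1) N
    rw [count_lt_succ] at hc
    simp only [Cmd.wp, Expr.OK_add, Expr.OK_read, Expr.val_add, Expr.val_read, Expr.OK_var,
      Expr.OK_ofNat, Expr.val_var, Expr.val_ofNat, hi, hJ0 j le_rfl, hJ j le_rfl (by omega),
      State.arr_setVar, State.arr_setArr_apply, true_and]
    refine ⟨by omega, by omega, by omega, fun v hv => ?_, fun v hv hvK => ?_⟩
    · split_ifs with h
      · subst h; rw [count_lt_succ]; omega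
      · exact hJ0 v (by omega)
    · rw [if_neg (by omega)]; exact hJ v (by omega) hvK
  · simp [Cmd.cost]; omega
  have e5 : s5.arr 4 = s.arr 4 := by rw [f5.arr 4 rfl, f4.arr 4 rfl, f3.arr 4 rfl, e2]
  have x5 : s5.arr 3 = s.arr 3 := by
    rw [f5.arr 3 rfl, f4.arr 3 rfl, f3.arr 3 rfl, f2.arr 3 rfl, f1.arr 3 rfl]
  have n5 : s5.var 1 = N := by rw [f5.var 1 rfl, f4.var 1 rfl, f3.var 1 rfl, n2]
  refine Runs.seq (t₁ := 40 * (N + 2)) (Runs.forTo hw n5 (fun j s' =>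
    (∀ v ≤ K, s'.arr 5 v = Nat.count (fun i => s.arr 4 i < v) N +
      Nat.count (fun i => s.arr 4 i = v) j) ∧
    ∀ i < j, s'.arr 6 (sortPos N (s.arr 4) i) = s.arr 3 i)
    (by decide) rfl rfl (by omega) ?_ ?_ ?_) (by omega) fun s6 f6 h6 => ?_
  · exact ⟨fun v hv => by simpa using h5.1 v (by omega), fun i hi => by omega⟩
  · rintro j s' hj hf hi ⟨hJ0, hJ⟩
    have e : s'.arr 4 = s.arr 4 := (hf.arr 4 rfl).trans e5
    have ex : s'.arr 3 = s.arr 3 := (hf.arr 3 rfl).trans x5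
    have hk := hkey j hj
    have hlt := sortPos_lt (key := s.arr 4) hj
    have hval : s'.arr 5 (s.arr 4 j) = sortPos N (s.arr 4) j := hJ0 _ hk
    simp only [Cmd.wp, Expr.OK_add, Expr.OK_read, Expr.val_add, Expr.val_read, Expr.OK_var,
      Expr.OK_ofNat, Expr.val_var, Expr.val_ofNat, State.var_setArr, hi, e, ex, hval,
      State.arr_setVar, State.arr_setArr_apply, true_and, Nat.reduceEqDiff,
      false_and, if_false]
    refine ⟨by omega, by omega, by omega, by omega, by omega, by omega, fun v hv => ?_,
      fun i hij => ?_⟩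
    · rw [Nat.count_succ]
      split_ifs with h h' h'
      · subst h; simp only [sortPos]; omega
      · omega
      · omega
      · exact hJ0 v hv
    · split_ifs with h
      · rw [sortPos_inj (by omega) hj h]
      · refine hJ i ?_
        by_contra hc
        exact h (by rw [show i = j by omega])
  · simp [Cmd.cost]; omega
  refine (tab_runs hw hS (N := N) (by rw [f6.var 1 rfl, n5]) hNS rfl (by simp; omega)
    (by simp; omega)).imp le_rfl fun s7 _ h7 => ⟨p, hp, fun i hi => ?_⟩
  rw [h7.1 i hi]
  simp only [Expr.val_read, Expr.val_var, State.arr_setVar, State.var_setVar, if_true]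
  conv_lhs => rw [← hpos i hi]
  exact h6.2 _ (hp.lt i hi)

/-- Sort the elements in array `3` stably by the key `e`, an expression in which register `2`
is the index of the element. -/
def sortBy (e : Expr) : Cmd := tab 4 e ;; countingSort

theorem sortBy_runs {w S : ℕ} (hw : 1 < wordCap w) (hS : S ≤ wordCap w) {s : State} {e : Expr}
    {N K t : ℕ} {key : ℕ → ℕ} (hN : s.var 1 = N) (hK : s.var 3 = K) (hNS : N < S)
    (hKS : K + 2 < S) (hr : e.reads 4 = false) (hOK : ∀ j < N, e.OK w S (s.setVar 2 j))
    (hval : ∀ j < N, e.val (s.setVar 2 j) = key (s.arr 3 j))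
    (hkey : ∀ i < N, key (s.arr 3 i) ≤ K)
    (ht : (N + 2) * (e.cost + 11) + 200 * (N + K + 3) ≤ t) :
    Runs w S (sortBy e) s t fun s' =>
      ∃ p, StablePerm N (fun i => key (s.arr 3 i)) p ∧ ∀ i < N, s'.arr 3 i = s.arr 3 (p i) := by
  refine Runs.seq (tab_runs hw hS hN hNS hr hOK le_rfl) (by omega) fun s1 f1 h1 => ?_
  have h1' : ∀ j < N, s1.arr 4 j = key (s.arr 3 j) := fun j hj => (h1.1 j hj).trans (hval j hj)
  refine (countingSort_runs hw hS (N := N) (K := K) (by rw [f1.var 1 rfl, hN])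
    (by rw [f1.var 3 rfl, hK]) hNS hKS fun i hi => by rw [h1' i hi]; exact hkey i hi).imp
    (Nat.le_sub_of_add_le' ht) ?_
  rintro s2 - ⟨p, hp, h2⟩
  refine ⟨p, ⟨hp.lt, fun i j hij hj => ?_⟩, fun i hi => by rw [h2 i hi, f1.arr 3 rfl]⟩
  have := hp.sorted i j hij hj
  have ei := h1' (p i) (hp.lt i (hij.trans hj))
  have ej := h1' (p j) (hp.lt j hj)
  rwa [ei, ej] at this

/-! ### Suffixes of strings over the positive integers -/

/-- `T` is a string of length `n` over the positive integers, continued by zeros. -/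
structure IsStr (T : ℕ → ℕ) (n : ℕ) : Prop where
  pos : ∀ i < n, 0 < T i
  zero : ∀ i, n ≤ i → T i = 0

/-- Lexicographic order of the suffixes that start at `i` and `j`. -/
def LexLt (T : ℕ → ℕ) (i j : ℕ) : Prop :=
  ∃ k, (∀ m < k, T (i + m) = T (j + m)) ∧ T (i + k) < T (j + k)

theorem LexLt.irrefl {T : ℕ → ℕ} {i : ℕ} : ¬ LexLt T i i := fun ⟨_, _, h⟩ => lt_irrefl _ h

theorem LexLt.trans {T : ℕ → ℕ} {i j k : ℕ} (h : LexLt T i j) (h' : LexLt T j k) :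
    LexLt T i k := by
  obtain ⟨a, ha, ha'⟩ := h
  obtain ⟨b, hb, hb'⟩ := h'
  rcases lt_trichotomy a b with h | rfl | h
  · exact ⟨a, fun m hm => (ha m hm).trans (hb m (hm.trans h)), by rw [← hb a h]; exact ha'⟩
  · exact ⟨a, fun m hm => (ha m hm).trans (hb m hm), ha'.trans hb'⟩
  · exact ⟨b, fun m hm => (ha m (hm.trans h)).trans (hb m hm), by rw [ha b h]; exact hb'⟩

theorem LexLt.asymm {T : ℕ → ℕ} {i j : ℕ} (h : LexLt T i j) : ¬ LexLt T j i :=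
  fun h' => LexLt.irrefl (h.trans h')

theorem lexLt_cons {T : ℕ → ℕ} {i j : ℕ} :
    LexLt T i j ↔ T i < T j ∨ T i = T j ∧ LexLt T (i + 1) (j + 1) := by
  constructor
  · rintro ⟨k, hk, h⟩
    cases k with
    | zero => exact .inl h
    | succ k =>
      refine .inr ⟨hk 0 (by omega), k, fun m hm => ?_, ?_⟩
      · have := hk (m + 1) (by omega)
        rwa [← Nat.add_assoc, ← Nat.add_assoc, Nat.add_right_comm i, Nat.add_right_comm j] at this
      · rwa [← Nat.add_assoc, ← Nat.add_assoc, Nat.add_right_comm i, Nat.add_right_comm j] at h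
  · rintro (h | ⟨h0, k, hk, h⟩)
    · exact ⟨0, fun m hm => by omega, h⟩
    · refine ⟨k + 1, fun m hm => ?_, ?_⟩
      · cases m with
        | zero => exact h0
        | succ m =>
          have := hk m (by omega)
          rwa [Nat.add_right_comm i, Nat.add_right_comm j] at this
      · rwa [Nat.add_right_comm i, Nat.add_right_comm j] at h

theorem IsStr.exists_ne {T : ℕ → ℕ} {n p q : ℕ} (hT : IsStr T n) (hpq : p < q) (hq : q ≤ n) :
    T (p + (n - q)) ≠ T (q + (n - q)) := by
  rw [hT.zero (q + (n - q)) (by omega)]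
  exact (hT.pos _ (by omega)).ne'

theorem lexLt_or_lexLt_of_ne {T : ℕ → ℕ} {p q k : ℕ} (h : T (p + k) ≠ T (q + k)) :
    LexLt T p q ∨ LexLt T q p := by
  classical
  have hex : ∃ k, T (p + k) ≠ T (q + k) := ⟨k, h⟩
  have h1 := Nat.find_spec hex
  have h2 : ∀ m < Nat.find hex, T (p + m) = T (q + m) := fun m hm => by
    simpa using Nat.find_min hex hm
  rcases Nat.lt_or_gt_of_ne h1 with h3 | h3
  · exact .inl ⟨_, h2, h3⟩
  · exact .inr ⟨_, fun m hm => (h2 m hm).symm, h3⟩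

theorem IsStr.lexLt_or {T : ℕ → ℕ} {n p q : ℕ} (hT : IsStr T n) (hp : p ≤ n) (hq : q ≤ n)
    (hne : p ≠ q) : LexLt T p q ∨ LexLt T q p := by
  rcases Nat.lt_or_gt_of_ne hne with h | h
  · exact lexLt_or_lexLt_of_ne (hT.exists_ne h hq)
  · exact (lexLt_or_lexLt_of_ne (hT.exists_ne h hp)).symm

theorem IsStr.lexLt_end {T : ℕ → ℕ} {n p : ℕ} (hT : IsStr T n) (hp : p < n) : LexLt T n p :=
  lexLt_cons.2 (.inl (by rw [hT.zero n le_rfl]; exact hT.pos p hp))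

/-- `sa` is the suffix array of `T`. The empty suffix is included, so that there are `n + 1`
entries, the first of which is `n`. -/
structure IsSA (T : ℕ → ℕ) (n : ℕ) (sa : ℕ → ℕ) : Prop where
  le : ∀ i ≤ n, sa i ≤ n
  lt : ∀ i j, i < j → j ≤ n → LexLt T (sa i) (sa j)

theorem IsSA.inj {T sa : ℕ → ℕ} {n i j : ℕ} (h : IsSA T n sa) (hi : i ≤ n) (hj : j ≤ n)
    (hij : sa i = sa j) : i = j := by
  by_contra hne
  rcases Nat.lt_or_gt_of_ne hne with h1 | h1
  · have := h.lt _ _ h1 hj; rw [hij] at this; exact LexLt.irrefl this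
  · have := h.lt _ _ h1 hi; rw [hij] at this; exact LexLt.irrefl this

theorem IsSA.surj {T sa : ℕ → ℕ} {n p : ℕ} (h : IsSA T n sa) (hp : p ≤ n) :
    ∃ i ≤ n, sa i = p := by
  obtain ⟨i, hi, hip⟩ := exists_of_injOn (N := n + 1) (f := sa)
    (fun i hi => Nat.lt_succ_of_le (h.le i (by omega)))
    (fun i hi j hj => h.inj (by omega) (by omega)) (Nat.lt_succ_of_le hp)
  exact ⟨i, by omega, hip⟩

theorem IsSA.zero {T sa : ℕ → ℕ} {n : ℕ} (h : IsSA T n sa) (hT : IsStr T n) : sa 0 = n := by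
  obtain ⟨i, hi, hin⟩ := h.surj le_rfl
  rcases Nat.eq_zero_or_pos i with rfl | hpos
  · exact hin
  · have h1 := h.lt 0 i hpos hi
    rw [hin] at h1
    by_contra hne
    exact h1.asymm (hT.lexLt_end (lt_of_le_of_ne (h.le 0 (by omega)) hne))

/-! ### Naming the entries of a sorted sequence -/

/-- The names `1, 2, …` given to the entries of a sorted sequence, equal entries getting the
same name. -/
def names {κ : Type*} [DecidableEq κ] (key : ℕ → κ) : ℕ → ℕ
  | 0 => 1
  | i + 1 => names key i + if key (i + 1) = key i then 0 else 1

section names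
variable {κ : Type*} [LinearOrder κ] {key : ℕ → κ} {N : ℕ}

theorem names_pos (key : ℕ → κ) (i : ℕ) : 0 < names key i := by
  induction i with
  | zero => simp [names]
  | succ i ih => simp only [names]; omega

theorem names_le (key : ℕ → κ) (i : ℕ) : names key i ≤ i + 1 := by
  induction i with
  | zero => simp [names]
  | succ i ih => simp only [names]; split_ifs <;> omega

theorem names_mono (key : ℕ → κ) {i j : ℕ} (h : i ≤ j) : names key i ≤ names key j := by
  induction h with
  | refl => exact le_rfl
  | step h ih => exact ih.trans (by simp [names])

theorem names_eq_iff (hs : ∀ i j, i < j → j < N → key i ≤ key j) {i j : ℕ} (hij : i ≤ j)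
    (hj : j < N) : names key i = names key j ↔ key i = key j := by
  induction j with
  | zero => obtain rfl : i = 0 := by omega
            simp
  | succ j ih =>
    rcases Nat.eq_or_lt_of_le hij with rfl | hlt
    · simp
    · have ih := ih (by omega) (by omega)
      have hm := names_mono key (show i ≤ j by omega)
      have h1 : key i ≤ key j := by
        rcases Nat.eq_or_lt_of_le (show i ≤ j by omega) with rfl | h
        · exact le_rfl
        · exact hs _ _ h (by omega)
      have h2 := hs j (j + 1) (by omega) hj
      simp only [names]
      split_ifs with h
      · rw [h]; simpa using ih
      · refine ⟨fun h' => by omega, fun h' => ?_⟩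
        exact absurd (le_antisymm (h' ▸ h1) h2) h

theorem names_lt_iff (hs : ∀ i j, i < j → j < N → key i ≤ key j) {i j : ℕ} (hi : i < N)
    (hj : j < N) : names key i < names key j ↔ key i < key j := by
  rcases Nat.lt_or_ge i j with h | h
  · have h1 := names_mono key h.le
    have h2 := hs i j h hj
    have h3 := names_eq_iff hs h.le hj
    constructor
    · intro h'; exact lt_of_le_of_ne h2 fun he => by rw [h3.2 he] at h'; omega
    · intro h'; exact lt_of_le_of_ne h1 fun he => h'.ne (h3.1 he)
  · have h1 := names_mono key h
    refine ⟨fun h' => by omega, fun h' => ?_⟩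
    rcases Nat.eq_or_lt_of_le h with rfl | h2
    · exact absurd h' (lt_irrefl _)
    · exact absurd h' (not_lt.2 (hs _ _ h2 hi))

theorem names_inj_iff (hs : ∀ i j, i < j → j < N → key i ≤ key j) {i j : ℕ} (hi : i < N)
    (hj : j < N) : names key i = names key j ↔ key i = key j := by
  rcases le_total i j with h | h
  · exact names_eq_iff hs h hj
  · rw [eq_comm, names_eq_iff hs h hi, eq_comm]

/-- Different neighbours get successive names. -/
theorem names_eq_succ (hs : ∀ i, i + 1 < N → key (i + 1) ≠ key i) {i : ℕ} (hi : i < N) :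
    names key i = i + 1 := by
  induction i with
  | zero => rfl
  | succ i ih => simp only [names]; rw [if_neg (hs i hi), ih (by omega)]

/-- If the name of an entry is as large as possible, so are those of all earlier entries. -/
theorem names_eq_succ_of_last (key : ℕ → κ) {i d : ℕ} (h : names key (i + d) = i + d + 1) :
    names key i = i + 1 := by
  induction d with
  | zero => exact h
  | succ d ih =>
    refine ih ?_
    have h1 := names_le key (i + d)
    rw [← Nat.add_assoc] at h
    simp only [names] at h
    split_ifs at h <;> omega

end names

/-- `X 0, …, X (N - 1)` lists the numbers satisfying `P` without repetition. -/
structure Enum (N : ℕ) (X : ℕ → ℕ) (P : ℕ → Prop) : Prop where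
  mem : ∀ i < N, P (X i)
  inj : ∀ i < N, ∀ j < N, X i = X j → i = j
  surj : ∀ x, P x → ∃ i < N, X i = x

theorem Enum.stablePerm {N : ℕ} {X X' key p : ℕ → ℕ} {P : ℕ → Prop} (h : Enum N X P)
    (hp : StablePerm N key p) (hX : ∀ i < N, X' i = X (p i)) : Enum N X' P where
  mem i hi := by rw [hX i hi]; exact h.mem _ (hp.lt i hi)
  inj i hi j hj hij := by
    rw [hX i hi, hX j hj] at hij
    exact hp.inj hi hj (h.inj _ (hp.lt i hi) _ (hp.lt j hj) hij)
  surj x hx := by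
    obtain ⟨k, hk, hkx⟩ := h.surj x hx
    obtain ⟨i, hi, hik⟩ := hp.surj hk
    exact ⟨i, hi, by rw [hX i hi, hik, hkx]⟩

/-! ### Reduction of suffix sorting to two thirds of the suffixes -/

/-- Number of sample positions, i.e. of `p ≤ n` that are not divisible by `3`. -/
def numSample (n : ℕ) : ℕ := (n + 2) / 3 + (n + 1) / 3

/-- The sample positions, first those congruent to `1` modulo `3`, then those congruent to
`2`. -/
def sample (n t : ℕ) : ℕ := if t < (n + 2) / 3 then 3 * t + 1 else 3 * (t - (n + 2) / 3) + 2

/-- The inverse of `sample`. -/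
def sampleIdx (n p : ℕ) : ℕ := if p % 3 = 1 then p / 3 else p / 3 + (n + 2) / 3

/-- Being a sample position. -/
def IsSample (n p : ℕ) : Prop := p ≤ n ∧ p % 3 ≠ 0

theorem isSample_sample {n t : ℕ} (ht : t < numSample n) : IsSample n (sample n t) := by
  unfold numSample at ht
  unfold IsSample sample
  split_ifs <;> constructor <;> omega

theorem sampleIdx_sample {n t : ℕ} : sampleIdx n (sample n t) = t := by
  unfold sampleIdx sample
  split_ifs <;> omega

theorem sampleIdx_lt {n p : ℕ} (hp : IsSample n p) : sampleIdx n p < numSample n := by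
  obtain ⟨h1, h2⟩ := hp
  unfold sampleIdx numSample
  split_ifs <;> omega

theorem sample_sampleIdx {n p : ℕ} (hp : IsSample n p) : sample n (sampleIdx n p) = p := by
  obtain ⟨h1, h2⟩ := hp
  unfold sampleIdx sample
  split_ifs <;> omega

theorem enum_sample (n : ℕ) : Enum (numSample n) (sample n) (IsSample n) where
  mem _ ht := isSample_sample ht
  inj t _ u _ h := by rw [← sampleIdx_sample (n := n) (t := t), h, sampleIdx_sample]
  surj p hp := ⟨_, sampleIdx_lt hp, sample_sampleIdx hp⟩

/-- The three symbols from position `p` on, ordered lexicographically. -/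
def trip (T : ℕ → ℕ) (p : ℕ) : ℕ ×ₗ ℕ ×ₗ ℕ := toLex (T p, toLex (T (p + 1), T (p + 2)))

theorem trip_lt_iff {T : ℕ → ℕ} {p q : ℕ} : trip T p < trip T q ↔
    T p < T q ∨ T p = T q ∧ (T (p + 1) < T (q + 1) ∨ T (p + 1) = T (q + 1) ∧
      T (p + 2) < T (q + 2)) := by
  simp only [trip, Prod.Lex.toLex_lt_toLex]

theorem trip_le_iff {T : ℕ → ℕ} {p q : ℕ} : trip T p ≤ trip T q ↔
    T p < T q ∨ T p = T q ∧ (T (p + 1) < T (q + 1) ∨ T (p + 1) = T (q + 1) ∧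
      T (p + 2) ≤ T (q + 2)) := by
  simp only [trip, Prod.Lex.toLex_le_toLex]

theorem trip_eq_iff {T : ℕ → ℕ} {p q : ℕ} : trip T p = trip T q ↔
    T p = T q ∧ T (p + 1) = T (q + 1) ∧ T (p + 2) = T (q + 2) := by
  simp [trip]

/-- A triple that reaches the end of the string occurs only once. -/
theorem IsStr.eq_of_trip {T : ℕ → ℕ} {n p q : ℕ} (hT : IsStr T n) (hp : p ≤ n) (hq : q ≤ n)
    (hpn : n < p + 3) (h : trip T p = trip T q) : p = q := by
  obtain ⟨h0, h1, h2⟩ := trip_eq_iff.1 h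
  have z : ∀ x, T x = 0 ↔ n ≤ x := fun x =>
    ⟨fun hx => by by_contra hc; exact (hT.pos x (by omega)).ne' hx, hT.zero x⟩
  have z0 := z p; have z1 := z (p + 1); have z2 := z (p + 2)
  have y0 := z q; have y1 := z (q + 1); have y2 := z (q + 2)
  omega

/-- `R` is the string of the names of the triples at the sample positions of `T`. -/
structure IsReduct (T : ℕ → ℕ) (n : ℕ) (R : ℕ → ℕ) : Prop where
  str : IsStr R (numSample n)
  le : ∀ t, R t ≤ numSample n
  lt : ∀ t < numSample n, ∀ u < numSample n, R t < R u → trip T (sample n t) < trip T (sample n u)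
  eq : ∀ t < numSample n, ∀ u < numSample n, R t = R u → trip T (sample n t) = trip T (sample n u)

theorem sample_add_three {n t : ℕ} (ht : t < numSample n) (h : sample n t + 3 ≤ n) :
    t + 1 < numSample n ∧ sample n (t + 1) = sample n t + 3 := by
  unfold numSample at *
  unfold sample at *
  split_ifs at * <;> omega

/-- Suffixes of the reduced string are ordered like the sample suffixes: comparing them
compares the latter by blocks of three symbols, and a block that crosses the end of one of
the two parts of the reduced string is never reached, being unique. -/
theorem IsReduct.lexLt {T R : ℕ → ℕ} {n : ℕ} (hT : IsStr T n) (hR : IsReduct T n R) :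
    ∀ {t u : ℕ}, t < numSample n → u < numSample n → LexLt R t u →
      LexLt T (sample n t) (sample n u) := by
  have key : ∀ k t u, t < numSample n → u < numSample n → (∀ m < k, R (t + m) = R (u + m)) →
      R (t + k) < R (u + k) → LexLt T (sample n t) (sample n u) := by
    intro k
    induction k with
    | zero =>
      intro t u ht hu _ h
      rw [lexLt_cons, lexLt_cons, lexLt_cons]
      rcases trip_lt_iff.1 (hR.lt t ht u hu h) with h | ⟨h, h' | ⟨h', h''⟩⟩
      · exact .inl h
      · exact .inr ⟨h, .inl h'⟩
      · exact .inr ⟨h, .inr ⟨h', .inl h''⟩⟩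
    | succ k ih =>
      intro t u ht hu hk h
      have he := hR.eq t ht u hu (hk 0 (by omega))
      have htu : sample n t ≠ sample n u := fun h' => by
        have : t = u := by
          rw [← sampleIdx_sample (n := n) (t := t), h', sampleIdx_sample]
        subst this; exact lt_irrefl _ h
      have h1 := isSample_sample ht
      have h2 := isSample_sample hu
      have h3 : sample n t + 3 ≤ n := by
        by_contra hc
        exact htu (hT.eq_of_trip h1.1 h2.1 (by omega) he)
      have h4 : sample n u + 3 ≤ n := by
        by_contra hc
        exact htu.symm (hT.eq_of_trip h2.1 h1.1 (by omega) he.symm)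
      obtain ⟨h5, h6⟩ := sample_add_three ht h3
      obtain ⟨h7, h8⟩ := sample_add_three hu h4
      have ih := ih (t + 1) (u + 1) h5 h7 (fun m hm => by
        have := hk (m + 1) (by omega)
        rwa [← Nat.add_assoc, ← Nat.add_assoc, Nat.add_right_comm t, Nat.add_right_comm u]
          at this) (by
        rwa [← Nat.add_assoc, ← Nat.add_assoc, Nat.add_right_comm t, Nat.add_right_comm u] at h)
      rw [h6, h8] at ih
      obtain ⟨e0, e1, e2⟩ := trip_eq_iff.1 he
      rw [lexLt_cons, lexLt_cons, lexLt_cons]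
      exact .inr ⟨e0, .inr ⟨e1, .inr ⟨e2, ih⟩⟩⟩
  rintro t u ht hu ⟨k, hk, h⟩
  exact key k t u ht hu hk h

/-- The ranks `RK` order the sample suffixes. -/
def IsRank (T : ℕ → ℕ) (n : ℕ) (RK : ℕ → ℕ) : Prop :=
  ∀ p q, IsSample n p → IsSample n q → (RK p < RK q ↔ LexLt T p q)

theorem IsStr.lt_of_eq {T : ℕ → ℕ} {n p q : ℕ} (hT : IsStr T n) (hp : p ≤ n) (hq : q ≤ n)
    (hne : p ≠ q) (h : T p = T q) : p < n ∧ q < n := by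
  have z : ∀ x, T x = 0 ↔ n ≤ x := fun x =>
    ⟨fun hx => by by_contra hc; exact (hT.pos x (by omega)).ne' hx, hT.zero x⟩
  have := z p; have := z q
  omega

/-- Positions divisible by `3` are compared with each other or with positions congruent to `1` by
one symbol and the ranks of the following suffixes, which are sample suffixes. -/
theorem IsRank.lexLt_iff_one {T RK : ℕ → ℕ} {n p q : ℕ} (hR : IsRank T n RK) (hT : IsStr T n)
    (hp : p ≤ n) (hq : q ≤ n) (hne : p ≠ q) (hp3 : p % 3 ≠ 2) (hq3 : q % 3 ≠ 2) :
    LexLt T p q ↔ T p < T q ∨ T p = T q ∧ RK (p + 1) < RK (q + 1) := by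
  rw [lexLt_cons]
  refine or_congr Iff.rfl (and_congr_right fun h => ?_)
  obtain ⟨h1, h2⟩ := hT.lt_of_eq hp hq hne h
  exact (hR _ _ ⟨h1, by omega⟩ ⟨h2, by omega⟩).symm

/-- Positions divisible by `3` are compared with positions congruent to `2` by two symbols and the
ranks of the suffixes behind them, which are sample suffixes. -/
theorem IsRank.lexLt_iff_two {T RK : ℕ → ℕ} {n p q : ℕ} (hR : IsRank T n RK) (hT : IsStr T n)
    (hp : p ≤ n) (hq : q ≤ n) (hne : p ≠ q) (hp3 : p % 3 ≠ 1) (hq3 : q % 3 ≠ 1) :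
    LexLt T p q ↔ T p < T q ∨ T p = T q ∧ (T (p + 1) < T (q + 1) ∨ T (p + 1) = T (q + 1) ∧
      RK (p + 2) < RK (q + 2)) := by
  rw [lexLt_cons, lexLt_cons]
  refine or_congr Iff.rfl (and_congr_right fun h => or_congr Iff.rfl (and_congr_right fun h' => ?_))
  obtain ⟨h1, h2⟩ := hT.lt_of_eq hp hq hne h
  obtain ⟨h3, h4⟩ := hT.lt_of_eq (p := p + 1) (q := q + 1) h1 h2 (by omega) h'
  exact (hR _ _ ⟨h3, by omega⟩ ⟨h4, by omega⟩).symm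

/-- The suffix array of the reduced string lists the sample suffixes in order. Its entry `0`, the
empty suffix, is left out. -/
theorem IsReduct.sample_sorted {T R sa : ℕ → ℕ} {n : ℕ} (hT : IsStr T n) (hR : IsReduct T n R)
    (hsa : IsSA R (numSample n) sa) :
    Enum (numSample n) (fun i => sample n (sa (i + 1))) (IsSample n) ∧
    ∀ i j, i < j → j < numSample n → LexLt T (sample n (sa (i + 1))) (sample n (sa (j + 1))) := by
  have h0 := hsa.zero hR.str
  have hlt : ∀ i < numSample n, sa (i + 1) < numSample n := fun i hi =>
    lt_of_le_of_ne (hsa.le _ hi) fun h => by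
      have := hsa.inj (i := i + 1) (j := 0) hi (by omega) (by rw [h, h0]); omega
  have mono : ∀ i j, i < j → j < numSample n →
      LexLt T (sample n (sa (i + 1))) (sample n (sa (j + 1))) := fun i j hij hj =>
    hR.lexLt hT (hlt i (hij.trans hj)) (hlt j hj) (hsa.lt _ _ (by omega) hj)
  refine ⟨⟨fun i hi => isSample_sample (hlt i hi), fun i hi j hj h => ?_, fun p hp => ?_⟩, mono⟩
  · have h1 := (enum_sample n).inj _ (hlt i hi) _ (hlt j hj) h
    have := hsa.inj (i := i + 1) (j := j + 1) hi hj h1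
    omega
  · obtain ⟨i, hi, hip⟩ := hsa.surj (sampleIdx_lt hp).le
    have h1 := sampleIdx_lt hp
    cases i with
    | zero => omega
    | succ i => exact ⟨i, hi, by simp only [hip, sample_sampleIdx hp]⟩

theorem IsReduct.isRank {T R sa RK : ℕ → ℕ} {n : ℕ} (hT : IsStr T n) (hR : IsReduct T n R)
    (hsa : IsSA R (numSample n) sa)
    (hRK : ∀ i < numSample n, RK (sample n (sa (i + 1))) = i + 1) : IsRank T n RK := by
  obtain ⟨henum, mono⟩ := hR.sample_sorted hT hsa
  intro p q hp hq
  obtain ⟨i, hi, rfl⟩ := henum.surj p hp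
  obtain ⟨j, hj, rfl⟩ := henum.surj q hq
  rw [hRK i hi, hRK j hj]
  refine ⟨fun h => mono i j (by omega) hj, fun h => ?_⟩
  by_contra hc
  rcases Nat.eq_or_lt_of_le (show j ≤ i by omega) with rfl | h'
  · exact LexLt.irrefl h
  · exact h.asymm (mono j i h' hi)

/-- If all symbols of a string are different, they are its suffix ranks. -/
theorem isSA_of_inj {R sa : ℕ → ℕ} {m : ℕ} (hR : IsStr R m) (hle : ∀ t, R t ≤ m)
    (hinj : ∀ t < m, ∀ u < m, R t = R u → t = u) (h0 : sa 0 = m) (hsa : ∀ t < m, sa (R t) = t) :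
    IsSA R m sa := by
  have key : ∀ i, i ≤ m → sa i ≤ m ∧ R (sa i) = i := fun i hi => by
    cases i with
    | zero => exact ⟨h0.le, by rw [h0, hR.zero m le_rfl]⟩
    | succ i =>
      obtain ⟨t, ht, hti⟩ := exists_of_injOn (N := m) (f := fun t => R t - 1)
        (fun t ht => by have := hR.pos t ht; have := hle t; show R t - 1 < m; omega)
        (fun t ht u hu h => hinj t ht u hu (by
          have := hR.pos t ht; have := hR.pos u hu; omega)) hi
      have h1 : R t = i + 1 := by have := hR.pos t ht; omega
      rw [← h1, hsa t ht]
      exact ⟨ht.le, rfl⟩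
  refine ⟨fun i hi => (key i hi).1, fun i j hij hj => lexLt_cons.2 (.inl ?_)⟩
  rw [(key i (by omega)).2, (key j hj).2]; exact hij

/-- The string of length `n` stored in array `A` from cell `o` on. -/
def strAt (A : ℕ → ℕ) (o n : ℕ) : ℕ → ℕ := fun i => if i < n then A (o + i) else 0

theorem isReduct_of_names {T X R : ℕ → ℕ} {n : ℕ} (hX : Enum (numSample n) X (IsSample n))
    (hs : ∀ i j, i < j → j < numSample n → trip T (X i) ≤ trip T (X j))
    (hR : ∀ i < numSample n, R (sampleIdx n (X i)) = names (fun i => trip T (X i)) i)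
    (hR0 : ∀ x, numSample n ≤ x → R x = 0) : IsReduct T n R := by
  have key : ∀ t < numSample n, ∃ i < numSample n, X i = sample n t ∧
      R t = names (fun i => trip T (X i)) i := fun t ht => by
    obtain ⟨i, hi, hit⟩ := hX.surj _ (isSample_sample ht)
    exact ⟨i, hi, hit, by rw [← hR i hi, hit, sampleIdx_sample]⟩
  refine ⟨⟨fun t ht => ?_, hR0⟩, fun t => ?_, fun t ht u hu h => ?_, fun t ht u hu h => ?_⟩
  · obtain ⟨i, _, _, h⟩ := key t ht
    rw [h]; exact names_pos _ _
  · by_cases ht : t < numSample n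
    · obtain ⟨i, hi, _, h⟩ := key t ht
      rw [h]; exact (names_le _ _).trans hi
    · rw [hR0 t (by omega)]; omega
  · obtain ⟨i, hi, h1, h2⟩ := key t ht
    obtain ⟨j, hj, h3, h4⟩ := key u hu
    rw [h2, h4, names_lt_iff hs hi hj] at h
    rwa [← h1, ← h3]
  · obtain ⟨i, hi, h1, h2⟩ := key t ht
    obtain ⟨j, hj, h3, h4⟩ := key u hu
    rw [h2, h4, names_inj_iff hs hi hj] at h
    rwa [← h1, ← h3]

/-! ### Construction of the suffix array -/

/-- The sample position with index `e`; register `7` holds the number of sample positions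
congruent to `1` modulo `3`. -/
def sampleE (e : Expr) : Expr := 3 * (e - (1 - (e <ₑ ♯7)) * ♯7) + 2 - (e <ₑ ♯7)

theorem sampleE_val {s : State} {n : ℕ} (e : Expr) (h7 : s.var 7 = (n + 2) / 3) :
    (sampleE e).val s = sample n (e.val s) := by
  unfold sampleE sample
  simp only [Expr.val_sub, Expr.val_add, Expr.val_mul, Expr.val_lt, Expr.val_ofNat, Expr.val_var,
    h7]
  split_ifs <;> omega

theorem sampleE_OK {w S : ℕ} {s : State} {n : ℕ} {e : Expr} (h7 : s.var 7 = (n + 2) / 3)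
    (he : e.OK w S s) (hlt : e.val s < numSample n) (hn : n + 6 < wordCap w) :
    (sampleE e).OK w S s := by
  unfold sampleE
  unfold numSample at hlt
  simp only [Expr.OK_sub, Expr.OK_add, Expr.OK_mul, Expr.OK_lt, Expr.OK_ofNat, Expr.OK_var,
    Expr.val_sub, Expr.val_add, Expr.val_mul, Expr.val_lt, Expr.val_ofNat, Expr.val_var, h7, he]
  split_ifs <;> simp <;> omega

theorem sampleE_cost (e : Expr) : (sampleE e).cost = 3 * e.cost + 14 := by
  simp only [sampleE, Expr.cost_sub, Expr.cost]
  omega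

/-- Array `3` gets the sample positions sorted by the three symbols from there on, for the string
of length `♯6` in array `7` from cell `♯5` on. -/
def sortTriples : Cmd :=
  7 ≔ (♯6 + 2) / 3 ;;
  1 ≔ ♯7 + (♯6 + 1) / 3 ;;
  3 ≔ ♯6 + 1 ;;
  tab 3 (sampleE ♯2) ;;
  sortBy (7 ⊙ (♯5 + 3 ⊙ ♯2 + 2)) ;;
  sortBy (7 ⊙ (♯5 + 3 ⊙ ♯2 + 1)) ;;
  sortBy (7 ⊙ (♯5 + 3 ⊙ ♯2))

theorem sortTriples_runs {w S : ℕ} (hw : 1 < wordCap w) (hS : S ≤ wordCap w) {s : State}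
    {o n : ℕ} (h5 : s.var 5 = o) (h6 : s.var 6 = n) (hb : o + n + 20 < S)
    (hle : ∀ i, strAt (s.arr 7) o n i ≤ n)
    (hz : ∀ i, n ≤ i → s.arr 7 (o + i) = 0) :
    Runs w S sortTriples s (1300 * (n + 3)) fun s' =>
      s'.var 7 = (n + 2) / 3 ∧ s'.var 1 = numSample n ∧
      Enum (numSample n) (s'.arr 3) (IsSample n) ∧
      ∀ i j, i < j → j < numSample n →
        trip (strAt (s.arr 7) o n) (s'.arr 3 i) ≤ trip (strAt (s.arr 7) o n) (s'.arr 3 j) := by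
  have hNn : numSample n ≤ n := by unfold numSample; omega
  set T := strAt (s.arr 7) o n with hT
  have hTA : ∀ i, s.arr 7 (o + i) = T i := fun i => by
    rw [hT]; unfold strAt
    split_ifs with h
    · rfl
    · exact hz i (by omega)
  -- one pass of the radix sort
  have pass : ∀ (d : ℕ) (e : Expr) (s1 : State), s1.var 1 = numSample n → s1.var 3 = n + 1 →
      s1.arr 7 = s.arr 7 → Enum (numSample n) (s1.arr 3) (IsSample n) →
      e.reads 4 = false → (∀ j < numSample n, e.OK w S (s1.setVar 2 j)) →
      (∀ j < numSample n, e.val (s1.setVar 2 j) = T (s1.arr 3 j + d)) → e.cost ≤ 10 →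
      Runs w S (sortBy e) s1 ((n + 2) * 21 + 200 * (n + n + 4)) fun s2 =>
        ∃ p, StablePerm (numSample n) (fun i => T (s1.arr 3 i + d)) p ∧
          ∀ i < numSample n, s2.arr 3 i = s1.arr 3 (p i) := by
    intro d e s1 h1 h3 _ hE hr hOK hval hc
    refine sortBy_runs hw hS (key := fun x => T (x + d)) h1 h3 (by omega) (by omega) hr hOK hval
      (fun i _ => (hle _).trans (by omega)) ?_
    have : (numSample n + 2) * (e.cost + 11) ≤ (n + 2) * 21 :=
      Nat.mul_le_mul (by omega) (by omega)
    omega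
  refine Runs.seq (P := fun s1 => s1.var 7 = (n + 2) / 3) (t₁ := 10)
    (Cmd.wp.runs hw ?_ (by simp [Cmd.cost])) (by omega) fun s1 f1 h1 => ?_
  · simp [Cmd.wp, h6]; omega
  refine Runs.seq (P := fun s2 => s2.var 1 = numSample n) (t₁ := 10)
    (Cmd.wp.runs hw ?_ (by simp [Cmd.cost])) (by omega) fun s2 f2 h2 => ?_
  · simp [Cmd.wp, f1.var 6 rfl, h1, h6, numSample]; omega
  refine Runs.seq (P := fun s3 => s3.var 3 = n + 1) (t₁ := 10)
    (Cmd.wp.runs hw ?_ (by simp [Cmd.cost])) (by omega) fun s3 f3 h3 => ?_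
  · simp [Cmd.wp, f2.var 6 rfl, f1.var 6 rfl, h6]; omega
  have v1 : s3.var 1 = numSample n := by rw [f3.var 1 rfl, h2]
  have v7 : s3.var 7 = (n + 2) / 3 := by rw [f3.var 7 rfl, f2.var 7 rfl, h1]
  refine Runs.seq (t₁ := (n + 2) * 31) (tab_runs hw hS v1 (by omega) rfl ?_ ?_) (by omega)
    fun s4 f4 h4 => ?_
  · intro j hj
    exact sampleE_OK (n := n) (by simpa using v7) trivial (by simpa using hj) (by omega)
  · rw [sampleE_cost]; simp only [Expr.cost]; nlinarith
  have hX4 : ∀ j < numSample n, s4.arr 3 j = sample n j := fun j hj => by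
    rw [h4.1 j hj, sampleE_val (n := n) _ (by simpa using v7)]; simp
  have E4 : Enum (numSample n) (s4.arr 3) (IsSample n) :=
    ⟨fun i hi => by rw [hX4 i hi]; exact (enum_sample n).mem i hi,
      fun i hi j hj h => (enum_sample n).inj i hi j hj (by rwa [hX4 i hi, hX4 j hj] at h),
      fun x hx => by
        obtain ⟨i, hi, h⟩ := (enum_sample n).surj x hx
        exact ⟨i, hi, by rw [hX4 i hi, h]⟩⟩
  have A4 : s4.arr 7 = s.arr 7 := by rw [f4.arr 7 rfl, f3.arr 7 rfl, f2.arr 7 rfl, f1.arr 7 rfl]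
  have O4 : s4.var 5 = o := by rw [f4.var 5 rfl, f3.var 5 rfl, f2.var 5 rfl, f1.var 5 rfl, h5]
  have V4 : s4.var 1 = numSample n := by rw [f4.var 1 rfl, v1]
  have K4 : s4.var 3 = n + 1 := by rw [f4.var 3 rfl, h3]
  refine Runs.seq (pass 2 _ s4 V4 K4 A4 E4 rfl (fun j hj => ?_) (fun j hj => ?_)
    (by simp)) (by omega) ?_
  · have := (E4.mem j hj).1
    simp [O4]; omega
  · simp [O4, A4, ← hTA, Nat.add_assoc]
  rintro s5 f5 ⟨p5, hp5, h5'⟩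
  have E5 := E4.stablePerm hp5 h5'
  have A5 : s5.arr 7 = s.arr 7 := by rw [f5.arr 7 rfl, A4]
  have O5 : s5.var 5 = o := by rw [f5.var 5 rfl, O4]
  have V5 : s5.var 1 = numSample n := by rw [f5.var 1 rfl, V4]
  have K5 : s5.var 3 = n + 1 := by rw [f5.var 3 rfl, K4]
  refine Runs.seq (pass 1 _ s5 V5 K5 A5 E5 rfl (fun j hj => ?_) (fun j hj => ?_)
    (by simp)) (by omega) ?_
  · have := (E5.mem j hj).1
    simp [O5]; omega
  · simp [O5, A5, ← hTA, Nat.add_assoc]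
  rintro s6 f6 ⟨p6, hp6, h6'⟩
  have E6 := E5.stablePerm hp6 h6'
  have A6 : s6.arr 7 = s.arr 7 := by rw [f6.arr 7 rfl, A5]
  have O6 : s6.var 5 = o := by rw [f6.var 5 rfl, O5]
  have V6 : s6.var 1 = numSample n := by rw [f6.var 1 rfl, V5]
  have K6 : s6.var 3 = n + 1 := by rw [f6.var 3 rfl, K5]
  refine (pass 0 _ s6 V6 K6 A6 E6 rfl (fun j hj => ?_) (fun j hj => ?_)
    (by simp)).imp (by omega) ?_
  · have := (E6.mem j hj).1
    simp [O6]; omega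
  · simp [O6, A6, ← hTA]
  rintro s7 f7 ⟨p7, hp7, h7'⟩
  refine ⟨?_, by rw [f7.var 1 rfl, V6], E6.stablePerm hp7 h7', fun i j hij hj => ?_⟩
  · rw [f7.var 7 rfl, f6.var 7 rfl, f5.var 7 rfl, f4.var 7 rfl, v7]
  have s5s : ∀ i j, i < j → j < numSample n → T (s5.arr 3 i + 2) ≤ T (s5.arr 3 j + 2) := by
    intro i j hij hj
    have := hp5.sorted i j hij hj
    rw [h5' i (hij.trans hj), h5' j hj]; omega
  have s6s : ∀ i j, i < j → j < numSample n → T (s6.arr 3 i + 1) < T (s6.arr 3 j + 1) ∨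
      T (s6.arr 3 i + 1) = T (s6.arr 3 j + 1) ∧ T (s6.arr 3 i + 2) ≤ T (s6.arr 3 j + 2) := by
    intro i j hij hj
    rw [h6' i (hij.trans hj), h6' j hj]
    rcases hp6.sorted i j hij hj with h | ⟨h, h'⟩
    · exact .inl h
    · exact .inr ⟨h, s5s _ _ h' (hp6.lt j hj)⟩
  rw [h7' i (hij.trans hj), h7' j hj, trip_le_iff]
  rcases hp7.sorted i j hij hj with h | ⟨h, h'⟩
  · exact .inl h
  · exact .inr ⟨h, s6s _ _ h' (hp7.lt j hj)⟩

/-- Register `9` gets the name of the triple at the `♯2`-th of the sorted sample positions in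
array `3`, if before it holds the name of the preceding triple. -/
def nextName : Cmd :=
  .ite (♯2 =ₑ 0) (9 ≔ 1)
    (11 ≔ ♯5 + 3 ⊙ ♯2 ;;
    12 ≔ ♯5 + 3 ⊙ (♯2 - 1) ;;
    .ite (7 ⊙ ♯11 =ₑ 7 ⊙ ♯12)
      (.ite (7 ⊙ (♯11 + 1) =ₑ 7 ⊙ (♯12 + 1))
        (.ite (7 ⊙ (♯11 + 2) =ₑ 7 ⊙ (♯12 + 2)) .skip (9 ≔ ♯9 + 1))
        (9 ≔ ♯9 + 1))
      (9 ≔ ♯9 + 1))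

/-- The names of the triples at the sorted sample positions in array `3` are stored as a string
behind the string of length `♯6` in array `7`. -/
def nameTriples : Cmd :=
  9 ≔ 0 ;;
  .forTo 2 1 (nextName ;;
    11 ≔ 3 ⊙ ♯2 ;;
    .ite (♯11 % 3 =ₑ 1) (12 ≔ ♯11 / 3) (12 ≔ ♯11 / 3 + ♯7) ;;
    .write 7 (♯5 + ♯6 + 3 + ♯12) ♯9)

theorem nameTriples_runs {w S : ℕ} (hw : 1 < wordCap w) (hS : S ≤ wordCap w) {s : State}
    {o n : ℕ} {T : ℕ → ℕ} (h5 : s.var 5 = o) (h6 : s.var 6 = n) (h1 : s.var 1 = numSample n)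
    (h7 : s.var 7 = (n + 2) / 3) (hb : o + 2 * n + 20 < S)
    (hX : Enum (numSample n) (s.arr 3) (IsSample n))
    (hT : ∀ i, i ≤ n + 2 → s.arr 7 (o + i) = T i) :
    Runs w S nameTriples s (100 * (n + 3)) fun s' =>
      (s'.var 9 = if numSample n = 0 then 0
        else names (fun i => trip T (s.arr 3 i)) (numSample n - 1)) ∧
      (∀ i < numSample n, s'.arr 7 (o + n + 3 + sampleIdx n (s.arr 3 i)) =
        names (fun i => trip T (s.arr 3 i)) i) ∧
      ∀ x, x < o + n + 3 ∨ o + n + 3 + numSample n ≤ x → s'.arr 7 x = s.arr 7 x := by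
  have hNn : numSample n ≤ n := by unfold numSample; omega
  set key := fun i => trip T (s.arr 3 i) with hkey
  refine Runs.seq (P := fun s1 => s1.var 9 = 0) (t₁ := 10)
    (Cmd.wp.runs hw (by simp [Cmd.wp]; omega) (by simp [Cmd.cost])) (by omega) fun s1 f1 e1 => ?_
  refine (Runs.forTo hw (N := numSample n) (by rw [f1.var 1 rfl, h1]) (fun j s' =>
      (s'.var 9 = if j = 0 then 0 else names key (j - 1)) ∧
      (∀ i < j, s'.arr 7 (o + n + 3 + sampleIdx n (s.arr 3 i)) = names key i) ∧
      ∀ x, x < o + n + 3 ∨ o + n + 3 + numSample n ≤ x → s'.arr 7 x = s.arr 7 x)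
    (by decide) rfl rfl (by omega) ?_ ?_ ?_)
  · exact ⟨by simpa using e1, fun i hi => by omega, fun x _ => by simp [f1.arr 7 rfl]⟩
  · rintro j s' hj hf hi ⟨hJ1, hJ2, hJ3⟩
    have v5 : s'.var 5 = o := by rw [hf.var 5 rfl, f1.var 5 rfl, h5]
    have v6 : s'.var 6 = n := by rw [hf.var 6 rfl, f1.var 6 rfl, h6]
    have v7 : s'.var 7 = (n + 2) / 3 := by rw [hf.var 7 rfl, f1.var 7 rfl, h7]
    have a3 : s'.arr 3 = s.arr 3 := by rw [hf.arr 3 rfl, f1.arr 3 rfl]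
    have hA : ∀ i, i ≤ n + 2 → s'.arr 7 (o + i) = T i := fun i hi => by
      rw [hJ3 _ (.inl (by omega)), hT i hi]
    have hxj := hX.mem j hj
    have hidx := sampleIdx_lt hxj
    have hle := names_le key j
    refine Cmd.wp.seq (P := fun s'' => s''.var 9 = names key j) ?_ fun s'' f2 h9 => ?_
    · cases j with
      | zero =>
        simp [nextName, Cmd.wp, hi, names]; omega
      | succ j =>
        have hxj' := hX.mem j (by omega)
        have c0 := hA (s.arr 3 (j + 1)) (by have := hxj.1; omega)
        have c1 := hA (s.arr 3 (j + 1) + 1) (by have := hxj.1; omega)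
        have c2 := hA (s.arr 3 (j + 1) + 2) (by have := hxj.1; omega)
        have d0 := hA (s.arr 3 j) (by have := hxj'.1; omega)
        have d1 := hA (s.arr 3 j + 1) (by have := hxj'.1; omega)
        have d2 := hA (s.arr 3 j + 2) (by have := hxj'.1; omega)
        have hl := names_le key j
        have hnm : names key (j + 1) = names key j + if T (s.arr 3 (j + 1)) = T (s.arr 3 j) ∧
            T (s.arr 3 (j + 1) + 1) = T (s.arr 3 j + 1) ∧
            T (s.arr 3 (j + 1) + 2) = T (s.arr 3 j + 2) then 0 else 1 := by
          simp only [names, hkey, trip_eq_iff]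
        have b1 := hxj.1
        have b2 := hxj'.1
        rw [hnm]
        simp only [Nat.add_one_ne_zero, if_false, Nat.add_sub_cancel] at hJ1
        by_cases h0 : T (s.arr 3 (j + 1)) = T (s.arr 3 j)
        · by_cases h0' : T (s.arr 3 (j + 1) + 1) = T (s.arr 3 j + 1)
          · by_cases h : T (s.arr 3 (j + 1) + 2) = T (s.arr 3 j + 2)
            · simp [nextName, Cmd.wp, hi, v5, a3, c0, c1, c2, d0, d1, d2, Nat.add_assoc, hJ1,
                h0, h0', h]
              omega
            · simp [nextName, Cmd.wp, hi, v5, a3, c0, c1, c2, d0, d1, d2, Nat.add_assoc, hJ1,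
                h0, h0', h]
              omega
          · simp [nextName, Cmd.wp, hi, v5, a3, c0, c1, d0, d1, Nat.add_assoc, hJ1, h0, h0']
            omega
        · simp [nextName, Cmd.wp, hi, v5, a3, c0, d0, Nat.add_assoc, hJ1, h0]
          omega
    · have w2 : s''.var 2 = j := by rw [f2.var 2 rfl, hi]
      have w5 : s''.var 5 = o := by rw [f2.var 5 rfl, v5]
      have w6 : s''.var 6 = n := by rw [f2.var 6 rfl, v6]
      have w7 : s''.var 7 = (n + 2) / 3 := by rw [f2.var 7 rfl, v7]
      have b3 : s''.arr 3 = s.arr 3 := by rw [f2.arr 3 rfl, a3]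
      have b7 : s''.arr 7 = s'.arr 7 := f2.arr 7 rfl
      refine Cmd.wp.seq (P := fun s'' => s''.var 11 = s.arr 3 j) ?_ fun s3 f3 h11 => ?_
      · simp [Cmd.wp, w2, b3]; omega
      refine Cmd.wp.seq (P := fun s'' => s''.var 12 = sampleIdx n (s.arr 3 j)) ?_
        fun s4 f4 h12 => ?_
      · have b1 := hxj.1
        simp only [Cmd.wp, Expr.OK_eq, Expr.OK_mod, Expr.OK_var, Expr.OK_ofNat, Expr.val_var,
          Expr.val_ofNat, Expr.val_mod, Expr.val_eq, Expr.OK_div, Expr.OK_add, Expr.val_div,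
          Expr.val_add, State.var_setVar, if_true, h11, f3.var 7 rfl, w7, sampleIdx]
        split_ifs with h
        · simp; omega
        · simp; omega
      have x9 : s4.var 9 = names key j := by rw [f4.var 9 rfl, f3.var 9 rfl, h9]
      have x5 : s4.var 5 = o := by rw [f4.var 5 rfl, f3.var 5 rfl, w5]
      have x6 : s4.var 6 = n := by rw [f4.var 6 rfl, f3.var 6 rfl, w6]
      have c7 : s4.arr 7 = s'.arr 7 := by rw [f4.arr 7 rfl, f3.arr 7 rfl, b7]
      simp only [Cmd.wp, Expr.OK_add, Expr.OK_var, Expr.OK_ofNat, Expr.val_add, Expr.val_var,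
        Expr.val_ofNat, State.var_setVar, State.var_setArr, State.arr_setVar,
        State.arr_setArr_apply, h12, x9, x5, x6, c7]
      refine ⟨by simp; omega, trivial, by omega, by simp, fun i hij => ?_, fun x hx => ?_⟩
      · split_ifs with h
        · have h' : sampleIdx n (s.arr 3 i) = sampleIdx n (s.arr 3 j) := by omega
          have : s.arr 3 i = s.arr 3 j := by
            rw [← sample_sampleIdx (hX.mem i (by omega)), h', sample_sampleIdx hxj]
          rw [hX.inj i (by omega) j hj this]
        · refine hJ2 i ?_
          by_contra hc
          exact h ⟨trivial, by rw [show i = j by omega]⟩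
      · rw [if_neg (by omega)]; exact hJ3 x hx
  · simp [Cmd.cost, nextName]; omega

/-- One level of the recursion: the string of length `♯6` in array `7` from cell `♯5` on is
reduced. The position and the length of the string are stored at index `♯8` of the arrays `8`
and `9`. Register `10` tells whether all names are different. -/
def reduceStep : Cmd :=
  sortTriples ;;
  nameTriples ;;
  .write 8 ♯8 ♯5 ;;
  .write 9 ♯8 ♯6 ;;
  5 ≔ ♯5 + ♯6 + 3 ;;
  6 ≔ ♯1 ;;
  8 ≔ ♯8 + 1 ;;
  10 ≔ (♯9 =ₑ ♯1)

theorem strAt_of_zero {A : ℕ → ℕ} {o n : ℕ} (hz : ∀ i, n ≤ i → A (o + i) = 0) (i : ℕ) :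
    A (o + i) = strAt A o n i := by
  unfold strAt
  split_ifs with h
  · rfl
  · exact hz i (by omega)

/-- A repeated name requires `3 ≤ n`, because a triple that reaches the end of the string occurs
only once. -/
theorem reduceStep_runs {w S : ℕ} (hw : 1 < wordCap w) (hS : S ≤ wordCap w) {s : State}
    {o n l : ℕ} (h5 : s.var 5 = o) (h6 : s.var 6 = n) (h8 : s.var 8 = l)
    (hb : o + 2 * n + 20 < S) (hl : l + 2 < S) (hstr : IsStr (strAt (s.arr 7) o n) n)
    (hle : ∀ i, strAt (s.arr 7) o n i ≤ n)
    (hz : ∀ i, n ≤ i → s.arr 7 (o + i) = 0) :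
    Runs w S reduceStep s (1450 * (n + 3)) fun s' =>
      s'.var 5 = o + n + 3 ∧ s'.var 6 = numSample n ∧ s'.var 8 = l + 1 ∧
      (∀ i, s'.arr 8 i = if i = l then o else s.arr 8 i) ∧
      (∀ i, s'.arr 9 i = if i = l then n else s.arr 9 i) ∧
      (∀ i < o + n + 3, s'.arr 7 i = s.arr 7 i) ∧
      (∀ i, numSample n ≤ i → s'.arr 7 (o + n + 3 + i) = 0) ∧
      IsReduct (strAt (s.arr 7) o n) n (strAt (s'.arr 7) (o + n + 3) (numSample n)) ∧
      (s'.var 10 = 0 → 3 ≤ n) ∧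
      (s'.var 10 ≠ 0 → ∀ i < numSample n, ∀ j < numSample n,
        strAt (s'.arr 7) (o + n + 3) (numSample n) i =
          strAt (s'.arr 7) (o + n + 3) (numSample n) j → i = j) := by
  have hNn : numSample n ≤ n := by unfold numSample; omega
  set T := strAt (s.arr 7) o n with hT
  refine Runs.seq (sortTriples_runs hw hS h5 h6 (by omega) hle hz) (by omega) ?_
  rintro s1 f1 ⟨v7, v1, hE, hs⟩
  refine Runs.seq (nameTriples_runs hw hS (T := T) (by rw [f1.var 5 rfl, h5])
    (by rw [f1.var 6 rfl, h6]) v1 v7 hb hE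
    (fun i _ => by rw [f1.arr 7 rfl, strAt_of_zero hz])) (by omega) ?_
  rintro s2 f2 ⟨g9, gn, gA⟩
  have w5 : s2.var 5 = o := by rw [f2.var 5 rfl, f1.var 5 rfl, h5]
  have w6 : s2.var 6 = n := by rw [f2.var 6 rfl, f1.var 6 rfl, h6]
  have w8 : s2.var 8 = l := by rw [f2.var 8 rfl, f1.var 8 rfl, h8]
  have w1 : s2.var 1 = numSample n := by rw [f2.var 1 rfl, v1]
  have b8 : s2.arr 8 = s.arr 8 := by rw [f2.arr 8 rfl, f1.arr 8 rfl]
  have b9 : s2.arr 9 = s.arr 9 := by rw [f2.arr 9 rfl, f1.arr 9 rfl]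
  have b7 : s1.arr 7 = s.arr 7 := f1.arr 7 rfl
  have hR : IsReduct T n (strAt (s2.arr 7) (o + n + 3) (numSample n)) := by
    refine isReduct_of_names hE hs (fun i hi => ?_) fun x hx => ?_
    · rw [strAt, if_pos (sampleIdx_lt (hE.mem i hi))]; exact gn i hi
    · rw [strAt, if_neg (by omega)]
  refine Cmd.wp.runs hw ?_ (by simp [Cmd.cost]; omega)
  simp only [Cmd.wp, Expr.OK_add, Expr.OK_eq, Expr.OK_var, Expr.OK_ofNat, Expr.val_add,
    Expr.val_eq, Expr.val_var,
    Expr.val_ofNat, State.var_setVar, State.var_setArr, State.arr_setVar,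
    State.arr_setArr_apply, w5, w6, w8, w1, b8, b9]
  simp only [Nat.reduceEqDiff, if_true, if_false, true_and, false_and, and_true]
  have hA7 : ((s2.setArr 8 l o).setArr 9 l n).arr 7 = s2.arr 7 := by
    simp [State.arr_setArr]
  simp only [hA7]
  refine ⟨by omega, by omega, by omega, by omega, fun _ => trivial, fun _ => trivial,
    fun i hi => ?_, fun i hi => ?_, hR, fun h => ?_, fun h i hi j hj hij => ?_⟩
  · rw [gA i (.inl hi), b7]
  · rw [gA _ (.inr (by omega)), b7]
    have := hz (n + 3 + i) (by omega)
    rw [← this]; congr 1; omega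
  · by_contra hc
    have hne : s2.var 9 ≠ numSample n := fun h' => by simp [h'] at h
    rw [g9] at hne
    split_ifs at hne with h0
    · exact hne h0.symm
    · refine hne ?_
      rw [names_eq_succ (N := numSample n) _ (by omega)]
      · omega
      · intro i hi he
        have m1 := hE.mem _ hi
        have m2 := hE.mem i (by omega)
        have := hE.inj _ hi i (by omega) (hstr.eq_of_trip m1.1 m2.1 (by have := m1.2; omega) he)
        omega
  · have heq : s2.var 9 = numSample n := by by_contra h'; simp [h'] at h
    rw [g9, if_neg (by omega)] at heq
    have hnm : ∀ i < numSample n, names (fun i => trip T (s1.arr 3 i)) i = i + 1 := fun i hi =>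
      names_eq_succ_of_last _ (d := numSample n - 1 - i) (by
        rw [show i + (numSample n - 1 - i) = numSample n - 1 by omega, heq]; omega)
    obtain ⟨a, ha, hai⟩ := hE.surj _ (isSample_sample hi)
    obtain ⟨b, hb', hbj⟩ := hE.surj _ (isSample_sample hj)
    have e1 := gn a ha
    have e2 := gn b hb'
    rw [hai, sampleIdx_sample, hnm a ha] at e1
    rw [hbj, sampleIdx_sample, hnm b hb'] at e2
    simp only [strAt, hi, hj, if_true] at hij
    have hab : a = b := by omega
    rw [hab, hbj] at hai
    rw [← sampleIdx_sample (n := n) (t := i), ← hai, sampleIdx_sample]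

theorem enum_multiples (n : ℕ) :
    Enum (n / 3 + 1) (fun t => 3 * t) (fun p => p ≤ n ∧ p % 3 = 0) where
  mem i hi := ⟨by omega, by omega⟩
  inj i _ j _ h := by omega
  surj x hx := ⟨x / 3, by omega, by have := hx.2; omega⟩

theorem Enum.congr {N : ℕ} {X Y : ℕ → ℕ} {P : ℕ → Prop} (h : Enum N X P)
    (hY : ∀ i < N, Y i = X i) : Enum N Y P where
  mem i hi := by rw [hY i hi]; exact h.mem i hi
  inj i hi j hj hij := h.inj i hi j hj (by rwa [hY i hi, hY j hj] at hij)
  surj x hx := by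
    obtain ⟨i, hi, hix⟩ := h.surj x hx
    exact ⟨i, hi, by rw [hY i hi, hix]⟩

/-- From the suffix array of the reduced string in array `10`, the sorted sample positions are
computed in array `14` and the ranks of their suffixes in array `11`. -/
def rankSamples : Cmd :=
  7 ≔ (♯6 + 2) / 3 ;;
  1 ≔ ♯7 + (♯6 + 1) / 3 ;;
  17 ≔ ♯1 ;;
  tab 14 (sampleE (10 ⊙ (♯2 + 1))) ;;
  1 ≔ ♯6 + 3 ;;
  tab 11 0 ;;
  .forTo 2 17 (.write 11 (14 ⊙ ♯2) (♯2 + 1))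

theorem rankSamples_runs {w S : ℕ} (hw : 1 < wordCap w) (hS : S ≤ wordCap w) {s : State}
    {n : ℕ} {T R : ℕ → ℕ} (h6 : s.var 6 = n) (hb : n + 20 < S) (hT : IsStr T n)
    (hR : IsReduct T n R) (hsa : IsSA R (numSample n) (s.arr 10)) :
    Runs w S rankSamples s (100 * (n + 4)) fun s' =>
      s'.var 17 = numSample n ∧ Enum (numSample n) (s'.arr 14) (IsSample n) ∧
      (∀ i j, i < j → j < numSample n → LexLt T (s'.arr 14 i) (s'.arr 14 j)) ∧
      IsRank T n (s'.arr 11) ∧ ∀ i ≤ n + 2, s'.arr 11 i ≤ n := by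
  have hNn : numSample n ≤ n := by unfold numSample; omega
  obtain ⟨hE, hs⟩ := hR.sample_sorted hT hsa
  refine Runs.seq (P := fun s1 => s1.var 7 = (n + 2) / 3) (t₁ := 10)
    (Cmd.wp.runs hw ?_ (by simp [Cmd.cost])) (by omega) fun s1 f1 h1 => ?_
  · simp [Cmd.wp, h6]; omega
  refine Runs.seq (P := fun s2 => s2.var 1 = numSample n) (t₁ := 10)
    (Cmd.wp.runs hw ?_ (by simp [Cmd.cost])) (by omega) fun s2 f2 h2 => ?_
  · simp [Cmd.wp, f1.var 6 rfl, h1, h6, numSample]; omega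
  refine Runs.seq (P := fun s3 => s3.var 17 = numSample n) (t₁ := 10)
    (Cmd.wp.runs hw ?_ (by simp [Cmd.cost])) (by omega) fun s3 f3 h3 => ?_
  · simp [Cmd.wp, h2]
  have v1 : s3.var 1 = numSample n := by rw [f3.var 1 rfl, h2]
  have v7 : s3.var 7 = (n + 2) / 3 := by rw [f3.var 7 rfl, f2.var 7 rfl, h1]
  have A10 : s3.arr 10 = s.arr 10 := by rw [f3.arr 10 rfl, f2.arr 10 rfl, f1.arr 10 rfl]
  have hlt : ∀ i < numSample n, s.arr 10 (i + 1) < numSample n := fun i hi => by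
    refine lt_of_le_of_ne (hsa.le _ hi) fun h => ?_
    have := hsa.inj (i := i + 1) (j := 0) hi (by omega) (by rw [h, hsa.zero hR.str]); omega
  refine Runs.seq (t₁ := (n + 2) * 40) (tab_runs hw hS v1 (by omega) rfl ?_ ?_) (by omega)
    fun s4 f4 h4 => ?_
  · intro j hj
    exact sampleE_OK (n := n) (by simpa using v7) (by simp; omega) (by simpa [A10] using hlt j hj)
      (by omega)
  · rw [sampleE_cost]; simp only [Expr.cost]; nlinarith
  have hX4 : ∀ j < numSample n, s4.arr 14 j = sample n (s.arr 10 (j + 1)) := fun j hj => by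
    rw [h4.1 j hj, sampleE_val (n := n) _ (by simpa using v7)]; simp [A10]
  refine Runs.seq (P := fun s2 => s2.var 1 = n + 3) (t₁ := 10)
    (Cmd.wp.runs hw ?_ (by simp [Cmd.cost])) (by omega) fun s5 f5 h5 => ?_
  · simp [Cmd.wp, f4.var 6 rfl, f3.var 6 rfl, f2.var 6 rfl, f1.var 6 rfl, h6]; omega
  refine Runs.seq (t₁ := (n + 5) * 12) (tab_runs hw hS h5 (by omega) rfl (by simp; omega)
    (by simp)) (by omega) fun s6 f6 h6' => ?_
  have hX6 : ∀ j < numSample n, s6.arr 14 j = sample n (s.arr 10 (j + 1)) := fun j hj => by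
    rw [f6.arr 14 rfl, f5.arr 14 rfl, hX4 j hj]
  have E6 : Enum (numSample n) (s6.arr 14) (IsSample n) := hE.congr hX6
  refine (Runs.forTo hw (N := numSample n) (by rw [f6.var 17 rfl, f5.var 17 rfl, f4.var 17 rfl, h3])
    (fun j s' => (∀ i < j, s'.arr 11 (s6.arr 14 i) = i + 1) ∧ ∀ i ≤ n + 2, s'.arr 11 i ≤ j)
    (by decide) rfl rfl (by omega) ?_ ?_ (t := (n + 2) * 20) ?_).imp (by omega) ?_
  · exact ⟨fun i hi => by omega, fun i hi => by simp [h6'.1 i (by omega)]⟩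
  · rintro j s' hj hf hi ⟨hJ, hJ'⟩
    have a14 : s'.arr 14 = s6.arr 14 := hf.arr 14 rfl
    have hm := (E6.mem j hj).1
    simp only [Cmd.wp, Expr.OK_add, Expr.OK_read, Expr.val_add, Expr.val_read, Expr.OK_var,
      Expr.OK_ofNat, Expr.val_var, Expr.val_ofNat, hi, a14,
      State.arr_setVar, State.arr_setArr_apply, true_and]
    refine ⟨by omega, by omega, by omega, fun i hij => ?_, fun i hi => ?_⟩
    · split_ifs with h
      · rw [E6.inj i (by omega) j hj h]
      · refine hJ i ?_
        by_contra hc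
        exact h (by rw [show i = j by omega])
    · split_ifs with h
      · exact le_rfl
      · exact (hJ' i hi).trans (by omega)
  · simp [Cmd.cost]; omega
  · rintro s7 f7 ⟨h7, h7'⟩
    have a14 : s7.arr 14 = s6.arr 14 := f7.arr 14 rfl
    refine ⟨by rw [f7.var 17 rfl, f6.var 17 rfl, f5.var 17 rfl, f4.var 17 rfl, h3],
      by rw [a14]; exact E6, fun i j hij hj => ?_, hR.isRank hT hsa fun i hi => ?_,
      fun i hi => (h7' i hi).trans hNn⟩
    · rw [a14, hX6 i (hij.trans hj), hX6 j hj]; exact hs i j hij hj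
    · rw [← hX6 i hi]; exact h7 i hi

/-- The positions divisible by `3` are sorted in array `3`, using the ranks of the sample
suffixes. -/
def sortMultiples : Cmd :=
  1 ≔ ♯6 / 3 + 1 ;;
  3 ≔ ♯6 + 1 ;;
  tab 3 (3 * ♯2) ;;
  sortBy (11 ⊙ (3 ⊙ ♯2 + 1)) ;;
  sortBy (7 ⊙ (♯5 + 3 ⊙ ♯2)) ;;
  18 ≔ ♯1

theorem sortMultiples_runs {w S : ℕ} (hw : 1 < wordCap w) (hS : S ≤ wordCap w) {s : State}
    {o n : ℕ} {T : ℕ → ℕ} (h5 : s.var 5 = o) (h6 : s.var 6 = n) (hb : o + n + 20 < S)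
    (hT : IsStr T n) (hle : ∀ i, T i ≤ n) (hTA : ∀ i ≤ n + 2, s.arr 7 (o + i) = T i)
    (hRK : IsRank T n (s.arr 11)) (hRKle : ∀ i ≤ n + 2, s.arr 11 i ≤ n) :
    Runs w S sortMultiples s (1000 * (n + 3)) fun s' =>
      s'.var 18 = n / 3 + 1 ∧ Enum (n / 3 + 1) (s'.arr 3) (fun p => p ≤ n ∧ p % 3 = 0) ∧
      ∀ i j, i < j → j < n / 3 + 1 → LexLt T (s'.arr 3 i) (s'.arr 3 j) := by
  have hNn : n / 3 + 1 ≤ n + 1 := by omega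
  refine Runs.seq (P := fun s1 => s1.var 1 = n / 3 + 1) (t₁ := 10)
    (Cmd.wp.runs hw ?_ (by simp [Cmd.cost])) (by omega) fun s1 f1 h1 => ?_
  · simp [Cmd.wp, h6]; omega
  refine Runs.seq (P := fun s3 => s3.var 3 = n + 1) (t₁ := 10)
    (Cmd.wp.runs hw ?_ (by simp [Cmd.cost])) (by omega) fun s3 f3 h3 => ?_
  · simp [Cmd.wp, f1.var 6 rfl, h6]; omega
  have v1 : s3.var 1 = n / 3 + 1 := by rw [f3.var 1 rfl, h1]
  refine Runs.seq (t₁ := (n + 3) * 20) (tab_runs hw hS v1 (by omega) rfl ?_ ?_) (by omega)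
    fun s4 f4 h4 => ?_
  · intro j hj; simp; omega
  · simp; omega
  have E4 : Enum (n / 3 + 1) (s4.arr 3) (fun p => p ≤ n ∧ p % 3 = 0) :=
    (enum_multiples n).congr fun i hi => by simpa using h4.1 i hi
  have A4 : s4.arr 7 = s.arr 7 := by rw [f4.arr 7 rfl, f3.arr 7 rfl, f1.arr 7 rfl]
  have B4 : s4.arr 11 = s.arr 11 := by rw [f4.arr 11 rfl, f3.arr 11 rfl, f1.arr 11 rfl]
  have O4 : s4.var 5 = o := by rw [f4.var 5 rfl, f3.var 5 rfl, f1.var 5 rfl, h5]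
  have V4 : s4.var 1 = n / 3 + 1 := by rw [f4.var 1 rfl, v1]
  have K4 : s4.var 3 = n + 1 := by rw [f4.var 3 rfl, h3]
  refine Runs.seq (t₁ := (n + 3) * 21 + 200 * (n + 1 + (n + 1) + 3))
    (sortBy_runs hw hS (key := fun x => s.arr 11 (x + 1)) V4 K4 (by omega) (by omega) rfl
      (fun j hj => ?_) (fun j hj => ?_) (fun j hj => ?_) ?_) (by omega) ?_
  · have := (E4.mem j hj).1
    simp; omega
  · simp [B4]
  · have := (E4.mem j hj).1
    exact (hRKle _ (by omega)).trans (by omega)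
  · simp; omega
  rintro s5 f5 ⟨p5, hp5, h5'⟩
  have E5 := E4.stablePerm hp5 h5'
  have A5 : s5.arr 7 = s.arr 7 := by rw [f5.arr 7 rfl, A4]
  have O5 : s5.var 5 = o := by rw [f5.var 5 rfl, O4]
  have V5 : s5.var 1 = n / 3 + 1 := by rw [f5.var 1 rfl, V4]
  have K5 : s5.var 3 = n + 1 := by rw [f5.var 3 rfl, K4]
  refine Runs.seq (t₁ := (n + 3) * 21 + 200 * (n + 1 + (n + 1) + 3))
    (sortBy_runs hw hS (key := T) V5 K5 (by omega) (by omega) rfl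
      (fun j hj => ?_) (fun j hj => ?_) (fun j hj => ?_) ?_) (by omega) ?_
  · have := (E5.mem j hj).1
    simp [O5]; omega
  · have := (E5.mem j hj).1
    simp [O5, A5, hTA _ (show s5.arr 3 j ≤ n + 2 by omega)]
  · exact (hle _).trans (by omega)
  · simp; omega
  rintro s6 f6 ⟨p6, hp6, h6'⟩
  have E6 := E5.stablePerm hp6 h6'
  refine Cmd.wp.runs hw ?_ (by simp [Cmd.cost]; omega)
  refine ⟨trivial, by simp [f6.var 1 rfl, V5], E6, fun i j hij hj => ?_⟩
  have mi := E6.mem i (hij.trans hj)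
  have mj := E6.mem j hj
  rw [State.arr_setVar, hRK.lexLt_iff_one hT mi.1 mj.1
    (fun h => by have := E6.inj i (hij.trans hj) j hj h; omega) (by omega) (by omega),
    h6' i (hij.trans hj), h6' j hj]
  rcases hp6.sorted i j hij hj with h | ⟨h, h'⟩
  · exact .inl h
  refine .inr ⟨h, ?_⟩
  have li := hp6.lt i (hij.trans hj)
  have lj := hp6.lt j hj
  have hle : s.arr 11 (s5.arr 3 (p6 i) + 1) ≤ s.arr 11 (s5.arr 3 (p6 j) + 1) := by
    rw [h5' _ li, h5' _ lj]
    have := hp5.sorted _ _ h' lj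
    omega
  -- equal ranks are impossible: a tie means that both positions are inside the string
  have m1 := E5.mem _ li
  have m2 := E5.mem _ lj
  have hne : s5.arr 3 (p6 i) ≠ s5.arr 3 (p6 j) := fun h => by
    have := E5.inj _ li _ lj h; omega
  obtain ⟨l1, l2⟩ := hT.lt_of_eq m1.1 m2.1 hne h
  refine lt_of_le_of_ne hle fun heq => ?_
  have q1 : IsSample n (s5.arr 3 (p6 i) + 1) := ⟨l1, by omega⟩
  have q2 : IsSample n (s5.arr 3 (p6 j) + 1) := ⟨l2, by omega⟩
  rcases hT.lexLt_or q1.1 q2.1 (by omega) with h | h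
  · have := (hRK _ _ q1 q2).2 h; omega
  · have := (hRK _ _ q2 q1).2 h; omega

/-- Register `19` tells whether the next suffix in the merged order is the sample suffix at index
`♯14` of array `14` or the other suffix at index `♯15` of array `3`. -/
def mergeCompare : Cmd :=
  19 ≔ 0 ;;
  .ite (♯15 =ₑ ♯18) (19 ≔ 1)
    (.ite (♯14 =ₑ ♯17) .skip
      (11 ≔ 14 ⊙ ♯14 ;;
      12 ≔ 3 ⊙ ♯15 ;;
      .ite (7 ⊙ (♯5 + ♯11) <ₑ 7 ⊙ (♯5 + ♯12)) (19 ≔ 1)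
        (.ite (7 ⊙ (♯5 + ♯11) =ₑ 7 ⊙ (♯5 + ♯12))
          (.ite (♯11 % 3 =ₑ 1) (19 ≔ (11 ⊙ (♯11 + 1) <ₑ 11 ⊙ (♯12 + 1)))
            (.ite (7 ⊙ (♯5 + ♯11 + 1) <ₑ 7 ⊙ (♯5 + ♯12 + 1)) (19 ≔ 1)
              (.ite (7 ⊙ (♯5 + ♯11 + 1) =ₑ 7 ⊙ (♯5 + ♯12 + 1))
                (19 ≔ (11 ⊙ (♯11 + 2) <ₑ 11 ⊙ (♯12 + 2))) .skip)))
          .skip)))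

theorem mergeCompare_wp {w S : ℕ} (hw : 1 < wordCap w) (hS : S ≤ wordCap w) {s : State}
    {o n i j : ℕ} {T : ℕ → ℕ} (h5 : s.var 5 = o) (h14 : s.var 14 = i) (h15 : s.var 15 = j)
    (h17 : s.var 17 = numSample n) (h18 : s.var 18 = n / 3 + 1) (hb : o + n + 20 < S)
    (hT : IsStr T n) (hTA : ∀ i ≤ n + 2, s.arr 7 (o + i) = T i) (hRK : IsRank T n (s.arr 11))
    (hA : ∀ i < numSample n, IsSample n (s.arr 14 i))
    (hX : ∀ i < n / 3 + 1, s.arr 3 i ≤ n ∧ s.arr 3 i % 3 = 0)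
    (hi : i ≤ numSample n) (hj : j ≤ n / 3 + 1) (hij : i + j ≤ n) :
    mergeCompare.wp w S s fun s' =>
      (s'.var 19 ≠ 0 ∧ i < numSample n ∧ (j < n / 3 + 1 → LexLt T (s.arr 14 i) (s.arr 3 j))) ∨
      (s'.var 19 = 0 ∧ j < n / 3 + 1 ∧
        (i < numSample n → LexLt T (s.arr 3 j) (s.arr 14 i))) := by
  have hN : numSample n + (n / 3 + 1) = n + 1 := by unfold numSample; omega
  by_cases hj' : j = n / 3 + 1
  · simp [mergeCompare, Cmd.wp, h15, h18, hj']; omega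
  by_cases hi' : i = numSample n
  · simp [mergeCompare, Cmd.wp, h14, h15, h17, h18, hj', hi']; omega
  obtain ⟨mp, mp3⟩ := hA i (by omega)
  obtain ⟨mq, mq3⟩ := hX j (by omega)
  have hiN : i < numSample n := by omega
  have hjN : j < n / 3 + 1 := by omega
  suffices h : mergeCompare.wp w S s fun s' =>
      (s'.var 19 ≠ 0 ↔ LexLt T (s.arr 14 i) (s.arr 3 j)) by
    refine Cmd.wp.mono (fun s' hs' => ?_) h
    by_cases h0 : s'.var 19 = 0
    · refine .inr ⟨h0, by omega, fun _ => ?_⟩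
      have hn : ¬ LexLt T (s.arr 14 i) (s.arr 3 j) := fun hl => hs'.2 hl h0
      exact (hT.lexLt_or mq mp (by omega)).resolve_right hn
    · exact .inl ⟨h0, by omega, fun _ => hs'.1 h0⟩
  generalize hp : s.arr 14 i = p at *
  generalize hq : s.arr 3 j = q at *
  have c0 := hTA p (by omega)
  have c1 := hTA (p + 1) (by omega)
  have d0 := hTA q (by omega)
  have d1 := hTA (q + 1) (by omega)
  have b : o + p < S ∧ o + q < S ∧ o + p < wordCap w ∧ o + q < wordCap w ∧ i < S ∧ j < S ∧
    3 < wordCap w ∧ p < wordCap w ∧ 1 < wordCap w ∧ o + (p + 1) < S ∧ o + (q + 1) < S ∧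
    o + (p + 1) < wordCap w ∧ o + (q + 1) < wordCap w ∧ p + 1 < wordCap w ∧ q + 1 < wordCap w ∧
    p + 1 < S ∧ q + 1 < S ∧ 2 < wordCap w ∧ 0 < wordCap w ∧
    p + 2 < wordCap w ∧ q + 2 < wordCap w ∧ p + 2 < S ∧ q + 2 < S := by
    refine ⟨?_, ?_, ?_, ?_, ?_, ?_, ?_, ?_, ?_, ?_, ?_, ?_, ?_, ?_, ?_, ?_, ?_, ?_, ?_, ?_, ?_,
      ?_, ?_⟩ <;> omega
  have hiff : LexLt T p q ↔ T p < T q ∨ T p = T q ∧ (if p % 3 = 1 then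
      s.arr 11 (p + 1) < s.arr 11 (q + 1) else T (p + 1) < T (q + 1) ∨ T (p + 1) = T (q + 1) ∧
        s.arr 11 (p + 2) < s.arr 11 (q + 2)) := by
    split_ifs with h
    · exact hRK.lexLt_iff_one hT mp mq (by omega) (by omega) (by omega)
    · exact hRK.lexLt_iff_two hT mp mq (by omega) h (by omega)
  rw [hiff]
  by_cases e0 : T p < T q
  · simp [mergeCompare, Cmd.wp, h5, h14, h15, h17, h18, hp, hq, c0, d0, hj', hi', b, e0]
  by_cases e1 : T p = T q
  · by_cases e2 : p % 3 = 1
    · simp [mergeCompare, Cmd.wp, h5, h14, h15, h17, h18, hp, hq, c0, d0, hj', hi', b, e1, e2]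
    · by_cases e3 : T (p + 1) < T (q + 1)
      · simp [mergeCompare, Cmd.wp, h5, h14, h15, h17, h18, hp, hq, c0, d0, c1, d1, hj', hi', b,
          e1, e2, e3, Nat.add_assoc]
      · by_cases e4 : T (p + 1) = T (q + 1)
        · simp [mergeCompare, Cmd.wp, h5, h14, h15, h17, h18, hp, hq, c0, d0, c1, d1, hj', hi', b,
            e1, e2, e4, Nat.add_assoc]
        · simp [mergeCompare, Cmd.wp, h5, h14, h15, h17, h18, hp, hq, c0, d0, c1, d1, hj', hi', b,
            e1, e2, e3, e4, Nat.add_assoc]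
  · simp [mergeCompare, Cmd.wp, h5, h14, h15, h17, h18, hp, hq, c0, d0, hj', hi', b, e0, e1]

/-- The sorted sample suffixes in array `14` and the other sorted suffixes in array `3` are merged
into array `10`. -/
def mergeSuffixes : Cmd :=
  14 ≔ 0 ;;
  15 ≔ 0 ;;
  16 ≔ 0 ;;
  .loop (♯16 <ₑ ♯6 + 1)
    (mergeCompare ;;
    .ite ♯19 (.write 10 ♯16 (14 ⊙ ♯14) ;; 14 ≔ ♯14 + 1)
      (.write 10 ♯16 (3 ⊙ ♯15) ;; 15 ≔ ♯15 + 1) ;;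
    16 ≔ ♯16 + 1)

theorem mergeSuffixes_runs {w S : ℕ} (hw : 1 < wordCap w) (hS : S ≤ wordCap w) {s : State}
    {o n : ℕ} {T : ℕ → ℕ} (h5 : s.var 5 = o) (h6 : s.var 6 = n)
    (h17 : s.var 17 = numSample n) (h18 : s.var 18 = n / 3 + 1) (hb : o + n + 20 < S)
    (hT : IsStr T n) (hTA : ∀ i ≤ n + 2, s.arr 7 (o + i) = T i) (hRK : IsRank T n (s.arr 11))
    (hA : ∀ i < numSample n, IsSample n (s.arr 14 i))
    (hAs : ∀ i j, i < j → j < numSample n → LexLt T (s.arr 14 i) (s.arr 14 j))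
    (hX : ∀ i < n / 3 + 1, s.arr 3 i ≤ n ∧ s.arr 3 i % 3 = 0)
    (hXs : ∀ i j, i < j → j < n / 3 + 1 → LexLt T (s.arr 3 i) (s.arr 3 j)) :
    Runs w S mergeSuffixes s (120 * (n + 3)) fun s' => IsSA T n (s'.arr 10) := by
  have hN : numSample n + (n / 3 + 1) = n + 1 := by unfold numSample; omega
  refine Runs.seq (P := fun s1 => s1.var 14 = 0) (t₁ := 2)
    (Cmd.wp.runs hw (by simp [Cmd.wp]; omega) (by simp [Cmd.cost])) (by omega) fun s1 f1 g1 => ?_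
  refine Runs.seq (P := fun s1 => s1.var 15 = 0) (t₁ := 2)
    (Cmd.wp.runs hw (by simp [Cmd.wp]; omega) (by simp [Cmd.cost])) (by omega) fun s2 f2 g2 => ?_
  refine Runs.seq (P := fun s1 => s1.var 16 = 0) (t₁ := 2)
    (Cmd.wp.runs hw (by simp [Cmd.wp]; omega) (by simp [Cmd.cost])) (by omega) fun s3 f3 g3 => ?_
  have z14 : s3.var 14 = 0 := by rw [f3.var 14 rfl, f2.var 14 rfl, g1]
  have z15 : s3.var 15 = 0 := by rw [f3.var 15 rfl, g2]
  have z6 : s3.var 6 = n := by rw [f3.var 6 rfl, f2.var 6 rfl, f1.var 6 rfl, h6]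
  have z5 : s3.var 5 = o := by rw [f3.var 5 rfl, f2.var 5 rfl, f1.var 5 rfl, h5]
  have z17 : s3.var 17 = numSample n := by rw [f3.var 17 rfl, f2.var 17 rfl, f1.var 17 rfl, h17]
  have z18 : s3.var 18 = n / 3 + 1 := by rw [f3.var 18 rfl, f2.var 18 rfl, f1.var 18 rfl, h18]
  have a3 : s3.arr = s.arr := by
    funext a; rw [f3.arr a rfl, f2.arr a rfl, f1.arr a rfl]
  refine (Runs.while hw (fun s' => s'.var 14 ≤ numSample n ∧ s'.var 15 ≤ n / 3 + 1 ∧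
      s'.var 16 = s'.var 14 + s'.var 15 ∧ s'.var 16 ≤ n + 1 ∧
      (∀ a < s'.var 16, s'.arr 10 a ≤ n) ∧
      (∀ a b, a < b → b < s'.var 16 → LexLt T (s'.arr 10 a) (s'.arr 10 b)) ∧
      ∀ a < s'.var 16,
        (∀ i, s'.var 14 ≤ i → i < numSample n → LexLt T (s'.arr 10 a) (s.arr 14 i)) ∧
        ∀ j, s'.var 15 ≤ j → j < n / 3 + 1 → LexLt T (s'.arr 10 a) (s.arr 3 j))
    (fun s' => n + 1 - s'.var 16) ?_ ?_ (t := 100 * (n + 2)) ?_).imp (by omega) ?_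
  · rw [z14, z15, g3]
    refine ⟨by omega, by omega, by omega, by omega, fun a ha => by omega, fun a b _ hb => by omega,
      fun a ha => by omega⟩
  · rintro s' hf ⟨hi, hj, hk, hkn, hle, hlt, hlt'⟩
    have v6 : s'.var 6 = n := by rw [hf.var 6 rfl, z6]
    have v5 : s'.var 5 = o := by rw [hf.var 5 rfl, z5]
    have v17 : s'.var 17 = numSample n := by rw [hf.var 17 rfl, z17]
    have v18 : s'.var 18 = n / 3 + 1 := by rw [hf.var 18 rfl, z18]
    have e3 : s'.arr 3 = s.arr 3 := by rw [hf.arr 3 rfl, a3]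
    have e7 : s'.arr 7 = s.arr 7 := by rw [hf.arr 7 rfl, a3]
    have e11 : s'.arr 11 = s.arr 11 := by rw [hf.arr 11 rfl, a3]
    have e14 : s'.arr 14 = s.arr 14 := by rw [hf.arr 14 rfl, a3]
    refine ⟨by simp [v6]; omega, fun hc => ?_⟩
    have hk' : s'.var 16 < n + 1 := by
      by_contra h; simp [v6, h] at hc
    have hcmp := mergeCompare_wp hw hS (s := s') (o := o) (n := n) (T := T) v5 rfl rfl v17 v18 hb
      hT (by rw [e7]; exact hTA) (by rw [e11]; exact hRK) (by rw [e14]; exact hA)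
      (by rw [e3]; exact hX) hi hj (by omega)
    refine Cmd.wp.seq hcmp fun s4 f4 h4 => ?_
    have u14 : s4.var 14 = s'.var 14 := f4.var 14 rfl
    have u15 : s4.var 15 = s'.var 15 := f4.var 15 rfl
    have u16 : s4.var 16 = s'.var 16 := f4.var 16 rfl
    have w3 : s4.arr 3 = s.arr 3 := by rw [f4.arr 3 rfl, e3]
    have w14 : s4.arr 14 = s.arr 14 := by rw [f4.arr 14 rfl, e14]
    have w10 : s4.arr 10 = s'.arr 10 := f4.arr 10 rfl
    rw [e3, e14] at h4
    simp only [Cmd.wp, Expr.OK_add, Expr.OK_read, Expr.OK_var, Expr.OK_ofNat, Expr.val_add,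
      Expr.val_read, Expr.val_var, Expr.val_ofNat, State.var_setVar, State.var_setArr,
      State.arr_setVar, State.arr_setArr_apply, u14, u15, u16, w3, w14, w10,
      Nat.reduceEqDiff, if_true, if_false, true_and]
    rcases h4 with ⟨h19, hin, hlex⟩ | ⟨h19, hjn, hlex⟩
    · refine ⟨fun _ => ?_, fun h => absurd h h19⟩
      refine ⟨by omega, by omega, by omega, by omega, ⟨by omega, by omega, by omega, by omega,
        fun a ha => ?_, fun a b hab hb => ?_, fun a ha => ?_⟩, by omega⟩
      · split_ifs with h
        · exact (hA _ hin).1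
        · exact hle a (by omega)
      · rw [if_neg (show ¬ a = s'.var 16 by omega)]
        split_ifs with h
        · exact (hlt' a (by omega)).1 _ le_rfl hin
        · exact hlt a b hab (by omega)
      · split_ifs with h
        · refine ⟨fun i h1 h2 => hAs _ _ (by omega) h2, fun j h1 h2 => ?_⟩
          rcases Nat.eq_or_lt_of_le h1 with h3 | h3
          · rw [← h3]; exact hlex (by omega)
          · exact (hlex (by omega)).trans (hXs _ _ h3 h2)
        · exact ⟨fun i h1 h2 => (hlt' a (by omega)).1 i (by omega) h2, (hlt' a (by omega)).2⟩
    · refine ⟨fun h => absurd h19 h, fun _ => ?_⟩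
      refine ⟨by omega, by omega, by omega, by omega, ⟨by omega, by omega, by omega, by omega,
        fun a ha => ?_, fun a b hab hb => ?_, fun a ha => ?_⟩, by omega⟩
      · split_ifs with h
        · exact (hX _ hjn).1
        · exact hle a (by omega)
      · rw [if_neg (show ¬ a = s'.var 16 by omega)]
        split_ifs with h
        · exact (hlt' a (by omega)).2 _ le_rfl hjn
        · exact hlt a b hab (by omega)
      · split_ifs with h
        · refine ⟨fun i h1 h2 => ?_, fun j h1 h2 => hXs _ _ (by omega) h2⟩
          rcases Nat.eq_or_lt_of_le h1 with h3 | h3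
          · rw [← h3]; exact hlex (by omega)
          · exact (hlex (by omega)).trans (hAs _ _ h3 h2)
        · exact ⟨(hlt' a (by omega)).1, fun i h1 h2 => (hlt' a (by omega)).2 i (by omega) h2⟩
  · simp [Cmd.cost, mergeCompare, g3]; omega
  · rintro s' hf ⟨⟨_, _, _, hkn, hle, hlt, _⟩, hc⟩
    have hkn' : s'.var 16 = n + 1 := by
      have v6 : s'.var 6 = n := by
        rw [← z6]; exact hf.var 6 rfl
      by_contra h
      have : s'.var 16 < n + 1 := by omega
      simp [v6, this] at hc
    exact ⟨fun i hi => hle i (by omega), fun i j hij hj => hlt i j hij (by omega)⟩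

/-- The strings of the levels below `l` of the recursion: the string of level `k` has length
`L k` and starts in cell `O k` of array `A`, and its reduction starts three cells behind its
end. The string of level `l` has length `n` and starts in cell `o`, the string of level `0` has
length `n₀`. -/
inductive Levels (A O L : ℕ → ℕ) (n₀ : ℕ) : ℕ → ℕ → ℕ → Prop
  | zero : Levels A O L n₀ 0 0 n₀
  | succ {l o n : ℕ} (h : Levels A O L n₀ l o n) (hO : O l = o) (hL : L l = n)
      (hT : IsStr (strAt A o n) n) (hle : ∀ i, strAt A o n i ≤ n)
      (hz : ∀ i, n ≤ i → i < n + 3 → A (o + i) = 0)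
      (hR : IsReduct (strAt A o n) n (strAt A (o + n + 3) (numSample n))) :
      Levels A O L n₀ (l + 1) (o + n + 3) (numSample n)

theorem strAt_congr {A A' : ℕ → ℕ} {o n : ℕ} (h : ∀ i < o + n, A' i = A i) :
    strAt A' o n = strAt A o n := by
  funext i
  unfold strAt
  split_ifs with hi
  · exact h _ (by omega)
  · rfl

theorem Levels.congr {A O L A' O' L' : ℕ → ℕ} {n₀ l o n : ℕ} (h : Levels A O L n₀ l o n)
    (hA : ∀ i < o + n, A' i = A i) (hO : ∀ i < l, O' i = O i) (hL : ∀ i < l, L' i = L i) :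
    Levels A' O' L' n₀ l o n := by
  induction h with
  | zero => exact .zero
  | @succ l o n h hOl hLl hT hle hz hR ih =>
    have e1 : strAt A' o n = strAt A o n := strAt_congr fun i hi => hA i (by omega)
    refine .succ (ih (fun i hi => hA i (by omega)) (fun i hi => hO i (by omega))
      (fun i hi => hL i (by omega))) (by rw [hO l (by omega), hOl]) (by rw [hL l (by omega), hLl])
      (by rwa [e1]) (by rwa [e1]) (fun i h1 h2 => by rw [hA _ (by omega), hz i h1 h2]) ?_
    rw [e1, strAt_congr hA]
    exact hR

/-- The recursion is entered until all names are different. -/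
def reduceLevels : Cmd :=
  5 ≔ 0 ;;
  8 ≔ 0 ;;
  10 ≔ 0 ;;
  .loop (♯10 =ₑ 0) reduceStep

theorem reduceLevels_runs {w S : ℕ} (hw : 1 < wordCap w) (hS : S ≤ wordCap w) {s : State}
    {n₀ : ℕ} (h6 : s.var 6 = n₀) (hb : 100 * (n₀ + 1) ≤ S) (hstr : IsStr (strAt (s.arr 7) 0 n₀) n₀)
    (hle : ∀ i, strAt (s.arr 7) 0 n₀ i ≤ n₀) (hz : ∀ i, n₀ ≤ i → s.arr 7 i = 0) :
    Runs w S reduceLevels s (14600 * (n₀ + 3)) fun s' =>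
      ∃ o n l, s'.var 5 = o ∧ s'.var 6 = n ∧ s'.var 8 = l ∧ o + n ≤ 10 * n₀ + 3 ∧ l ≤ o ∧
        Levels (s'.arr 7) (s'.arr 8) (s'.arr 9) n₀ l o n ∧
        IsStr (strAt (s'.arr 7) o n) n ∧ (∀ i, strAt (s'.arr 7) o n i ≤ n) ∧
        (∀ i < n, ∀ j < n, strAt (s'.arr 7) o n i = strAt (s'.arr 7) o n j → i = j) ∧
        ∀ i < n₀ + 3, s'.arr 7 i = s.arr 7 i := by
  refine Runs.seq (P := fun s1 => s1.var 5 = 0) (t₁ := 2)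
    (Cmd.wp.runs hw (by simp [Cmd.wp]; omega) (by simp [Cmd.cost])) (by omega) fun s1 f1 g1 => ?_
  refine Runs.seq (P := fun s1 => s1.var 8 = 0) (t₁ := 2)
    (Cmd.wp.runs hw (by simp [Cmd.wp]; omega) (by simp [Cmd.cost])) (by omega) fun s2 f2 g2 => ?_
  refine Runs.seq (P := fun s1 => s1.var 10 = 0) (t₁ := 2)
    (Cmd.wp.runs hw (by simp [Cmd.wp]; omega) (by simp [Cmd.cost])) (by omega) fun s3 f3 g3 => ?_
  have a3 : s3.arr = s.arr := by
    funext a; rw [f3.arr a rfl, f2.arr a rfl, f1.arr a rfl]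
  have z5 : s3.var 5 = 0 := by rw [f3.var 5 rfl, f2.var 5 rfl, g1]
  have z8 : s3.var 8 = 0 := by rw [f3.var 8 rfl, g2]
  have z6 : s3.var 6 = n₀ := by rw [f3.var 6 rfl, f2.var 6 rfl, f1.var 6 rfl, h6]
  -- With a string of length `m` starting in cell `o`, the next one has length at most
  -- `2 * m / 3 + 1` and starts in cell `o + m + 3`. As `3 ≤ m` while names repeat, `o + 8 * m` does
  -- not increase, and the last level exceeds this bound only by a constant factor.
  refine (Runs.loop hw (fun s' => (s'.var 10 = 0 → s'.var 5 + 8 * s'.var 6 ≤ 8 * n₀) ∧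
      s'.var 5 + s'.var 6 ≤ 10 * n₀ + 3 ∧ n₀ ≤ s'.var 5 + s'.var 6 ∧ s'.var 8 ≤ s'.var 5 ∧
      Levels (s'.arr 7) (s'.arr 8) (s'.arr 9) n₀ (s'.var 8) (s'.var 5) (s'.var 6) ∧
      IsStr (strAt (s'.arr 7) (s'.var 5) (s'.var 6)) (s'.var 6) ∧
      (∀ i, strAt (s'.arr 7) (s'.var 5) (s'.var 6) i ≤ s'.var 6) ∧
      (∀ i, s'.var 6 ≤ i → s'.arr 7 (s'.var 5 + i) = 0) ∧
      (s'.var 10 ≠ 0 → ∀ i < s'.var 6, ∀ j < s'.var 6,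
        strAt (s'.arr 7) (s'.var 5) (s'.var 6) i = strAt (s'.arr 7) (s'.var 5) (s'.var 6) j →
          i = j) ∧
      ∀ i < n₀ + 3, s'.arr 7 i = s.arr 7 i)
    (fun s' => 1460 * (10 * n₀ + 3 - s'.var 5) + 10) ?_ ?_).imp (by simp only [z5]; omega) ?_
  · simp only [z5, z6, z8, a3, g3]
    refine ⟨by omega, by omega, by omega, by omega, .zero, hstr, hle, fun i hi => ?_,
      fun h => by simp at h, fun _ _ => trivial⟩
    rw [Nat.zero_add]; exact hz i hi
  · rintro s' hf ⟨i1, i2, i3, i4, i5, i6, i7, i8, -, i10⟩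
    refine ⟨by simp; omega, by simp, fun hc => ?_⟩
    have h10 : s'.var 10 = 0 := by
      by_contra h; simp [h] at hc
    have i1 := i1 h10
    refine ⟨_, (reduceStep_runs hw hS rfl rfl rfl (by omega) (by omega) i6 i7 i8).imp le_rfl ?_⟩
    rintro s'' - ⟨v5, v6, v8, b8, b9, b7, bz, hR, hfl, hfl'⟩
    have hns : numSample (s'.var 6) ≤ s'.var 6 := by unfold numSample; omega
    simp only [v5, v6, v8]
    have e1 : strAt (s''.arr 7) (s'.var 5) (s'.var 6) = strAt (s'.arr 7) (s'.var 5) (s'.var 6) :=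
      strAt_congr fun i hi => b7 i (by omega)
    refine ⟨⟨fun h => ?_, by omega, by omega, by omega, ?_, hR.str, hR.le, bz, hfl',
      fun i hi => ?_⟩, ?_⟩
    · have := hfl h
      have : 8 * numSample (s'.var 6) + s'.var 6 + 3 ≤ 8 * s'.var 6 := by
        unfold numSample
        rcases (by omega : s'.var 6 % 3 = 0 ∨ s'.var 6 % 3 = 1 ∨ s'.var 6 % 3 = 2)
          with h | h | h <;> omega
      omega
    · refine .succ (i5.congr (fun i hi => b7 i (by omega)) (fun i hi => ?_) fun i hi => ?_) ?_ ?_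
        (by rwa [e1]) (by rwa [e1]) (fun i h1 h2 => ?_) (by rwa [e1])
      · rw [b8, if_neg (by omega)]
      · rw [b9, if_neg (by omega)]
      · rw [b8, if_pos rfl]
      · rw [b9, if_pos rfl]
      · rw [b7 _ (by omega), i8 i h1]
    · rw [b7 i (by omega), i10 i hi]
    · simp only [Expr.cost]; simp; omega
  · rintro s' - ⟨⟨-, i2, i3, i4, i5, i6, i7, i8, i9, i10⟩, hc⟩
    have h10 : s'.var 10 ≠ 0 := by
      intro h; simp [h] at hc
    exact ⟨_, _, _, rfl, rfl, rfl, i2, i4, i5, i6, i7, i9 h10, i10⟩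

/-- The suffix array of the last level, whose symbols are different. -/
def baseLevel : Cmd :=
  .write 10 0 ♯6 ;;
  .forTo 2 6 (.write 10 (7 ⊙ (♯5 + ♯2)) ♯2)

theorem baseLevel_runs {w S : ℕ} (hw : 1 < wordCap w) (hS : S ≤ wordCap w) {s : State}
    {o n : ℕ} (h5 : s.var 5 = o) (h6 : s.var 6 = n) (hb : o + n + 2 < S)
    (hstr : IsStr (strAt (s.arr 7) o n) n) (hle : ∀ i, strAt (s.arr 7) o n i ≤ n)
    (hinj : ∀ i < n, ∀ j < n, strAt (s.arr 7) o n i = strAt (s.arr 7) o n j → i = j) :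
    Runs w S baseLevel s (20 * (n + 3)) fun s' => IsSA (strAt (s.arr 7) o n) n (s'.arr 10) := by
  refine Runs.seq (P := fun s1 => s1.arr 10 0 = n) (t₁ := 3)
    (Cmd.wp.runs hw (by simp [Cmd.wp, h6]; omega) (by simp [Cmd.cost])) (by omega)
    fun s1 f1 g1 => ?_
  have v6 : s1.var 6 = n := by rw [f1.var 6 rfl, h6]
  have hT : ∀ i < n, s.arr 7 (o + i) = strAt (s.arr 7) o n i := fun i hi => by
    simp [strAt, hi]
  refine (Runs.forTo hw v6 (fun j s' => s'.arr 10 0 = n ∧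
    ∀ t < j, s'.arr 10 (strAt (s.arr 7) o n t) = t) (by decide) rfl rfl (by omega) ?_ ?_ ?_).imp
    le_rfl ?_
  · exact ⟨g1, fun t ht => by omega⟩
  · rintro j s' hj hf hi ⟨hJ, hJ'⟩
    have v5 : s'.var 5 = o := by rw [hf.var 5 rfl, f1.var 5 rfl, h5]
    have a7 : s'.arr 7 = s.arr 7 := by rw [hf.arr 7 rfl, f1.arr 7 rfl]
    have := hle j
    have hp := hstr.pos j hj
    simp only [Cmd.wp, Expr.OK_add, Expr.OK_read, Expr.val_add, Expr.val_read, Expr.OK_var,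
      Expr.val_var, hi, v5, a7, hT j hj, State.arr_setVar, State.arr_setArr_apply, true_and]
    refine ⟨by omega, by omega, ?_, fun t ht => ?_⟩
    · rw [if_neg (by omega)]; exact hJ
    · split_ifs with h
      · exact (hinj t (by omega) j hj h).symm
      · refine hJ' t ?_
        by_contra hc
        exact h (by rw [show t = j by omega])
  · simp [Cmd.cost]; omega
  · rintro s' - ⟨h0, h⟩
    exact isSA_of_inj hstr hle hinj h0 h

/-- The suffix array of a string is computed from that of its reduction. -/
def expandStep : Cmd :=
  8 ≔ ♯8 - 1 ;;
  5 ≔ 8 ⊙ ♯8 ;;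
  6 ≔ 9 ⊙ ♯8 ;;
  rankSamples ;;
  sortMultiples ;;
  mergeSuffixes

theorem expandStep_runs {w S : ℕ} (hw : 1 < wordCap w) (hS : S ≤ wordCap w) {s : State}
    {l o n : ℕ} (h8 : s.var 8 = l + 1) (hO : s.arr 8 l = o) (hL : s.arr 9 l = n)
    (hl : l + 2 < S) (hb : o + n + 20 < S)
    (hT : IsStr (strAt (s.arr 7) o n) n) (hle : ∀ i, strAt (s.arr 7) o n i ≤ n)
    (hz : ∀ i, n ≤ i → i < n + 3 → s.arr 7 (o + i) = 0)
    (hR : IsReduct (strAt (s.arr 7) o n) n (strAt (s.arr 7) (o + n + 3) (numSample n)))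
    (hsa : IsSA (strAt (s.arr 7) (o + n + 3) (numSample n)) (numSample n) (s.arr 10)) :
    Runs w S expandStep s (1258 * (n + 3)) fun s' =>
      s'.var 8 = l ∧ s'.var 5 = o ∧ s'.var 6 = n ∧
        IsSA (strAt (s.arr 7) o n) n (s'.arr 10) := by
  have hTA : ∀ i ≤ n + 2, s.arr 7 (o + i) = strAt (s.arr 7) o n i := fun i hi => by
    unfold strAt
    split_ifs with h
    · rfl
    · exact hz i (by omega) (by omega)
  refine Runs.seq (P := fun s1 => s1.var 8 = l) (t₁ := 4)
    (Cmd.wp.runs hw (by simp [Cmd.wp, h8]; omega) (by simp [Cmd.cost])) (by omega)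
    fun s1 f1 g1 => ?_
  refine Runs.seq (P := fun s1 => s1.var 5 = o) (t₁ := 4)
    (Cmd.wp.runs hw (by simp [Cmd.wp, g1, f1.arr 8 rfl, hO]; omega) (by simp [Cmd.cost]))
    (by omega) fun s2 f2 g2 => ?_
  refine Runs.seq (P := fun s1 => s1.var 6 = n) (t₁ := 4)
    (Cmd.wp.runs hw (by simp [Cmd.wp, f2.var 8 rfl, g1, f2.arr 9 rfl, f1.arr 9 rfl, hL]; omega)
      (by simp [Cmd.cost])) (by omega) fun s3 f3 g3 => ?_
  have a3 : s3.arr = s.arr := by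
    funext a; rw [f3.arr a rfl, f2.arr a rfl, f1.arr a rfl]
  have v5 : s3.var 5 = o := by rw [f3.var 5 rfl, g2]
  have v8 : s3.var 8 = l := by rw [f3.var 8 rfl, f2.var 8 rfl, g1]
  refine Runs.seq (rankSamples_runs hw hS g3 (by omega) hT hR (by rw [a3]; exact hsa)) (by omega) ?_
  rintro s4 f4 ⟨v17, hE, hs, hRK, hRKle⟩
  have a4 : s4.arr 7 = s.arr 7 := by rw [f4.arr 7 rfl, a3]
  have w5 : s4.var 5 = o := by rw [f4.var 5 rfl, v5]
  have w6 : s4.var 6 = n := by rw [f4.var 6 rfl, g3]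
  refine Runs.seq (sortMultiples_runs hw hS w5 w6 hb hT hle (by rw [a4]; exact hTA) hRK hRKle)
    (by omega) ?_
  rintro s5 f5 ⟨v18, hE', hs'⟩
  refine (mergeSuffixes_runs hw hS (o := o) (n := n) (by rw [f5.var 5 rfl, w5])
    (by rw [f5.var 6 rfl, w6]) (by rw [f5.var 17 rfl, v17]) v18 hb hT
    (by rw [f5.arr 7 rfl, a4]; exact hTA) (by rw [f5.arr 11 rfl]; exact hRK)
    (by rw [f5.arr 14 rfl]; exact hE.mem) (by rw [f5.arr 14 rfl]; exact hs) hE'.mem hs').imp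
    (by omega) ?_
  rintro s6 f6 h6
  exact ⟨by rw [f6.var 8 rfl, f5.var 8 rfl, f4.var 8 rfl, v8],
    by rw [f6.var 5 rfl, f5.var 5 rfl, w5], by rw [f6.var 6 rfl, f5.var 6 rfl, w6], h6⟩

/-- Array `10` gets the suffix array of the string of length `♯6` in array `7`. -/
def suffixArray : Cmd :=
  reduceLevels ;;
  baseLevel ;;
  .loop (0 <ₑ ♯8) expandStep

theorem suffixArray_runs {w S : ℕ} (hw : 1 < wordCap w) (hS : S ≤ wordCap w) {s : State}
    {n₀ : ℕ} (h6 : s.var 6 = n₀) (hb : 100 * (n₀ + 1) ≤ S) (hstr : IsStr (strAt (s.arr 7) 0 n₀) n₀)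
    (hle : ∀ i, strAt (s.arr 7) 0 n₀ i ≤ n₀) (hz : ∀ i, n₀ ≤ i → s.arr 7 i = 0) :
    Runs w S suffixArray s (30000 * (n₀ + 3)) fun s' =>
      IsSA (strAt (s.arr 7) 0 n₀) n₀ (s'.arr 10) ∧ ∀ i < n₀ + 3, s'.arr 7 i = s.arr 7 i := by
  refine Runs.seq (reduceLevels_runs hw hS h6 hb hstr hle hz) (by omega) ?_
  rintro s1 f1 ⟨o, n, l, v5, v6, v8, hon, hl, hlev, hs, hc, hinj, h7⟩
  refine Runs.seq (t₁ := 20 * (10 * n₀ + 6)) ((baseLevel_runs hw hS v5 v6 (by omega) hs hc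
    hinj).imp (by omega) fun _ _ h => h) (by omega) ?_
  intro s2 f2 hsa
  have a7 : s2.arr 7 = s1.arr 7 := f2.arr 7 rfl
  -- Returning to a level of length `m` moves the start back by `m + 3` cells, which pays for the
  -- time spent on it.
  refine (Runs.loop hw (fun s' => s'.var 5 + s'.var 6 ≤ 10 * n₀ + 3 ∧ s'.var 8 ≤ s'.var 5 ∧
      Levels (s2.arr 7) (s2.arr 8) (s2.arr 9) n₀ (s'.var 8) (s'.var 5) (s'.var 6) ∧
      IsSA (strAt (s2.arr 7) (s'.var 5) (s'.var 6)) (s'.var 6) (s'.arr 10))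
    (fun s' => 1260 * s'.var 5 + 10) ?_ ?_).imp ?_ ?_
  · rw [f2.var 5 rfl, f2.var 6 rfl, f2.var 8 rfl, v5, v6, v8, a7, f2.arr 8 rfl, f2.arr 9 rfl]
    exact ⟨hon, hl, hlev, hsa⟩
  · rintro s' hf ⟨i1, i2, i3, i4⟩
    refine ⟨by simp; omega, by simp, fun hc => ?_⟩
    have h8 : 0 < s'.var 8 := by
      by_contra h; simp [h] at hc
    have b7 : s'.arr 7 = s2.arr 7 := hf.arr 7 rfl
    have b8 : s'.arr 8 = s2.arr 8 := hf.arr 8 rfl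
    have b9 : s'.arr 9 = s2.arr 9 := hf.arr 9 rfl
    generalize hv8 : s'.var 8 = l' at *
    generalize hv5 : s'.var 5 = o' at *
    generalize hv6 : s'.var 6 = n' at *
    cases i3 with
    | zero => omega
    | @succ l o n hl' hO hL hT hle' hz' hR =>
      refine ⟨_, (expandStep_runs hw hS (l := l) (o := o) (n := n) hv8 (by rw [b8, hO])
        (by rw [b9, hL]) (by omega) (by omega) (by rwa [b7]) (by rwa [b7]) (by rwa [b7])
        (by rwa [b7]) (by rwa [b7])).imp le_rfl ?_⟩
      rintro s'' - ⟨u8, u5, u6, hsa'⟩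
      rw [u8, u5, u6, ← b7]
      refine ⟨⟨by omega, ?_, by rwa [b7], hsa'⟩, ?_⟩
      · have : ∀ {A O L : ℕ → ℕ} {n₀ l o n : ℕ}, Levels A O L n₀ l o n → l ≤ o := by
          intro A O L n₀ l o n h
          induction h with
          | zero => exact le_rfl
          | succ _ _ _ _ _ _ _ ih => omega
        exact this hl'
      · simp only [Expr.cost]; simp; omega
  · have : s2.var 5 ≤ 10 * n₀ + 3 := by rw [f2.var 5 rfl]; omega
    omega
  · rintro s' hf ⟨⟨i1, i2, i3, i4⟩, hc⟩
    have h8 : s'.var 8 = 0 := by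
      by_contra h; simp [Nat.pos_iff_ne_zero, h] at hc
    have b7 : s'.arr 7 = s1.arr 7 := by rw [← a7]; exact hf.arr 7 rfl
    generalize hv8 : s'.var 8 = l' at *
    generalize hv5 : s'.var 5 = o' at *
    generalize hv6 : s'.var 6 = n' at *
    cases i3 with
    | succ => omega
    | zero =>
      refine ⟨?_, fun i hi => by rw [b7, h7 i hi]⟩
      rwa [a7, strAt_congr (A := s.arr 7) (A' := s1.arr 7) fun i hi => h7 i (by omega)] at i4

/-! ### Longest common prefixes of neighbours in the suffix array -/

/-- The suffixes that start at `i` and `j` agree in their first `l` symbols. -/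
def Agree (T : ℕ → ℕ) (i j l : ℕ) : Prop := ∀ k < l, T (i + k) = T (j + k)

theorem Agree.symm {T : ℕ → ℕ} {i j l : ℕ} (h : Agree T i j l) : Agree T j i l :=
  fun k hk => (h k hk).symm

theorem Agree.trans {T : ℕ → ℕ} {i j k l : ℕ} (h : Agree T i j l) (h' : Agree T j k l) :
    Agree T i k l := fun m hm => (h m hm).trans (h' m hm)

theorem Agree.mono {T : ℕ → ℕ} {i j l m : ℕ} (h : Agree T i j l) (hm : m ≤ l) : Agree T i j m :=
  fun k hk => h k (hk.trans_le hm)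

theorem IsStr.agree_le {T : ℕ → ℕ} {n i j l : ℕ} (hT : IsStr T n) (hi : i ≤ n) (hj : j ≤ n)
    (hne : i ≠ j) (h : Agree T i j l) : i + l ≤ n ∧ j + l ≤ n := by
  have key : ∀ {i j : ℕ}, i < j → j ≤ n → Agree T i j l → j + l ≤ n := by
    intro i j hij hj h
    by_contra hc
    exact hT.exists_ne hij hj (h (n - j) (by omega))
  rcases Nat.lt_or_gt_of_ne hne with h1 | h1
  · have := key h1 hj h; omega
  · have := key h1 hi h.symm; omega

/-- A suffix between two suffixes in lexicographic order shares their common prefix. -/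
theorem Agree.between {T : ℕ → ℕ} {x y z m : ℕ} (h : Agree T x z m) (hxy : LexLt T x y)
    (hyz : LexLt T y z) : Agree T y z m := by
  obtain ⟨k, hk, hlt⟩ := hyz
  rcases Nat.lt_or_ge k m with hkm | hkm
  · have : LexLt T y x := ⟨k, fun i hi => (hk i hi).trans (h i (hi.trans hkm)).symm, by
      rw [h k hkm]; exact hlt⟩
    exact absurd this hxy.asymm
  · exact fun i hi => hk i (hi.trans_le hkm)

/-- `L r` is the length of the longest common prefix of the `r`-th suffix and its predecessor. -/
def IsLCP (T sa : ℕ → ℕ) (n : ℕ) (L : ℕ → ℕ) : Prop :=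
  ∀ r, 0 < r → r ≤ n → Agree T (sa r) (sa (r - 1)) (L r) ∧
    T (sa r + L r) ≠ T (sa (r - 1) + L r)

/-- Common prefixes of distant suffixes are range minima of those of neighbours. -/
theorem IsLCP.agree_iff {T sa L : ℕ → ℕ} {n : ℕ} (hL : IsLCP T sa n L) (hsa : IsSA T n sa)
    {a b m : ℕ} (hab : a < b) (hb : b ≤ n) :
    Agree T (sa a) (sa b) m ↔ ∀ r, a < r → r ≤ b → m ≤ L r := by
  have adj : ∀ r, 0 < r → r ≤ n → (Agree T (sa (r - 1)) (sa r) m ↔ m ≤ L r) := fun r h0 hr => by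
    obtain ⟨h1, h2⟩ := hL r h0 hr
    refine ⟨fun h => ?_, fun h => (h1.mono h).symm⟩
    by_contra hc
    exact h2 (h _ (by omega)).symm
  induction b with
  | zero => omega
  | succ b ih =>
    have hadj := adj (b + 1) (by omega) hb
    rw [Nat.add_sub_cancel] at hadj
    rcases Nat.eq_or_lt_of_le (show a ≤ b by omega) with rfl | hlt
    · rw [hadj]
      exact ⟨fun h r h1 h2 => by rwa [show r = a + 1 by omega],
        fun h => h _ (by omega) le_rfl⟩
    · have ih := ih hlt (by omega)
      have h1 := hsa.lt a b hlt (by omega)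
      have h2 := hsa.lt b (b + 1) (by omega) hb
      constructor
      · intro h
        have h3 := h.between h1 h2
        have h4 := ih.1 (h.trans h3.symm)
        intro r hr hrb
        rcases Nat.eq_or_lt_of_le hrb with rfl | h5
        · exact hadj.1 h3
        · exact h4 r hr (by omega)
      · intro h
        exact (ih.2 fun r hr hrb => h r hr (by omega)).trans (hadj.2 (h _ (by omega) le_rfl))

/-- Passing from a suffix to the next one in the text shortens the common prefix with the
predecessor in the suffix array by at most one symbol. -/
theorem agree_pred_succ {T sa : ℕ → ℕ} {n a b l : ℕ} (hT : IsStr T n) (hsa : IsSA T n sa)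
    (ha : 0 < a) (han : a ≤ n) (hb : 0 < b) (hbn : b ≤ n) (hab : sa b = sa a + 1)
    (h : Agree T (sa a) (sa (a - 1)) (l + 1)) : Agree T (sa b) (sa (b - 1)) l := by
  have hlt := hsa.lt (a - 1) a (by omega) han
  have h0 : T (sa (a - 1)) = T (sa a) := by simpa using (h 0 (by omega)).symm
  have hne : sa (a - 1) ≠ sa a := fun h' => by
    have := hsa.inj (by omega) han h'; omega
  obtain ⟨h1, -⟩ := hT.lt_of_eq (hsa.le _ (by omega)) (hsa.le _ han) hne h0
  have hlt' : LexLt T (sa (a - 1) + 1) (sa a + 1) := by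
    rcases lexLt_cons.1 hlt with h2 | ⟨_, h2⟩
    · omega
    · exact h2
  have hag : Agree T (sa (a - 1) + 1) (sa a + 1) l := fun k hk => by
    have := h (k + 1) (by omega)
    rw [Nat.add_right_comm, Nat.add_right_comm (sa a), Nat.add_assoc, Nat.add_assoc]
    exact this.symm
  obtain ⟨c, hc, hcj⟩ := hsa.surj (show sa (a - 1) + 1 ≤ n by omega)
  rw [← hcj, ← hab] at hlt' hag
  have hcb : c < b := by
    by_contra hcb
    rcases Nat.eq_or_lt_of_le (show b ≤ c by omega) with rfl | h3
    · exact LexLt.irrefl hlt'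
    · exact hlt'.asymm (hsa.lt b c h3 hc)
  rcases Nat.eq_or_lt_of_le (show c ≤ b - 1 by omega) with rfl | h3
  · exact hag.symm
  · exact (hag.between (hsa.lt c (b - 1) h3 (by omega)) (hsa.lt (b - 1) b (by omega) hbn)).symm

/-- Kasai's algorithm: array `12` gets the lengths of the longest common prefixes of neighbours in
the suffix array, which is in array `10`. Register `20` is the current suffix and register `21`
the length up to which it has been compared with its predecessor. -/
def kasai : Cmd :=
  6 ≔ ♯0 + 1 ;;
  .forTo 2 6 (.write 11 (10 ⊙ ♯2) ♯2) ;;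
  20 ≔ 0 ;;
  21 ≔ 0 ;;
  .loop (♯20 <ₑ ♯0)
    (22 ≔ 10 ⊙ (11 ⊙ ♯20 - 1) ;;
    .ite (7 ⊙ (♯20 + ♯21) =ₑ 7 ⊙ (♯22 + ♯21)) (21 ≔ ♯21 + 1)
      (.write 12 (11 ⊙ ♯20) ♯21 ;;
      20 ≔ ♯20 + 1 ;;
      .ite (♯21 =ₑ 0) .skip (21 ≔ ♯21 - 1)))

theorem kasai_runs {w S : ℕ} (hw : 1 < wordCap w) (hS : S ≤ wordCap w) {s : State}
    {n : ℕ} {T : ℕ → ℕ} (h0 : s.var 0 = n) (hb : 2 * n + 20 < S) (hT : IsStr T n)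
    (hTA : ∀ i ≤ n, s.arr 7 i = T i) (hsa : IsSA T n (s.arr 10)) :
    Runs w S kasai s (120 * (n + 3)) fun s' => IsLCP T (s.arr 10) n (s'.arr 12) := by
  refine Runs.seq (P := fun s1 => s1.var 6 = n + 1) (t₁ := 4)
    (Cmd.wp.runs hw (by simp [Cmd.wp, h0]; omega) (by simp [Cmd.cost])) (by omega)
    fun s1 f1 g1 => ?_
  have b10 : s1.arr 10 = s.arr 10 := f1.arr 10 rfl
  refine Runs.seq (t₁ := 20 * (n + 3)) (Runs.forTo hw g1
    (fun j s' => ∀ r < j, s'.arr 11 (s.arr 10 r) = r) (by decide) rfl rfl (by omega)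
    (fun r hr => by omega) ?_ ?_) (by omega) fun s2 f2 hrk => ?_
  · rintro j s' hj hf hi hJ
    have a10 : s'.arr 10 = s.arr 10 := by rw [hf.arr 10 rfl, b10]
    have := hsa.le j (by omega)
    simp only [Cmd.wp, Expr.OK_read, Expr.val_read, Expr.OK_var,
      Expr.val_var, hi, a10, State.arr_setVar, State.arr_setArr_apply, true_and]
    refine ⟨by omega, by omega, fun r hr => ?_⟩
    split_ifs with h
    · exact hsa.inj (by omega) (by omega) h.symm
    · refine hJ r ?_
      by_contra hc
      exact h (by rw [show r = j by omega])
  · simp [Cmd.cost]; omega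
  refine Runs.seq (P := fun s1 => s1.var 20 = 0) (t₁ := 2)
    (Cmd.wp.runs hw (by simp [Cmd.wp]; omega) (by simp [Cmd.cost])) (by omega) fun s3 f3 g3 => ?_
  refine Runs.seq (P := fun s1 => s1.var 21 = 0) (t₁ := 2)
    (Cmd.wp.runs hw (by simp [Cmd.wp]; omega) (by simp [Cmd.cost])) (by omega) fun s4 f4 g4 => ?_
  have z20 : s4.var 20 = 0 := by rw [f4.var 20 rfl, g3]
  have z0 : s4.var 0 = n := by rw [f4.var 0 rfl, f3.var 0 rfl, f2.var 0 rfl, f1.var 0 rfl, h0]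
  have c10 : s4.arr 10 = s.arr 10 := by rw [f4.arr 10 rfl, f3.arr 10 rfl, f2.arr 10 rfl, b10]
  have c7 : s4.arr 7 = s.arr 7 := by rw [f4.arr 7 rfl, f3.arr 7 rfl, f2.arr 7 rfl, f1.arr 7 rfl]
  have c11 : s4.arr 11 = s2.arr 11 := by rw [f4.arr 11 rfl, f3.arr 11 rfl]
  have hpos : ∀ i, i < n → ∃ r, 0 < r ∧ r ≤ n ∧ s.arr 10 r = i ∧ s2.arr 11 i = r := fun i hi => by
    obtain ⟨r, hr, hri⟩ := hsa.surj hi.le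
    refine ⟨r, ?_, hr, hri, by rw [← hri]; exact hrk r (by omega)⟩
    by_contra h
    have := hsa.zero hT
    rw [show r = 0 by omega] at hri; omega
  refine (Runs.while hw (fun s' => s'.var 20 + s'.var 21 ≤ n ∧
      (∀ r, 0 < r → r ≤ n → s.arr 10 r = s'.var 20 →
        Agree T (s.arr 10 r) (s.arr 10 (r - 1)) (s'.var 21)) ∧
      ∀ r, 0 < r → r ≤ n → s.arr 10 r < s'.var 20 →
        Agree T (s.arr 10 r) (s.arr 10 (r - 1)) (s'.arr 12 r) ∧
        T (s.arr 10 r + s'.arr 12 r) ≠ T (s.arr 10 (r - 1) + s'.arr 12 r))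
    -- Each iteration either extends the comparison by one symbol or passes to the next suffix and
    -- shortens the comparison by at most one.
    (fun s' => 2 * n - (2 * s'.var 20 + s'.var 21)) ?_ ?_ (t := 99 * (n + 2)) ?_).imp (by omega) ?_
  · rw [z20, g4]
    exact ⟨by omega, fun _ _ _ _ k hk => by omega, fun r _ _ h => by omega⟩
  · rintro s' hf ⟨hle, hag, hdone⟩
    have v0 : s'.var 0 = n := by rw [hf.var 0 rfl, z0]
    have a7 : s'.arr 7 = s.arr 7 := by rw [hf.arr 7 rfl, c7]
    have a10 : s'.arr 10 = s.arr 10 := by rw [hf.arr 10 rfl, c10]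
    have a11 : s'.arr 11 = s2.arr 11 := by rw [hf.arr 11 rfl, c11]
    refine ⟨by simp, fun hc => ?_⟩
    generalize hi : s'.var 20 = i at *
    generalize hl : s'.var 21 = l at *
    have hin : i < n := by
      by_contra h; simp [v0, hi, h] at hc
    obtain ⟨r, hr0, hrn, hri, hrk'⟩ := hpos i hin
    have hag' := hag r hr0 hrn hri
    have hj := hsa.le (r - 1) (by omega)
    have hne : s.arr 10 r ≠ s.arr 10 (r - 1) := fun h => by
      have := hsa.inj hrn (by omega) h; omega
    have hll := hT.agree_le (hsa.le r hrn) hj hne hag'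
    rw [hri] at hll hne
    refine Cmd.wp.seq (P := fun s'' => s''.var 22 = s.arr 10 (r - 1)) ?_ fun s5 f5 g5 => ?_
    · simp [Cmd.wp, hi, a10, a11, hrk']; omega
    have d20 : s5.var 20 = i := by rw [f5.var 20 rfl, hi]
    have d21 : s5.var 21 = l := by rw [f5.var 21 rfl, hl]
    have d7 : s5.arr 7 = s.arr 7 := by rw [f5.arr 7 rfl, a7]
    have d11 : s5.arr 11 = s2.arr 11 := by rw [f5.arr 11 rfl, a11]
    have d12 : s5.arr 12 = s'.arr 12 := f5.arr 12 rfl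
    have t1 := hTA (i + l) (by omega)
    have t2 := hTA (s.arr 10 (r - 1) + l) (by omega)
    by_cases heq : T (i + l) = T (s.arr 10 (r - 1) + l)
    · have hag2 : Agree T (s.arr 10 r) (s.arr 10 (r - 1)) (l + 1) := fun k hk => by
        rcases Nat.eq_or_lt_of_le (show k ≤ l by omega) with rfl | h
        · rw [hri]; exact heq
        · exact hag' k h
      have hll2 := hT.agree_le (hsa.le r hrn) hj (by rwa [hri]) hag2
      rw [hri] at hll2
      simp [Cmd.wp, d20, d21, d7, g5, t1, t2, heq, d12]
      refine ⟨by omega, by omega, ⟨by omega, fun r' h1 h2 h3 => ?_, hdone⟩, by omega⟩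
      rw [hsa.inj h2 hrn (h3.trans hri.symm)]
      exact hag2
    · have hdone' : ∀ r', 0 < r' → r' ≤ n → s.arr 10 r' < i + 1 →
          Agree T (s.arr 10 r') (s.arr 10 (r' - 1)) (if r' = r then l else s'.arr 12 r') ∧
          ¬ T (s.arr 10 r' + (if r' = r then l else s'.arr 12 r')) =
            T (s.arr 10 (r' - 1) + (if r' = r then l else s'.arr 12 r')) := fun r' h1 h2 h3 => by
        by_cases h : r' = r
        · subst h
          rw [if_pos rfl]
          exact ⟨hag', by rwa [hri]⟩
        · rw [if_neg h]
          refine hdone r' h1 h2 ?_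
          have : s.arr 10 r' ≠ i := fun h' => h (hsa.inj h2 hrn (h'.trans hri.symm))
          omega
      simp [Cmd.wp, d20, d21, d7, d11, g5, t1, t2, heq, d12, hrk']
      refine ⟨by omega, by omega, by omega, by omega, by omega, fun hl0 => ?_, fun hl0 => ?_⟩
      · exact ⟨⟨by omega, fun _ _ _ _ k hk => by omega, fun r' h1 h2 h3 =>
          hdone' r' h1 h2 (by omega)⟩, by omega⟩
      · refine ⟨by omega, ⟨by omega, fun r' h1 h2 h3 => ?_, fun r' h1 h2 h3 =>
          hdone' r' h1 h2 (by omega)⟩, by omega⟩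
        exact agree_pred_succ hT hsa hr0 hrn h1 h2 (by rw [h3, hri])
          (by rwa [Nat.sub_add_cancel (by omega)])
  · simp [Cmd.cost, z20, g4]; omega
  · rintro s' hf ⟨⟨_, _, hdone⟩, hc⟩
    have v0 : s'.var 0 = n := by rw [← z0]; exact hf.var 0 rfl
    intro r h1 h2
    refine hdone r h1 h2 ?_
    have h3 : s.arr 10 r < n := lt_of_le_of_ne (hsa.le r h2) fun h => by
      have := hsa.inj (j := 0) h2 (by omega) (by rw [h, hsa.zero hT]); omega
    have h4 : ¬ s'.var 20 < n := by
      intro h; simp [v0, h] at hc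
    omega

/-! ### Longest previous factors -/

/-- No suffix that starts before `b` agrees with that at `b` in more than `d` symbols. -/
def MaxPrev (T : ℕ → ℕ) (b d : ℕ) : Prop := ∀ j < b, ∀ m, Agree T j b m → m ≤ d

/-- `d` is the length of the longest previous factor at `b` and `s` is an occurrence of it that
has no longer previous factor itself. -/
structure IsParent (T : ℕ → ℕ) (b d s : ℕ) : Prop where
  lt : s < b
  agree : Agree T s b d
  max : MaxPrev T b d
  max' : MaxPrev T s d

/-- The stack of a left-to-right scan of the suffix array up to entry `k`. The scanned entries are
divided into the blocks `[st i, st (i + 1))` for `i ≤ t`; `P i` is the least position in block `i`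
and `D i` the longest common prefix at the border between the blocks `i - 1` and `i`. -/
structure StackInv (sa L : ℕ → ℕ) (n k t : ℕ) (st P D : ℕ → ℕ) : Prop where
  st_zero : st 0 = 0
  st_end : st (t + 1) = k
  mono : ∀ i ≤ t, st i < st (i + 1)
  le : k ≤ n + 1
  mem : ∀ i ≤ t, ∃ r, st i ≤ r ∧ r < st (i + 1) ∧ sa r = P i
  min : ∀ i ≤ t, ∀ r, st i ≤ r → r < st (i + 1) → P i ≤ sa r
  dep : ∀ i, 0 < i → i ≤ t → D i = L (st i)
  dep_zero : D 0 = 0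
  dep_mono : ∀ i < t, D i ≤ D (i + 1)
  inner : ∀ i ≤ t, ∀ r, st i < r → r < st (i + 1) → D i ≤ L r
  inner' : ∀ i < t, ∀ r, st i < r → r < st (i + 1) → D (i + 1) ≤ L r
  inner_top : k ≤ n → ∀ r, st t < r → r < k → L k ≤ L r

section stack
variable {T sa L : ℕ → ℕ} {n k t : ℕ} {st P D : ℕ → ℕ}

theorem StackInv.st_lt (h : StackInv sa L n k t st P D) {i j : ℕ} (hij : i < j)
    (hj : j ≤ t + 1) : st i < st j := by
  induction j with
  | zero => omega
  | succ j ih =>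
    have := h.mono j (by omega)
    rcases Nat.eq_or_lt_of_le (show i ≤ j by omega) with rfl | h1
    · exact this
    · exact (ih h1 (by omega)).trans this

/-- A new entry is put on the stack as a block of its own. -/
theorem StackInv.push (h : StackInv sa L n k t st P D) {P' D' : ℕ → ℕ} (hk : k ≤ n)
    (hD : D t ≤ L k) (hP' : ∀ i, P' i = if i = t + 1 then sa k else P i)
    (hD' : ∀ i, D' i = if i = t + 1 then L k else D i) :
    StackInv sa L n (k + 1) (t + 1) (fun i => if i = t + 2 then k + 1 else st i) P' D' where
  st_zero := by simpa using h.st_zero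
  st_end := by simp
  mono i hi := by
    rw [if_neg (show i ≠ t + 2 by omega)]
    rcases Nat.eq_or_lt_of_le hi with rfl | h1
    · rw [if_pos rfl, h.st_end]; omega
    · rw [if_neg (by omega)]; exact h.mono i (by omega)
  le := by omega
  mem i hi := by
    rcases Nat.eq_or_lt_of_le hi with rfl | h1
    · exact ⟨k, by simp [h.st_end], by simp, by simp [hP']⟩
    · obtain ⟨r, h2, h3, h4⟩ := h.mem i (by omega)
      refine ⟨r, ?_, ?_, ?_⟩
      · rwa [if_neg (by omega)]
      · rwa [if_neg (by omega)]
      · rw [hP', if_neg (by omega), h4]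
  min i hi r h2 h3 := by
    rw [if_neg (by omega)] at h2
    rcases Nat.eq_or_lt_of_le hi with rfl | h1
    · rw [if_pos rfl] at h3
      rw [h.st_end] at h2
      obtain rfl : r = k := by omega
      simp [hP']
    · rw [if_neg (by omega)] at h3
      rw [hP', if_neg (by omega)]
      exact h.min i (by omega) r h2 h3
  dep i h0 hi := by
    rw [hD', if_neg (show ¬ i = t + 2 by omega)]
    split_ifs with h1
    · rw [h1, h.st_end]
    · exact h.dep i h0 (by omega)
  dep_zero := by simpa [hD'] using h.dep_zero
  dep_mono i hi := by
    rw [hD', hD', if_neg (by omega)]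
    split_ifs with h1
    · rw [show i = t by omega]; exact hD
    · exact h.dep_mono i (by omega)
  inner i hi r h2 h3 := by
    rw [if_neg (by omega)] at h2
    rcases Nat.eq_or_lt_of_le hi with rfl | h1
    · rw [if_pos rfl] at h3
      rw [h.st_end] at h2
      omega
    · rw [if_neg (by omega)] at h3
      rw [hD', if_neg (by omega)]
      exact h.inner i (by omega) r h2 h3
  inner' i hi r h2 h3 := by
    rw [if_neg (by omega)] at h2 h3
    rw [hD']
    split_ifs with h1
    · obtain rfl : i = t := by omega
      rw [h.st_end] at h3
      exact h.inner_top hk r h2 h3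
    · exact h.inner' i (by omega) r h2 h3
  inner_top _ r h2 h3 := by
    rw [if_neg (by omega), h.st_end] at h2
    omega

/-- Merging the two topmost blocks. -/
theorem StackInv.merge (h : StackInv sa L n k (t + 1) st P D) {P' D' : ℕ → ℕ}
    (hD : k ≤ n → L k < D (t + 1)) (hP' : ∀ i < t, P' i = P i)
    (hPt : P' t = Nat.min (P t) (P (t + 1))) (hD' : ∀ i ≤ t, D' i = D i) :
    StackInv sa L n k t (fun i => if i = t + 1 then k else st i) P' D' where
  st_zero := by simpa using h.st_zero
  st_end := by simp
  mono i hi := by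
    rw [if_neg (show i ≠ t + 1 by omega)]
    split_ifs with h1
    · rw [← h.st_end]; exact h.st_lt (by omega) (by omega)
    · exact h.mono i (by omega)
  le := h.le
  mem i hi := by
    rw [if_neg (show i ≠ t + 1 by omega)]
    rcases Nat.eq_or_lt_of_le hi with rfl | h1
    · rw [if_pos rfl, hPt]
      have e := h.st_end
      have m1 := h.mono i (by omega)
      have m2 := h.mono (i + 1) le_rfl
      rcases Nat.le_total (P i) (P (i + 1)) with h3 | h3
      · obtain ⟨r, h4, h5, h6⟩ := h.mem i (by omega)
        exact ⟨r, h4, by omega, by rw [h6]; exact (Nat.min_eq_left h3).symm⟩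
      · obtain ⟨r, h4, h5, h6⟩ := h.mem (i + 1) (by omega)
        exact ⟨r, by omega, by omega, by rw [h6]; exact (Nat.min_eq_right h3).symm⟩
    · rw [if_neg (by omega), hP' i h1]
      exact h.mem i (by omega)
  min i hi r h2 h3 := by
    rw [if_neg (by omega)] at h2
    rcases Nat.eq_or_lt_of_le hi with rfl | h1
    · rw [if_pos rfl] at h3
      rw [hPt]
      rcases Nat.lt_or_ge r (st (i + 1)) with h4 | h4
      · exact (Nat.min_le_left _ _).trans (h.min i (by omega) r h2 h4)
      · exact (Nat.min_le_right _ _).trans (h.min (i + 1) le_rfl r h4 (by rw [h.st_end]; exact h3))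
    · rw [if_neg (by omega)] at h3
      rw [hP' i h1]
      exact h.min i (by omega) r h2 h3
  dep i h0 hi := by
    rw [if_neg (show ¬ i = t + 1 by omega), hD' i hi]
    exact h.dep i h0 (by omega)
  dep_zero := by rw [hD' 0 (by omega)]; exact h.dep_zero
  dep_mono i hi := by
    rw [hD' _ (by omega), hD' _ (by omega)]
    exact h.dep_mono i (by omega)
  inner i hi r h2 h3 := by
    rw [if_neg (by omega)] at h2
    rw [hD' i hi]
    rcases Nat.eq_or_lt_of_le hi with rfl | h1
    · rw [if_pos rfl] at h3
      have hm := h.dep_mono i (by omega)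
      rcases lt_trichotomy r (st (i + 1)) with h4 | rfl | h4
      · exact h.inner i (by omega) r h2 h4
      · rw [← h.dep (i + 1) (by omega) le_rfl]; exact hm
      · exact hm.trans (h.inner (i + 1) le_rfl r h4 (by rw [h.st_end]; exact h3))
    · rw [if_neg (by omega)] at h3
      exact h.inner i (by omega) r h2 h3
  inner' i hi r h2 h3 := by
    rw [if_neg (by omega)] at h2 h3
    rw [hD' _ (by omega)]
    exact h.inner' i (by omega) r h2 h3
  inner_top hk r h2 h3 := by
    rw [if_neg (by omega)] at h2
    refine (hD hk).le.trans ?_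
    rcases lt_trichotomy r (st (t + 1)) with h4 | rfl | h4
    · exact h.inner' t (by omega) r h2 h4
    · exact (h.dep (t + 1) (by omega) le_rfl).le
    · exact h.inner (t + 1) le_rfl r h4 (by rw [h.st_end]; exact h3)

/-- The least position `b` of a block whose borders have common prefixes of length at most `d`: the
suffixes that start before `b` lie outside the block. -/
theorem maxPrev_of_block (hsa : IsSA T n sa) (hL : IsLCP T sa n L) {x y b d r : ℕ}
    (hr : r ≤ n) (hxr : x ≤ r) (hry : r < y) (hrb : sa r = b)
    (hmin : ∀ r', x ≤ r' → r' < y → b ≤ sa r')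
    (hx : 0 < x → L x ≤ d) (hy : y ≤ n → L y ≤ d) : MaxPrev T b d := by
  intro j hj m hag
  obtain ⟨q, hq, rfl⟩ := hsa.surj (show j ≤ n from hj.le.trans (hrb ▸ hsa.le r hr))
  rw [← hrb] at hag
  rcases Nat.lt_or_ge q x with h1 | h1
  · exact ((hL.agree_iff hsa (by omega) hr).1 hag x h1 hxr).trans (hx (by omega))
  · rcases Nat.lt_or_ge q y with h2 | h2
    · have := hmin q h1 h2; omega
    · exact ((hL.agree_iff hsa (by omega) hq).1 hag.symm y hry h2).trans (hy (by omega))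

/-- When the two topmost blocks are merged, the border between them has the longest common prefix
among the borders of both, so the longest previous factor of the larger of their least positions
is found. -/
theorem StackInv.isParent (hsa : IsSA T n sa) (hL : IsLCP T sa n L)
    (h : StackInv sa L n k (t + 1) st P D) (hD : k ≤ n → L k < D (t + 1)) :
    IsParent T (Nat.max (P t) (P (t + 1))) (D (t + 1)) (Nat.min (P t) (P (t + 1))) := by
  obtain ⟨r₁, a1, a2, a3⟩ := h.mem t (by omega)
  obtain ⟨r₂, b1, b2, b3⟩ := h.mem (t + 1) le_rfl
  have e := h.st_end
  rw [e] at b2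
  have hkn := h.le
  have hd := h.dep (t + 1) (by omega) le_rfl
  have hne : P t ≠ P (t + 1) := fun heq => by
    have := hsa.inj (i := r₁) (j := r₂) (by omega) (by omega) (by rw [a3, b3, heq]); omega
  have hag : Agree T (P t) (P (t + 1)) (D (t + 1)) := by
    rw [← a3, ← b3, hL.agree_iff hsa (by omega) (by omega)]
    intro r h1 h2
    rcases lt_trichotomy r (st (t + 1)) with h4 | rfl | h4
    · exact h.inner' t (by omega) r (by omega) h4
    · exact hd.le
    · exact h.inner (t + 1) le_rfl r h4 (by omega)
  have hleft : 0 < st t → L (st t) ≤ D (t + 1) := fun h0 => by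
    have ht : 0 < t := by
      rcases Nat.eq_zero_or_pos t with h1 | h1
      · rw [h1, h.st_zero] at h0; omega
      · exact h1
    rw [← h.dep t ht (by omega)]
    exact h.dep_mono t (by omega)
  have hright : k ≤ n → L k ≤ D (t + 1) := fun h0 => (hD h0).le
  have m1 : MaxPrev T (P t) (D (t + 1)) :=
    maxPrev_of_block hsa hL (by omega) a1 a2 a3 (h.min t (by omega)) hleft fun _ => hd.ge
  have m2 : MaxPrev T (P (t + 1)) (D (t + 1)) :=
    maxPrev_of_block hsa hL (by omega) b1 b2 b3
      (fun r h1 h2 => h.min (t + 1) le_rfl r h1 (by omega)) (fun _ => hd.ge) hright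
  rcases Nat.lt_or_gt_of_ne hne with h1 | h1
  · rw [show Nat.max (P t) (P (t + 1)) = P (t + 1) from Nat.max_eq_right h1.le,
      show Nat.min (P t) (P (t + 1)) = P t from Nat.min_eq_left h1.le]
    exact ⟨h1, hag, m2, m1⟩
  · rw [show Nat.max (P t) (P (t + 1)) = P t from Nat.max_eq_left h1.le,
      show Nat.min (P t) (P (t + 1)) = P (t + 1) from Nat.min_eq_right h1.le]
    exact ⟨h1, hag.symm, m1, m2⟩

end stack

/-- A scan of the suffix array in array `10` with its common prefixes in array `12`. Arrays `18`
and `19` hold the stack of least positions and border depths, register `23` its top and register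
`24` the next entry. Register `25` tells whether the next entry is put on the stack; after the last
entry, all blocks are merged. Arrays `16` and `17` get, for each position, the length of its longest
previous factor and an occurrence of it. -/
def scanStack : Cmd :=
  .write 18 0 (10 ⊙ 0) ;;
  .write 19 0 0 ;;
  23 ≔ 0 ;;
  24 ≔ 1 ;;
  .loop ((♯24 <ₑ ♯0 + 1) + (0 <ₑ ♯23))
    (.ite (♯24 <ₑ ♯0 + 1) (25 ≔ 1 - (12 ⊙ ♯24 <ₑ 19 ⊙ ♯23)) (25 ≔ 0) ;;
    .ite ♯25
      (23 ≔ ♯23 + 1 ;;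
      .write 18 ♯23 (10 ⊙ ♯24) ;;
      .write 19 ♯23 (12 ⊙ ♯24) ;;
      24 ≔ ♯24 + 1)
      (26 ≔ 18 ⊙ ♯23 ;;
      28 ≔ 19 ⊙ ♯23 ;;
      23 ≔ ♯23 - 1 ;;
      27 ≔ 18 ⊙ ♯23 ;;
      .ite (♯26 <ₑ ♯27)
        (.write 16 ♯27 ♯28 ;; .write 17 ♯27 ♯26 ;; .write 18 ♯23 ♯26)
        (.write 16 ♯26 ♯28 ;; .write 17 ♯26 ♯27)))

theorem scanStack_runs {w S : ℕ} (hw : 1 < wordCap w) (hS : S ≤ wordCap w) {s : State}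
    {n : ℕ} {T : ℕ → ℕ} (h0 : s.var 0 = n) (hb : 2 * n + 20 < S)
    (hsa : IsSA T n (s.arr 10)) (hL : IsLCP T (s.arr 10) n (s.arr 12))
    (hz : s.arr 16 0 = 0) (hz' : s.arr 17 0 = 0) :
    Runs w S scanStack s (200 * (n + 3)) fun s' => s'.arr 16 0 = 0 ∧ s'.arr 17 0 = 0 ∧
      ∀ b, 0 < b → b < n → IsParent T b (s'.arr 16 b) (s'.arr 17 b) := by
  refine Runs.seq (P := fun s1 => s1.arr 18 0 = s.arr 10 0) (t₁ := 4)
    (Cmd.wp.runs hw (by simp [Cmd.wp]; omega) (by simp [Cmd.cost])) (by omega)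
    fun s1 f1 g1 => ?_
  refine Runs.seq (P := fun s1 => s1.arr 19 0 = 0) (t₁ := 4)
    (Cmd.wp.runs hw (by simp [Cmd.wp]; omega) (by simp [Cmd.cost])) (by omega)
    fun s2 f2 g2 => ?_
  refine Runs.seq (P := fun s1 => s1.var 23 = 0) (t₁ := 4)
    (Cmd.wp.runs hw (by simp [Cmd.wp]; omega) (by simp [Cmd.cost])) (by omega)
    fun s3 f3 g3 => ?_
  refine Runs.seq (P := fun s1 => s1.var 24 = 1) (t₁ := 4)
    (Cmd.wp.runs hw (by simp [Cmd.wp]; omega) (by simp [Cmd.cost])) (by omega)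
    fun s4 f4 g4 => ?_
  have z23 : s4.var 23 = 0 := by rw [f4.var 23 rfl, g3]
  have z0 : s4.var 0 = n := by rw [f4.var 0 rfl, f3.var 0 rfl, f2.var 0 rfl, f1.var 0 rfl, h0]
  have c18 : s4.arr 18 0 = s.arr 10 0 := by rw [f4.arr 18 rfl, f3.arr 18 rfl, f2.arr 18 rfl, g1]
  have c19 : s4.arr 19 0 = 0 := by rw [f4.arr 19 rfl, f3.arr 19 rfl, g2]
  have c10 : s4.arr 10 = s.arr 10 := by
    rw [f4.arr 10 rfl, f3.arr 10 rfl, f2.arr 10 rfl, f1.arr 10 rfl]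
  have c12 : s4.arr 12 = s.arr 12 := by
    rw [f4.arr 12 rfl, f3.arr 12 rfl, f2.arr 12 rfl, f1.arr 12 rfl]
  have c16 : s4.arr 16 = s.arr 16 := by
    rw [f4.arr 16 rfl, f3.arr 16 rfl, f2.arr 16 rfl, f1.arr 16 rfl]
  have c17 : s4.arr 17 = s.arr 17 := by
    rw [f4.arr 17 rfl, f3.arr 17 rfl, f2.arr 17 rfl, f1.arr 17 rfl]
  refine (Runs.while hw (fun s' => s'.var 23 < s'.var 24 ∧ s'.arr 16 0 = 0 ∧ s'.arr 17 0 = 0 ∧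
      (∃ st, StackInv (s.arr 10) (s.arr 12) n (s'.var 24) (s'.var 23) st (s'.arr 18) (s'.arr 19)) ∧
      ∀ r < s'.var 24, (∀ i ≤ s'.var 23, s'.arr 18 i ≠ s.arr 10 r) →
        IsParent T (s.arr 10 r) (s'.arr 16 (s.arr 10 r)) (s'.arr 17 (s.arr 10 r)))
    (fun s' => 2 * (n + 1 - s'.var 24) + s'.var 23) ?_ ?_ (t := 90 * (2 * n + 3)) ?_).imp
    (by omega) ?_
  · rw [z23, g4]
    refine ⟨by omega, by rw [c16, hz], by rw [c17, hz'], ⟨fun i => i, ⟨rfl, rfl,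
      fun i _ => by omega, by omega, fun i hi => ⟨0, by omega, by omega, ?_⟩, fun i hi r h1 h2 => ?_,
      fun i h1 h2 => by omega, c19, fun i hi => by omega, fun i hi r h1 h2 => by omega,
      fun i hi => by omega, fun _ r h1 h2 => by omega⟩⟩, fun r hr h => ?_⟩
    · rw [show i = 0 by omega, c18]
    · rw [show i = 0 by omega, show r = 0 by omega, c18]
    · exact absurd (by rw [show r = 0 by omega, c18]) (h 0 le_rfl)
  · rintro s' hf ⟨htk, i16, i17, ⟨st, hst⟩, hdone⟩
    have v0 : s'.var 0 = n := by rw [hf.var 0 rfl, z0]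
    have a10 : s'.arr 10 = s.arr 10 := by rw [hf.arr 10 rfl, c10]
    have a12 : s'.arr 12 = s.arr 12 := by rw [hf.arr 12 rfl, c12]
    generalize hk : s'.var 24 = k at *
    generalize ht : s'.var 23 = t at *
    have hkn := hst.le
    refine ⟨?_, fun hc => ?_⟩
    · simp only [Expr.OK_add, Expr.OK_lt, Expr.OK_var, Expr.OK_ofNat, Expr.val_lt, Expr.val_var,
        Expr.val_add, Expr.val_ofNat, v0, hk, ht, true_and]
      split_ifs <;> simp <;> omega
    have hc' : k ≤ n ∨ 0 < t := by
      by_contra h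
      push Not at h
      have h1 : ¬ k < n + 1 := by omega
      have h2 : ¬ 0 < t := by omega
      simp [v0, hk, ht, h1, h2] at hc
    refine Cmd.wp.seq (P := fun s'' => (s''.var 25 ≠ 0 ∧ k ≤ n ∧ s'.arr 19 t ≤ s.arr 12 k) ∨
      (s''.var 25 = 0 ∧ 0 < t ∧ (k ≤ n → s.arr 12 k < s'.arr 19 t))) ?_ fun s5 f5 h5 => ?_
    · by_cases hkn' : k < n + 1
      · by_cases hlt : s.arr 12 k < s'.arr 19 t
        · have : 0 < t := by
            by_contra h
            rw [show t = 0 by omega, hst.dep_zero] at hlt; omega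
          simp [Cmd.wp, v0, hk, ht, a12, hkn', hlt, this]; omega
        · simp [Cmd.wp, v0, hk, ht, a12, hkn', hlt]; omega
      · simp [Cmd.wp, v0, hk, ht, hkn']; omega
    have d23 : s5.var 23 = t := by rw [f5.var 23 rfl, ht]
    have d24 : s5.var 24 = k := by rw [f5.var 24 rfl, hk]
    have d10 : s5.arr 10 = s.arr 10 := by rw [f5.arr 10 rfl, a10]
    have d12 : s5.arr 12 = s.arr 12 := by rw [f5.arr 12 rfl, a12]
    have d16 : s5.arr 16 = s'.arr 16 := f5.arr 16 rfl
    have d17 : s5.arr 17 = s'.arr 17 := f5.arr 17 rfl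
    have d18 : s5.arr 18 = s'.arr 18 := f5.arr 18 rfl
    have d19 : s5.arr 19 = s'.arr 19 := f5.arr 19 rfl
    rcases h5 with ⟨h25, hkn', hle⟩ | ⟨h25, ht0, hlt⟩
    · simp only [Cmd.wp, Expr.OK_add, Expr.OK_read, Expr.OK_var, Expr.OK_ofNat, Expr.val_add,
        Expr.val_read, Expr.val_var, Expr.val_ofNat, State.var_setVar, State.var_setArr,
        State.arr_setVar, State.arr_setArr_apply, d23, d24, d10, d12, d16, d17,
        Nat.reduceEqDiff, if_true, if_false, true_and, false_and]
      refine ⟨fun _ => ⟨by omega, by omega, by omega, by omega, by omega, by omega,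
        ⟨by omega, i16, i17, ⟨_, hst.push hkn' hle ?_ ?_⟩, fun r hr h => ?_⟩, by omega⟩,
        fun h => absurd h h25⟩
      · intro i; simp [d18]
      · intro i; simp [d19]
      · rcases Nat.eq_or_lt_of_le (show r ≤ k by omega) with rfl | h1
        · exact absurd (by simp) (h (t + 1) le_rfl)
        · refine hdone r h1 fun i hi => ?_
          have := h i (by omega)
          rwa [if_neg (by omega), d18] at this
    · obtain ⟨u, rfl⟩ : ∃ u, t = u + 1 := ⟨t - 1, by omega⟩
      have hpar := hst.isParent hsa hL hlt
      have hPle : ∀ i ≤ u + 1, s'.arr 18 i ≤ n := fun i hi => by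
        obtain ⟨r, h1, h2, h3⟩ := hst.mem i hi
        have := hst.st_end
        have h4 : st (i + 1) ≤ k := by
          rcases Nat.eq_or_lt_of_le (show i + 1 ≤ u + 1 + 1 by omega) with h | h
          · rw [h, this]
          · rw [← this]; exact (hst.st_lt h le_rfl).le
        rw [← h3]; exact hsa.le r (by omega)
      have p1 := hPle u (by omega)
      have p2 := hPle (u + 1) le_rfl
      -- the larger of the two least positions leaves the stack
      have hleave : ∀ (P' : ℕ → ℕ) (r : ℕ), r < k → (∀ i < u, P' i = s'.arr 18 i) →
          P' u = Nat.min (s'.arr 18 u) (s'.arr 18 (u + 1)) → (∀ i ≤ u, P' i ≠ s.arr 10 r) →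
          s.arr 10 r ≠ Nat.max (s'.arr 18 u) (s'.arr 18 (u + 1)) →
          IsParent T (s.arr 10 r) (s'.arr 16 (s.arr 10 r)) (s'.arr 17 (s.arr 10 r)) := by
        intro P' r hr e1 e2 h hne
        refine hdone r hr fun i hi heq => ?_
        rcases Nat.lt_or_ge i u with h1 | h1
        · exact h i h1.le (by rw [e1 i h1, heq])
        · have h2 := h u le_rfl
          rw [e2] at h2
          simp only [Nat.min_def, Nat.max_def] at h2 hne
          have : i = u ∨ i = u + 1 := by omega
          rcases this with rfl | rfl
          · split_ifs at h2 hne <;> omega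
          · split_ifs at h2 hne <;> omega
      refine ⟨trivial, fun h => absurd h25 h, fun _ => ?_⟩
      refine Cmd.wp.seq (P := fun s'' => s''.var 26 = s'.arr 18 (u + 1)) ?_ fun s6 f6 g6 => ?_
      · simp [Cmd.wp, d23, d18]; omega
      refine Cmd.wp.seq (P := fun s'' => s''.var 28 = s'.arr 19 (u + 1)) ?_ fun s7 f7 g7 => ?_
      · simp [Cmd.wp, f6.var 23 rfl, d23, f6.arr 19 rfl, d19]; omega
      refine Cmd.wp.seq (P := fun s'' => s''.var 23 = u) ?_ fun s8 f8 g8 => ?_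
      · simp [Cmd.wp, f7.var 23 rfl, f6.var 23 rfl, d23]; omega
      refine Cmd.wp.seq (P := fun s'' => s''.var 27 = s'.arr 18 u) ?_ fun s9 f9 g9 => ?_
      · simp [Cmd.wp, g8, f8.arr 18 rfl, f7.arr 18 rfl, f6.arr 18 rfl, d18]; omega
      have e23 : s9.var 23 = u := by rw [f9.var 23 rfl, g8]
      have e24 : s9.var 24 = k := by
        rw [f9.var 24 rfl, f8.var 24 rfl, f7.var 24 rfl, f6.var 24 rfl, d24]
      have e26 : s9.var 26 = s'.arr 18 (u + 1) := by
        rw [f9.var 26 rfl, f8.var 26 rfl, f7.var 26 rfl, g6]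
      have e28 : s9.var 28 = s'.arr 19 (u + 1) := by rw [f9.var 28 rfl, f8.var 28 rfl, g7]
      have e16 : s9.arr 16 = s'.arr 16 := by
        rw [f9.arr 16 rfl, f8.arr 16 rfl, f7.arr 16 rfl, f6.arr 16 rfl, d16]
      have e17 : s9.arr 17 = s'.arr 17 := by
        rw [f9.arr 17 rfl, f8.arr 17 rfl, f7.arr 17 rfl, f6.arr 17 rfl, d17]
      have e18 : s9.arr 18 = s'.arr 18 := by
        rw [f9.arr 18 rfl, f8.arr 18 rfl, f7.arr 18 rfl, f6.arr 18 rfl, d18]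
      have e19 : s9.arr 19 = s'.arr 19 := by
        rw [f9.arr 19 rfl, f8.arr 19 rfl, f7.arr 19 rfl, f6.arr 19 rfl, d19]
      simp only [Cmd.wp, Expr.OK_lt, Expr.OK_var, Expr.val_lt, Expr.val_var, State.var_setArr,
        State.arr_setArr_apply, e23, e24, e26, e28, e16, e17, g9,
        Nat.reduceEqDiff, if_false, true_and, false_and]
      refine ⟨fun h => ?_, fun h => ?_⟩
      · have hlt' : s'.arr 18 (u + 1) < s'.arr 18 u := by
          by_contra hc; simp [hc] at h
        have hmin : Nat.min (s'.arr 18 u) (s'.arr 18 (u + 1)) = s'.arr 18 (u + 1) :=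
          Nat.min_eq_right hlt'.le
        have hmax : Nat.max (s'.arr 18 u) (s'.arr 18 (u + 1)) = s'.arr 18 u :=
          Nat.max_eq_left hlt'.le
        rw [hmin, hmax] at hpar
        refine ⟨by omega, by omega, by omega, ⟨by omega, ?_, ?_, ⟨_, hst.merge (D' := s9.arr 19) hlt
          (fun i hi => ?_) ?_ (fun i _ => by rw [e19])⟩, fun r hr h => ?_⟩, by omega⟩
        · rw [if_neg (by omega)]; exact i16
        · rw [if_neg (by omega)]; exact i17
        · simp [e18]; omega
        · simp [hmin]
        · by_cases hr' : s.arr 10 r = s'.arr 18 u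
          · simpa [hr'] using hpar
          · rw [if_neg hr', if_neg hr']
            refine hleave (fun i => if i = u then s'.arr 18 (u + 1) else s'.arr 18 i) r hr ?_ ?_ ?_
              (by rwa [hmax])
            · intro i hi; simp; omega
            · simp [hmin]
            · intro i hi; have := h i hi; rwa [e18] at this
      · have hlt' : s'.arr 18 u ≤ s'.arr 18 (u + 1) := by
          by_contra hc; simp [show s'.arr 18 (u + 1) < s'.arr 18 u by omega] at h
        have hmin : Nat.min (s'.arr 18 u) (s'.arr 18 (u + 1)) = s'.arr 18 u :=
          Nat.min_eq_left hlt'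
        have hmax : Nat.max (s'.arr 18 u) (s'.arr 18 (u + 1)) = s'.arr 18 (u + 1) :=
          Nat.max_eq_right hlt'
        rw [hmin, hmax] at hpar
        have := hpar.lt
        have hA : ((s9.setArr 16 (s'.arr 18 (u + 1)) (s'.arr 19 (u + 1))).setArr 17
            (s'.arr 18 (u + 1)) (s'.arr 18 u)).arr 19 = s'.arr 19 := by
          simp [State.arr_setArr, e19]
        have hB : ((s9.setArr 16 (s'.arr 18 (u + 1)) (s'.arr 19 (u + 1))).setArr 17
            (s'.arr 18 (u + 1)) (s'.arr 18 u)).arr 18 = s'.arr 18 := by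
          simp [State.arr_setArr, e18]
        refine ⟨by omega, by omega, ⟨by omega, ?_, ?_, ⟨_, hst.merge hlt
          (fun i hi => ?_) ?_ (fun i _ => ?_)⟩, fun r hr h => ?_⟩, by omega⟩
        · rw [if_neg (by omega)]; exact i16
        · rw [if_neg (by omega)]; exact i17
        · rw [hB]
        · rw [hB, hmin]
        · rw [hA]
        · by_cases hr' : s.arr 10 r = s'.arr 18 (u + 1)
          · simpa [hr'] using hpar
          · rw [if_neg hr', if_neg hr']
            refine hleave (s'.arr 18) r hr (fun _ _ => rfl) hmin.symm ?_ (by rwa [hmax])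
            intro i hi; have := h i hi; rwa [e18] at this
  · simp [Cmd.cost, z23, g4]; omega
  · rintro s' hf ⟨⟨_, i16, i17, ⟨st, hst⟩, hdone⟩, hc⟩
    have v0 : s'.var 0 = n := by rw [← z0]; exact hf.var 0 rfl
    refine ⟨i16, i17, fun b hb0 hbn => ?_⟩
    have hkt : s'.var 24 = n + 1 ∧ s'.var 23 = 0 := by
      have := hst.le
      by_cases h1 : s'.var 24 < n + 1
      · simp [v0, h1] at hc
      · by_cases h2 : 0 < s'.var 23
        · simp [v0, h2] at hc
        · omega
    rw [hkt.1, hkt.2] at hst hdone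
    obtain ⟨r, hr, hrb⟩ := hsa.surj hbn.le
    obtain ⟨q, hq, hq0⟩ := hsa.surj (show 0 ≤ n by omega)
    have := hdone r (by omega) fun i hi heq => by
      have h1 := hst.min 0 le_rfl q (by rw [hst.st_zero]; omega) (by rw [hst.st_end]; omega)
      rw [show i = 0 by omega, hrb] at heq
      omega
    rwa [hrb] at this

/-- `m` is the leftmost occurrence before `b` of the factor of length `d` at `b`. -/
structure IsLeftmost (T : ℕ → ℕ) (b d m : ℕ) : Prop where
  lt : m < b
  agree : Agree T m b d
  min : ∀ j < m, ¬ Agree T j b d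

/-- Array `21` gets the leftmost occurrences of the longest previous factors. The occurrence in
array `17` is replaced by its own leftmost occurrence if their longest previous factors are equally
long. -/
def leftmost : Cmd :=
  .forTo 2 0 (29 ≔ 17 ⊙ ♯2 ;;
    .ite (16 ⊙ ♯2 =ₑ 16 ⊙ ♯29) (.write 21 ♯2 (21 ⊙ ♯29)) (.write 21 ♯2 ♯29))

theorem leftmost_runs {w S : ℕ} (hw : 1 < wordCap w) (hS : S ≤ wordCap w) {s : State}
    {n : ℕ} {T : ℕ → ℕ} (h0 : s.var 0 = n) (hb : n + 20 < S)
    (hz : s.arr 16 0 = 0) (hz' : s.arr 17 0 = 0) (hz'' : s.arr 21 0 = 0)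
    (hpar : ∀ b, 0 < b → b < n → IsParent T b (s.arr 16 b) (s.arr 17 b)) :
    Runs w S leftmost s (50 * (n + 3)) fun s' =>
      ∀ b, 0 < b → b < n → IsLeftmost T b (s.arr 16 b) (s'.arr 21 b) := by
  refine (Runs.forTo hw h0 (fun j s' => s'.arr 21 0 = 0 ∧
    ∀ b, 0 < b → b < j → IsLeftmost T b (s.arr 16 b) (s'.arr 21 b)) (by decide) rfl rfl (by omega)
    ⟨hz'', fun b _ _ => by omega⟩ ?_ ?_).imp le_rfl fun s' _ h => h.2
  · rintro j s' hj hf hi ⟨hJ0, hJ⟩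
    have a16 : s'.arr 16 = s.arr 16 := hf.arr 16 rfl
    have a17 : s'.arr 17 = s.arr 17 := hf.arr 17 rfl
    have hpj : s.arr 17 j ≤ j := by
      rcases Nat.eq_zero_or_pos j with rfl | h
      · rw [hz']
      · exact (hpar j h hj).lt.le
    by_cases heq : s.arr 16 j = s.arr 16 (s.arr 17 j)
    · simp only [Cmd.wp, Expr.OK_read, Expr.OK_eq, Expr.OK_var, Expr.val_eq,
        Expr.val_read, Expr.val_var, State.var_setVar,
        State.arr_setVar, State.arr_setArr_apply, hi, a16, a17, heq,
        Nat.reduceEqDiff, if_true, if_false, true_and]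
      refine ⟨by omega, by omega, fun _ => ⟨by omega, by omega, ?_, fun b hb0 hbj => ?_⟩,
        fun h => by simp at h⟩
      · split_ifs with h
        · rw [← h, hz', hJ0]
        · exact hJ0
      · split_ifs with h
        · subst h
          have hp := hpar b hb0 hj
          rcases Nat.eq_zero_or_pos (s.arr 17 b) with h1 | h1
          · rw [h1] at heq ⊢
            rw [hz] at heq
            rw [hJ0, heq]
            exact ⟨hb0, fun k hk => by omega, fun j hj => by omega⟩
          · have hl := hJ _ h1 hp.lt
            rw [← heq] at hl
            exact ⟨hl.lt.trans hp.lt, hl.agree.trans hp.agree,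
              fun i hi h => hl.min i hi (h.trans hp.agree.symm)⟩
        · exact hJ b hb0 (by omega)
    · simp only [Cmd.wp, Expr.OK_read, Expr.OK_eq, Expr.OK_var, Expr.val_eq,
        Expr.val_read, Expr.val_var, State.var_setVar,
        State.arr_setVar, State.arr_setArr_apply, hi, a16, a17, heq,
        Nat.reduceEqDiff, if_true, if_false, true_and]
      refine ⟨by omega, by omega, fun h => by simp at h,
        fun _ => ⟨by omega, ?_, fun b hb0 hbj => ?_⟩⟩
      · split_ifs with h
        · rw [← h, hz']
        · exact hJ0
      · split_ifs with h
        · subst h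
          have hp := hpar b hb0 hj
          refine ⟨hp.lt, hp.agree, fun i hi h => ?_⟩
          -- an occurrence before the parent would make its longest previous factor as long
          have hp' := hpar (s.arr 17 b) (by omega) (by omega)
          have h1 := hp.max' _ hp'.lt _ hp'.agree
          have h2 := hp'.max i hi _ (h.trans hp.agree.symm)
          omega
        · exact hJ b hb0 (by omega)
  · simp [Cmd.cost]; omega

/-! ### The encoding in terms of longest previous factors -/

theorem SameFactor.mono {α : Type*} {T : List α} {j i l m : ℕ} (h : SameFactor T j i l)
    (hm : m ≤ l) : SameFactor T j i m :=
  ⟨by have := h.1; omega, by have := h.2.1; omega, fun k hk => h.2.2 k (hk.trans_le hm)⟩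

theorem length_newHeights {α : Type*} (H : List ℕ) (p : Phrase α) :
    (p.newHeights H).length = p.len := by
  cases p <;> simp [Phrase.newHeights, Phrase.len]

/-- A string of numbers that represents the equalities between the symbols of `X`. -/
structure Represents {α : Type*} (T : ℕ → ℕ) (X : List α) : Prop where
  str : IsStr T X.length
  eq_iff : ∀ i < X.length, ∀ j < X.length, T i = T j ↔ X[i]? = X[j]?

theorem Represents.sameFactor_iff {α : Type*} {T : ℕ → ℕ} {X : List α} (hX : Represents T X)
    {j i l : ℕ} (hj : j < i) (hi : i ≤ X.length) : SameFactor X j i l ↔ Agree T j i l := by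
  constructor
  · rintro ⟨h1, h2, h3⟩ k hk
    exact (hX.eq_iff _ (by omega) _ (by omega)).2 (h3 k hk)
  · intro h
    obtain ⟨h1, h2⟩ := hX.str.agree_le (by omega) hi hj.ne h
    exact ⟨h1, h2, fun k hk => (hX.eq_iff _ (by omega) _ (by omega)).1 (h k hk)⟩

section encoding
variable {α : Type*} [DecidableEq α]

theorem sameFactor_of_lmocc {T : List α} {b l s : ℕ} (h : lmocc T b l = some s) :
    s < b ∧ SameFactor T s b l := by
  unfold lmocc at h
  exact ⟨by simpa using List.mem_of_find?_eq_some h, by simpa using List.find?_some h⟩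

/-- The phrases that are chosen are correct and keep the heights bounded. -/
theorem nextPhrase_spec (h : ℕ) (T : List α) (H : List ℕ) (hb : H.length < T.length) :
    (nextPhrase h T H hb).ValidAt T H.length ∧
      H.length + (nextPhrase h T H hb).len ≤ T.length ∧
      ∀ x ∈ (nextPhrase h T H hb).newHeights H, x ≤ h := by
  have hlit : (Phrase.lit T[H.length]).ValidAt T H.length ∧
      H.length + (Phrase.lit T[H.length]).len ≤ T.length ∧
      ∀ x ∈ (Phrase.lit T[H.length]).newHeights H, x ≤ h := by
    refine ⟨by simp [Phrase.ValidAt, hb], by simp [Phrase.len]; omega,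
      by simp [Phrase.newHeights]⟩
  unfold nextPhrase
  split
  · exact hlit
  · rename_i s hs
    dsimp only
    split
    · rename_i hl
      obtain ⟨h1, h2⟩ := sameFactor_of_lmocc hs
      have h3 := h2.mono (Nat.findGreatest_le (P := fun l =>
        ∀ x ∈ (Phrase.copy l s : Phrase α).newHeights H, x ≤ h) (lpf T H.length))
      refine ⟨⟨hl, h1, h3⟩, h3.2.1, ?_⟩
      exact Nat.findGreatest_spec (P := fun l =>
        ∀ x ∈ (Phrase.copy l s : Phrase α).newHeights H, x ≤ h) (Nat.zero_le _)
        (by simp [Phrase.newHeights])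
    · exact hlit

theorem lzhb1From_spec (h : ℕ) (T : List α) (H : List ℕ) (hH : H.length ≤ T.length)
    (hle : ∀ x ∈ H, x ≤ h) :
    H.length + ((lzhb1From h T H).map Phrase.len).sum = T.length ∧
    (∀ (j : ℕ) (p : Phrase α), (lzhb1From h T H)[j]? = some p →
      p.ValidAt T (H.length + (((lzhb1From h T H).take j).map Phrase.len).sum)) ∧
    ∀ x ∈ (lzhb1From h T H).foldl (fun H p => H ++ p.newHeights H) H, x ≤ h := by
  induction H using lzhb1From.induct h T with
  | case1 H hb ih =>
    obtain ⟨h1, h2, h3⟩ := nextPhrase_spec h T H hb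
    have hlen := length_newHeights H (nextPhrase h T H hb)
    obtain ⟨i1, i2, i3⟩ := ih (by rw [List.length_append, hlen]; exact h2) (fun x hx => by
      rcases List.mem_append.1 hx with hx | hx
      · exact hle x hx
      · exact h3 x hx)
    rw [List.length_append, hlen] at i1 i2
    rw [lzhb1From, dif_pos hb]
    refine ⟨by rw [List.map_cons, List.sum_cons, ← Nat.add_assoc]; exact i1,
      fun j p hj => ?_, i3⟩
    cases j with
    | zero =>
      simp only [List.getElem?_cons_zero, Option.some.injEq] at hj
      subst hj
      simpa using h1
    | succ j =>
      rw [List.getElem?_cons_succ] at hj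
      rw [List.take_succ_cons, List.map_cons, List.sum_cons, ← Nat.add_assoc]
      exact i2 j p hj
  | case2 H hb =>
    rw [lzhb1From, dif_neg hb]
    exact ⟨by simp; omega, by simp, by simpa using hle⟩

theorem isHBounded_lzhb1 (h : ℕ) (T : List α) : IsHBounded h T (lzhb1 h T) := by
  obtain ⟨h1, h2, h3⟩ := lzhb1From_spec h T [] (by simp) (by simp)
  simp only [List.length_nil, Nat.zero_add] at h1 h2
  exact ⟨⟨h1, h2⟩, h3⟩

variable {T : ℕ → ℕ} {X : List α}

theorem lpf_zero (X : List α) : lpf X 0 = 0 := by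
  unfold lpf
  rw [Nat.findGreatest_eq_zero_iff]
  simp

theorem Represents.lpf_eq (hX : Represents T X) {b d s : ℕ} (hb : b < X.length)
    (h : IsParent T b d s) : lpf X b = d := by
  unfold lpf
  have hsf := (hX.sameFactor_iff h.lt hb.le).2 h.agree
  rw [Nat.findGreatest_eq_iff]
  refine ⟨by have := hsf.2.1; omega, fun _ => ⟨s, h.lt, hsf⟩, ?_⟩
  rintro m hdm - ⟨j, hj, hsf'⟩
  have := h.max j hj m ((hX.sameFactor_iff hj hb.le).1 hsf')
  omega

theorem Represents.lmocc_eq (hX : Represents T X) {b d m : ℕ} (hb : b < X.length)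
    (h : IsLeftmost T b d m) : lmocc X b d = some m := by
  unfold lmocc
  rw [List.find?_range_eq_some]
  refine ⟨by simpa using (hX.sameFactor_iff h.lt hb.le).2 h.agree, by simpa using h.lt,
    fun j hj => ?_⟩
  have := h.min j hj
  rw [← hX.sameFactor_iff (hj.trans h.lt) hb.le] at this
  simpa using this

/-- The copied length is found by a scan that stops at the first height that is too large. -/
theorem nextPhrase_eq {h : ℕ} {H : List ℕ} (hb : H.length < X.length) {d s k : ℕ}
    (hd : lpf X H.length = d) (hs : lmocc X H.length d = some s) (hk : k ≤ d)
    (hle : ∀ j < k, H.getD (s + j % (H.length - s)) 0 < h)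
    (hlt : k < d → h ≤ H.getD (s + k % (H.length - s)) 0) :
    nextPhrase h X H hb = if 2 ≤ k then .copy k s else .lit X[H.length] := by
  have hg : Nat.findGreatest
      (fun l => ∀ x ∈ (Phrase.copy l s : Phrase α).newHeights H, x ≤ h) d = k := by
    rw [Nat.findGreatest_eq_iff]
    refine ⟨hk, fun _ x hx => ?_, fun m hm hmd hall => ?_⟩
    · simp only [Phrase.newHeights, List.mem_map, List.mem_range] at hx
      obtain ⟨j, hj, rfl⟩ := hx
      exact hle j hj
    · have h1 := hall (H.getD (s + k % (H.length - s)) 0 + 1) (by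
        simp only [Phrase.newHeights, List.mem_map, List.mem_range]
        exact ⟨k, hm, rfl⟩)
      have := hlt (by omega)
      omega
  unfold nextPhrase
  rw [hd, hs]
  simp only [hg]

theorem nextPhrase_zero {h : ℕ} {H : List ℕ} (hb : H.length < X.length) (h0 : H.length = 0) :
    nextPhrase h X H hb = .lit X[H.length] := by
  unfold nextPhrase
  have : lmocc X H.length (lpf X H.length) = none := by simp [lmocc, h0]
  rw [this]

end encoding

/-! ### The greedy scan -/

section scan
variable {α : Type*} [DecidableEq α]

/-- The state of the scan: `b` is the start of the current phrase, `k` the number of symbols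
that it copies so far, `cnt` the number of finished phrases. `HT` holds the heights of the
positions before `b + k`, and `O₁`, `O₂` hold the finished phrases. -/
structure ScanInv (h : ℕ) (X : List α) (code : α → ℕ) (LPF LM : ℕ → ℕ) (b k cnt : ℕ)
    (HT O₁ O₂ : ℕ → ℕ) (H : List ℕ) (E : List (Phrase α)) : Prop where
  length : H.length = b
  le : b ≤ X.length
  height : ∀ i < b, HT i = H.getD i 0
  count : E.length = cnt
  count_le : cnt ≤ b
  eq : lzhb1 h X = E ++ lzhb1From h X H
  out : ∀ (j : ℕ) (hj : j < E.length), O₁ j = E[j].len ∧ O₂ j = E[j].second code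
  pos : 0 < k → 0 < b ∧ b < X.length ∧ k ≤ LPF b
  copied : ∀ j < k, HT (b + j) = H.getD (LM b + j % (b - LM b)) 0 + 1 ∧
    H.getD (LM b + j % (b - LM b)) 0 < h

/-- Array contents that describe the longest previous factors of `X`. -/
structure LPFTable (X : List α) (LPF LM : ℕ → ℕ) : Prop where
  lpf : ∀ b < X.length, lpf X b = LPF b
  lmocc : ∀ b, 0 < b → b < X.length → lmocc X b (LPF b) = some (LM b)

variable {h : ℕ} {X : List α} {code : α → ℕ} {LPF LM : ℕ → ℕ}

theorem LPFTable.lt (hT : LPFTable X LPF LM) {b : ℕ} (h0 : 0 < b) (hb : b < X.length) :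
    LM b < b := (sameFactor_of_lmocc (hT.lmocc b h0 hb)).1

theorem LPFTable.add_le (hT : LPFTable X LPF LM) {b : ℕ} (h0 : 0 < b) (hb : b < X.length) :
    b + LPF b ≤ X.length := (sameFactor_of_lmocc (hT.lmocc b h0 hb)).2.2.1

theorem LPFTable.zero (hT : LPFTable X LPF LM) (hb : 0 < X.length) : LPF 0 = 0 := by
  rw [← hT.lpf 0 hb, lpf_zero]

theorem LPFTable.source_lt (hT : LPFTable X LPF LM) {b k : ℕ} (h0 : 0 < b) (hb : b < X.length) :
    LM b + k % (b - LM b) < b := by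
  have := hT.lt h0 hb
  have := Nat.mod_lt k (show 0 < b - LM b by omega)
  omega

variable {b k cnt : ℕ} {HT HT' O₁ O₁' O₂ O₂' : ℕ → ℕ} {H : List ℕ} {E : List (Phrase α)}

theorem ScanInv.extend (hI : ScanInv h X code LPF LM b k cnt HT O₁ O₂ H E)
    (hT : LPFTable X LPF LM) (hb : b < X.length) (hk : k < LPF b)
    (hlt : HT (LM b + k % (b - LM b)) < h)
    (hHT : ∀ i, HT' i = if i = b + k then HT (LM b + k % (b - LM b)) + 1 else HT i) :
    ScanInv h X code LPF LM b (k + 1) cnt HT' O₁ O₂ H E := by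
  have h0 : 0 < b := by
    by_contra hc
    rw [show b = 0 by omega, hT.zero (by omega)] at hk
    omega
  have hsrc := hI.height _ (hT.source_lt (k := k) h0 hb)
  refine ⟨hI.length, hI.le, fun i hi => ?_, hI.count, hI.count_le, hI.eq, hI.out,
    fun _ => ⟨h0, hb, hk⟩, fun j hj => ?_⟩
  · rw [hHT, if_neg (by omega), hI.height i hi]
  · rcases Nat.eq_or_lt_of_le (show j ≤ k by omega) with rfl | h1
    · rw [hHT, if_pos rfl, hsrc]
      exact ⟨rfl, by rwa [← hsrc]⟩
    · rw [hHT, if_neg (by omega)]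
      exact hI.copied j h1

theorem ScanInv.nextPhrase_eq (hI : ScanInv h X code LPF LM b k cnt HT O₁ O₂ H E)
    (hT : LPFTable X LPF LM) (hb : b < X.length)
    (hsmall : k < LPF b → h ≤ HT (LM b + k % (b - LM b))) :
    nextPhrase h X H (hI.length ▸ hb) = if 2 ≤ k then .copy k (LM b) else .lit X[b] := by
  obtain rfl := hI.length
  rcases Nat.eq_zero_or_pos H.length with h0 | h0
  · have hk : k = 0 := by
      by_contra hc
      have := (hI.pos (by omega)).1
      omega
    rw [nextPhrase_zero hb h0, if_neg (by omega)]
  · refine HBLZ.nextPhrase_eq hb (hT.lpf _ hb) (hT.lmocc _ h0 hb) ?_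
      (fun j hj => (hI.copied j hj).2) fun hk => ?_
    · by_contra hc
      have := (hI.pos (by omega)).2.2
      omega
    · rw [← hI.height _ (hT.source_lt h0 hb)]
      exact hsmall hk

/-- A finished phrase is appended to the encoding. -/
theorem ScanInv.append (hI : ScanInv h X code LPF LM b k cnt HT O₁ O₂ H E)
    (hb : b < X.length) {p : Phrase α} (hp : nextPhrase h X H (hI.length ▸ hb) = p)
    (hHT : ∀ i < p.len, HT' (b + i) = (p.newHeights H).getD i 0)
    (hHT' : ∀ i < b, HT' i = HT i)
    (h₁ : ∀ i, O₁' i = if i = cnt then p.len else O₁ i)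
    (h₂ : ∀ i, O₂' i = if i = cnt then p.second code else O₂ i) :
    ScanInv h X code LPF LM (b + p.len) 0 (cnt + 1) HT' O₁' O₂' (H ++ p.newHeights H)
      (E ++ [p]) := by
  obtain rfl := hI.length
  obtain rfl := hI.count
  have hs := nextPhrase_spec h X H hb
  have hpos := nextPhrase_pos h X H hb
  rw [hp, length_newHeights] at hpos
  rw [hp] at hs
  refine ⟨by rw [List.length_append, length_newHeights], hs.2.1, fun i hi => ?_, by simp,
    by have := hI.count_le; omega, ?_, fun j hj => ?_, fun h => absurd h (lt_irrefl 0),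
    fun j hj => absurd hj (Nat.not_lt_zero j)⟩
  · rcases Nat.lt_or_ge i H.length with h1 | h1
    · rw [hHT' i h1, hI.height i h1, List.getD_append _ _ _ _ h1]
    · rw [List.getD_append_right _ _ _ _ h1, ← hHT _ (by omega)]
      congr 1; omega
  · rw [hI.eq, lzhb1From, dif_pos hb, hp, List.append_assoc, List.singleton_append]
  · rw [h₁, h₂]
    rw [List.length_append, List.length_singleton] at hj
    by_cases hj' : j < E.length
    · rw [if_neg (by omega), if_neg (by omega), List.getElem_append_left hj']
      exact hI.out j hj'
    · obtain rfl : j = E.length := by omega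
      simp

end scan

/-- The next phrase starts at the position in register `30` and copies the number of symbols in
register `31` so far; register `32` counts the phrases, register `33` is the source, and register
`34` tells whether one more symbol can be copied. Array `15` holds the heights. -/
def greedyScan (h : ℕ) : Cmd :=
  30 ≔ 0 ;; 31 ≔ 0 ;; 32 ≔ 0 ;;
  .loop (♯30 <ₑ ♯0)
    (33 ≔ 21 ⊙ ♯30 ;;
    34 ≔ 0 ;;
    .ite (♯31 <ₑ 16 ⊙ ♯30) (34 ≔ (15 ⊙ (♯33 + ♯31 % (♯30 - ♯33)) <ₑ .const h)) .skip ;;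
    .ite ♯34
      (.write 15 (♯30 + ♯31) (15 ⊙ (♯33 + ♯31 % (♯30 - ♯33)) + 1) ;;
      31 ≔ ♯31 + 1)
      (.ite (♯31 <ₑ 2)
        (.write 1 ♯32 1 ;; .write 2 ♯32 (0 ⊙ ♯30) ;; .write 15 ♯30 0 ;; 30 ≔ ♯30 + 1)
        (.write 1 ♯32 ♯31 ;; .write 2 ♯32 ♯33 ;; 30 ≔ ♯30 + ♯31) ;;
      31 ≔ 0 ;;
      32 ≔ ♯32 + 1)) ;;
  0 ≔ ♯32

theorem greedyScan_runs {α : Type*} [DecidableEq α] {w S : ℕ} (hw : 1 < wordCap w)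
    (hS : S ≤ wordCap w) {s : State} {h : ℕ} {X : List α} {code : α → ℕ}
    (h0 : s.var 0 = X.length) (hb : 2 * X.length + h + 20 < S)
    (hin : ∀ (i : ℕ) (hi : i < X.length), s.arr 0 i = code X[i])
    (hT : LPFTable X (s.arr 16) (s.arr 21)) :
    Runs w S (greedyScan h) s (200 * (X.length + 3)) (IsEncodingOutput code (lzhb1 h X)) := by
  refine Runs.seq (P := fun s1 => s1.var 30 = 0) (t₁ := 2)
    (Cmd.wp.runs hw (by simp [Cmd.wp]; omega) (by simp [Cmd.cost])) (by omega)
    fun s1 f1 g1 => ?_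
  refine Runs.seq (P := fun s1 => s1.var 31 = 0) (t₁ := 2)
    (Cmd.wp.runs hw (by simp [Cmd.wp]; omega) (by simp [Cmd.cost])) (by omega)
    fun s2 f2 g2 => ?_
  refine Runs.seq (P := fun s1 => s1.var 32 = 0) (t₁ := 2)
    (Cmd.wp.runs hw (by simp [Cmd.wp]; omega) (by simp [Cmd.cost])) (by omega)
    fun s3 f3 g3 => ?_
  have z0 : s3.var 0 = X.length := by rw [f3.var 0 rfl, f2.var 0 rfl, f1.var 0 rfl, h0]
  have z30 : s3.var 30 = 0 := by rw [f3.var 30 rfl, f2.var 30 rfl, g1]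
  have z31 : s3.var 31 = 0 := by rw [f3.var 31 rfl, g2]
  have c0 : s3.arr 0 = s.arr 0 := by rw [f3.arr 0 rfl, f2.arr 0 rfl, f1.arr 0 rfl]
  have c16 : s3.arr 16 = s.arr 16 := by rw [f3.arr 16 rfl, f2.arr 16 rfl, f1.arr 16 rfl]
  have c21 : s3.arr 21 = s.arr 21 := by rw [f3.arr 21 rfl, f2.arr 21 rfl, f1.arr 21 rfl]
  generalize hLPF : s.arr 16 = LPF at *
  generalize hLM : s.arr 21 = LM at *
  refine Runs.seq (t₁ := 200 * X.length + 400) (P := fun s' => s'.var 32 = (lzhb1 h X).length ∧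
      ∀ (j : ℕ) (hj : j < (lzhb1 h X).length), s'.arr 1 j = (lzhb1 h X)[j].len ∧
        s'.arr 2 j = (lzhb1 h X)[j].second code) ?_ (by omega) fun s4 f4 g4 => ?_
  swap
  · refine Cmd.wp.runs hw ?_ (by simp [Cmd.cost]; omega)
    simpa [Cmd.wp, IsEncodingOutput] using g4
  refine (Runs.while hw (fun s' => ∃ H E, ScanInv h X code LPF LM (s'.var 30) (s'.var 31)
      (s'.var 32) (s'.arr 15) (s'.arr 1) (s'.arr 2) H E)
    -- A finished phrase of at least two symbols turns `k` into the increase of `b`, and a literal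
    -- discards at most one copied symbol.
    (fun s' => 2 * X.length - (2 * s'.var 30 + s'.var 31)) ?_ ?_
      (t := 80 * (2 * X.length + 1)) ?_).imp (by omega) ?_
  · rw [z30, z31, g3]
    exact ⟨[], [], ⟨rfl, by omega, by simp, rfl, le_rfl, rfl, by simp, by simp, by simp⟩⟩
  · rintro s' hf ⟨H, E, hI⟩
    have v0 : s'.var 0 = X.length := by rw [hf.var 0 rfl, z0]
    have a0 : s'.arr 0 = s.arr 0 := by rw [hf.arr 0 rfl, c0]
    have a16 : s'.arr 16 = LPF := by rw [hf.arr 16 rfl, c16]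
    have a21 : s'.arr 21 = LM := by rw [hf.arr 21 rfl, c21]
    generalize hvb : s'.var 30 = b at *
    generalize hvk : s'.var 31 = k at *
    generalize hvc : s'.var 32 = cnt at *
    refine ⟨by simp, fun hc => ?_⟩
    have hbX : b < X.length := by
      by_contra hcon
      simp [v0, hvb, hcon] at hc
    have hcnt := hI.count_le
    have hbk : b + k ≤ X.length := by
      rcases Nat.eq_zero_or_pos k with rfl | hk
      · omega
      · have h1 := hI.pos hk
        have := hT.add_le h1.1 hbX
        omega
    refine Cmd.wp.seq (P := fun s'' => s''.var 33 = LM b) ?_ fun s5 f5 g5 => ?_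
    · simp [Cmd.wp, hvb, a21]; omega
    refine Cmd.wp.seq (P := fun s'' => s''.var 34 = 0) ?_ fun s6 f6 g6 => ?_
    · simp [Cmd.wp]; omega
    have d30 : s6.var 30 = b := by rw [f6.var 30 rfl, f5.var 30 rfl, hvb]
    have d31 : s6.var 31 = k := by rw [f6.var 31 rfl, f5.var 31 rfl, hvk]
    have d33 : s6.var 33 = LM b := by rw [f6.var 33 rfl, g5]
    have d15 : s6.arr 15 = s'.arr 15 := by rw [f6.arr 15 rfl, f5.arr 15 rfl]
    have d16 : s6.arr 16 = LPF := by rw [f6.arr 16 rfl, f5.arr 16 rfl, a16]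
    have hb0 : k < LPF b → 0 < b := fun hk => by
      by_contra hcon
      rw [show b = 0 by omega, hT.zero (by omega)] at hk
      omega
    refine Cmd.wp.seq (P := fun s'' =>
      (s''.var 34 ≠ 0 ∧ k < LPF b ∧ s'.arr 15 (LM b + k % (b - LM b)) < h) ∨
      (s''.var 34 = 0 ∧ (k < LPF b → h ≤ s'.arr 15 (LM b + k % (b - LM b))))) ?_
      fun s7 f7 g7 => ?_
    · by_cases hk : k < LPF b
      · have h1 := hT.source_lt (k := k) (hb0 hk) hbX
        have h2 := hT.lt (hb0 hk) hbX
        by_cases hlt : s'.arr 15 (LM b + k % (b - LM b)) < h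
        · simp [Cmd.wp, d30, d31, d33, d15, d16, hk, hlt]; omega
        · simp [Cmd.wp, d30, d31, d33, d15, d16, hk, hlt]; omega
      · simp [Cmd.wp, d30, d31, d16, hk, g6]; omega
    have e30 : s7.var 30 = b := by rw [f7.var 30 rfl, d30]
    have e31 : s7.var 31 = k := by rw [f7.var 31 rfl, d31]
    have e32 : s7.var 32 = cnt := by rw [f7.var 32 rfl, f6.var 32 rfl, f5.var 32 rfl, hvc]
    have e33 : s7.var 33 = LM b := by rw [f7.var 33 rfl, d33]
    have e15 : s7.arr 15 = s'.arr 15 := by rw [f7.arr 15 rfl, d15]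
    have e0 : s7.arr 0 = s.arr 0 := by rw [f7.arr 0 rfl, f6.arr 0 rfl, f5.arr 0 rfl, a0]
    have e1 : s7.arr 1 = s'.arr 1 := by rw [f7.arr 1 rfl, f6.arr 1 rfl, f5.arr 1 rfl]
    have e2 : s7.arr 2 = s'.arr 2 := by rw [f7.arr 2 rfl, f6.arr 2 rfl, f5.arr 2 rfl]
    rcases g7 with ⟨h34, hk, hlt⟩ | ⟨h34, hsmall⟩
    · have h1 := hT.source_lt (k := k) (hb0 hk) hbX
      have h2 := hT.lt (hb0 hk) hbX
      have h3 := hT.add_le (hb0 hk) hbX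
      have hnew := hI.extend (HT' := (s7.setArr 15 (b + k)
        (s'.arr 15 (LM b + k % (b - LM b)) + 1)).arr 15) hT hbX hk hlt fun i => by
          simp [State.arr_setArr_apply, e15]
      simp [Cmd.wp, e30, e31, e33, e15, h34, e32]
      refine ⟨by omega, by omega, by omega, by omega, ⟨H, E, ?_⟩, by omega⟩
      simpa [State.arr_setArr, e1, e2] using hnew
    · have hp := hI.nextPhrase_eq hT hbX hsmall
      by_cases hk2 : k < 2
      · rw [if_neg (by omega)] at hp
        have hnew := hI.append hbX hp (HT' := (s7.setArr 15 b 0).arr 15)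
          (O₁' := (s7.setArr 1 cnt 1).arr 1) (O₂' := (s7.setArr 2 cnt (code X[b])).arr 2)
          (fun i hi => by
            simp only [Phrase.len, Nat.lt_one_iff] at hi
            subst hi
            simp [Phrase.newHeights])
          (fun i hi => by simp [State.arr_setArr_apply, e15]; omega)
          (fun i => by simp [State.arr_setArr_apply, e1, Phrase.len])
          (fun i => by simp [State.arr_setArr_apply, e2, Phrase.second])
        simp [Cmd.wp, e30, e31, h34, e32, hk2, e0, hin b hbX]
        refine ⟨by omega, by omega, by omega, by omega, by omega, by omega, by omega, by omega,
          by omega, by omega, ⟨H ++ (Phrase.lit X[b]).newHeights H, E ++ [.lit X[b]], ?_⟩, by omega⟩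
        simpa [State.arr_setArr, Phrase.len] using hnew
      · rw [if_pos (by omega)] at hp
        have hnew := hI.append hbX hp (HT' := s7.arr 15)
          (O₁' := (s7.setArr 1 cnt k).arr 1) (O₂' := (s7.setArr 2 cnt (LM b)).arr 2)
          (fun i hi => by
            simp only [Phrase.len] at hi
            rw [e15, (hI.copied i hi).1]
            simp [Phrase.newHeights, hI.length, List.getElem?_range hi])
          (fun i hi => by rw [e15])
          (fun i => by simp [State.arr_setArr_apply, e1, Phrase.len])
          (fun i => by simp [State.arr_setArr_apply, e2, Phrase.second])
        simp [Cmd.wp, e30, e31, h34, e32, hk2, e33]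
        refine ⟨by omega, by omega, by omega, by omega, by omega,
          ⟨H ++ (Phrase.copy k (LM b) : Phrase α).newHeights H, E ++ [.copy k (LM b)], ?_⟩,
          by omega⟩
        simpa [State.arr_setArr, Phrase.len] using hnew
  · simp [Cmd.cost, z30, z31]; omega
  · rintro s' hf ⟨⟨H, E, hI⟩, hc⟩
    have v0 : s'.var 0 = X.length := by rw [← z0]; exact hf.var 0 rfl
    have hbX : ¬ H.length < X.length := by
      rw [hI.length]
      intro hcon
      simp [v0, hcon] at hc
    have hE : lzhb1 h X = E := by rw [hI.eq, lzhb1From, dif_neg hbX, List.append_nil]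
    rw [hE]
    exact ⟨hI.count.symm, hI.out⟩

/-! ### The whole program -/

/-- A copy of the input for a program renumbered by `40`. All other programs use only registers and
arrays with smaller numbers. -/
def copyInput : Cmd := 1 ≔ ♯0 ;; 40 ≔ ♯0 ;; tab 40 (0 ⊙ ♯2)

theorem copyInput_runs {w S : ℕ} (hw : 1 < wordCap w) (hS : S ≤ wordCap w) {xs : List ℕ}
    (hb : xs.length + 20 < S) :
    Runs w S copyInput (initState xs) (30 * (xs.length + 2)) (ShiftRel 40 (initState xs)) := by
  refine Runs.seq (P := fun s1 => s1.var 1 = xs.length) (t₁ := 2)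
    (Cmd.wp.runs hw (by simp [Cmd.wp, initState]) (by simp [Cmd.cost])) (by omega)
    fun s1 f1 g1 => ?_
  refine Runs.seq (P := fun s1 => s1.var 40 = xs.length) (t₁ := 2)
    (Cmd.wp.runs hw (by simp [Cmd.wp, f1.var 0 rfl, initState]) (by simp [Cmd.cost])) (by omega)
    fun s2 f2 g2 => ?_
  have a0 : s2.arr 0 = (initState xs).arr 0 := by rw [f2.arr 0 rfl, f1.arr 0 rfl]
  have a40 : s2.arr 40 = (initState xs).arr 40 := by rw [f2.arr 40 rfl, f1.arr 40 rfl]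
  refine (tab_runs (t := 20 * (xs.length + 2)) hw hS (by rw [f2.var 1 rfl, g1]) (by omega) rfl
    (fun j hj => by simp; omega) (by simp; omega)).imp (by omega) fun s3 f3 h3 => ?_
  refine ⟨fun x => ?_, fun a => ?_⟩
  · rcases Nat.eq_zero_or_pos x with rfl | hx
    · rw [f3.var _ rfl, g2]; rfl
    · rw [f3.var _ (by simp [tab, Cmd.forTo, Cmd.modV]), f2.var _ (by simp [Cmd.modV]; omega),
        f1.var _ (by simp [Cmd.modV])]
      simp [initState]; omega
  · rcases Nat.eq_zero_or_pos a with rfl | ha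
    · funext i
      rcases Nat.lt_or_ge i xs.length with hi | hi
      · rw [h3.1 i hi]; simp [a0]
      · rw [h3.2 i hi, a40]; simp [initState, hi]
    · rw [f3.arr _ (by simp [tab, Cmd.forTo, Cmd.modA]; omega), f2.arr _ rfl, f1.arr _ rfl]
      funext i
      simp [initState]; omega

/-- Names depend only on which neighbours are equal. -/
theorem names_congr {κ κ' : Type*} [DecidableEq κ] [DecidableEq κ'] {key : ℕ → κ}
    {key' : ℕ → κ'} {i : ℕ} (h : ∀ j < i, key (j + 1) = key j ↔ key' (j + 1) = key' j) :
    names key i = names key' i := by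
  induction i with
  | zero => rfl
  | succ i ih =>
    simp only [names, ih fun j hj => h j (by omega), h i (by omega)]

/-- Array `41` lists positions in the order of their symbols. Array `7` gets the number of
different symbols in this order up to the symbol at a position. Register `3` is the preceding
position; its content does not matter for the first one. -/
def rankSymbols : Cmd :=
  4 ≔ 0 ;;
  .forTo 2 0 (5 ≔ 41 ⊙ ♯2 ;;
    .ite ((0 <ₑ ♯2) * (0 ⊙ ♯5 =ₑ 0 ⊙ ♯3)) .skip (4 ≔ ♯4 + 1) ;;
    .write 7 ♯5 ♯4 ;;
    3 ≔ ♯5)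

theorem rankSymbols_runs {w S : ℕ} (hw : 1 < wordCap w) (hS : S ≤ wordCap w) {s : State}
    {n : ℕ} (h0 : s.var 0 = n) (h3 : s.var 3 < S) (hb : n + 20 < S)
    (hlt : ∀ i < n, s.arr 41 i < n)
    (hinj : ∀ i < n, ∀ j < n, s.arr 41 i = s.arr 41 j → i = j) :
    Runs w S rankSymbols s (60 * (n + 3)) fun s' =>
      (∀ i < n, s'.arr 7 (s.arr 41 i) = names (fun i => s.arr 0 (s.arr 41 i)) i) ∧
      ∀ i, n ≤ i → s'.arr 7 i = s.arr 7 i := by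
  set p := s.arr 41 with hp
  set key : ℕ → ℕ := fun i => s.arr 0 (p i) with hkey
  refine Runs.seq (P := fun s1 => s1.var 4 = 0) (t₁ := 2)
    (Cmd.wp.runs hw (by simp [Cmd.wp]; omega) (by simp [Cmd.cost])) (by omega)
    fun s1 f1 g1 => ?_
  refine (Runs.forTo hw (N := n) (t := 50 * (n + 2)) (by rw [f1.var 0 rfl, h0])
    (fun j s' => s'.var 3 < S ∧ (j = 0 → s'.var 4 = 0) ∧
      (∀ i, j = i + 1 → s'.var 4 = names key i ∧ s'.var 3 = p i) ∧
      (∀ i < j, s'.arr 7 (p i) = names key i) ∧ ∀ i, n ≤ i → s'.arr 7 i = s.arr 7 i)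
    (by decide) rfl rfl (by omega) ?_ ?_ ?_).imp (by omega) fun s' _ h => h.2.2.2
  · refine ⟨?_, fun _ => by simpa using g1, fun i hi => by omega, fun i hi => by omega,
      fun i hi => ?_⟩
    · simpa [f1.var 3 rfl] using h3
    · simp [f1.arr 7 rfl]
  · rintro j s' hj hf hi ⟨hJ3, hJ0, hJ1, hJ, hJz⟩
    have a41 : s'.arr 41 = p := by rw [hf.arr 41 rfl, f1.arr 41 rfl]
    have a0 : s'.arr 0 = s.arr 0 := by rw [hf.arr 0 rfl, f1.arr 0 rfl]
    have hpj := hlt j hj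
    refine Cmd.wp.seq (P := fun s'' => s''.var 5 = p j) ?_ fun s5 f5 g5 => ?_
    · simp [Cmd.wp, hi, a41]; omega
    have d2 : s5.var 2 = j := by rw [f5.var 2 rfl, hi]
    have d3 : s5.var 3 = s'.var 3 := f5.var 3 rfl
    have d4 : s5.var 4 = s'.var 4 := f5.var 4 rfl
    have d0 : s5.arr 0 = s.arr 0 := by rw [f5.arr 0 rfl, a0]
    refine Cmd.wp.seq (P := fun s'' => s''.var 4 = names key j) ?_ fun s6 f6 g6 => ?_
    · cases j with
      | zero => simp [Cmd.wp, d2, d3, d4, g5, hJ0 rfl, names]; omega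
      | succ j =>
        obtain ⟨h4, h5⟩ := hJ1 j rfl
        have := names_le key j
        have := hlt j (by omega)
        by_cases he : s.arr 0 (p (j + 1)) = s.arr 0 (p j)
        · have he' : key (j + 1) = key j := he
          simp [Cmd.wp, d2, d3, d4, g5, d0, h4, h5, he, names, he']; omega
        · have he' : key (j + 1) ≠ key j := he
          simp [Cmd.wp, d2, d3, d4, g5, d0, h4, h5, he, names, he']; omega
    have e5 : s6.var 5 = p j := by rw [f6.var 5 rfl, g5]
    have e7 : s6.arr 7 = s'.arr 7 := by rw [f6.arr 7 rfl, f5.arr 7 rfl]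
    simp only [Cmd.wp, Expr.OK_var, Expr.val_var, State.var_setVar, State.var_setArr,
      State.arr_setVar, State.arr_setArr_apply, e5, e7, g6, Nat.reduceEqDiff, if_true, if_false,
      true_and]
    refine ⟨by omega, by omega, fun h => h.elim, fun i h => ?_, fun i h => ?_, fun i h => ?_⟩
    · obtain rfl : j = i := by omega
      exact ⟨rfl, rfl⟩
    · split_ifs with hpi
      · rw [hinj i (by omega) j hj hpi]
      · refine hJ i ?_
        rcases Nat.eq_or_lt_of_le (show i ≤ j by omega) with rfl | h1
        · exact absurd rfl hpi
        · exact h1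
    · rw [if_neg (by omega)]
      exact hJz i h
  · simp [Cmd.cost]; omega

/-- Ranks of sorted symbols represent the string. Only codes are compared, but equal codes mean
equal symbols, and these are adjacent in the sorted order. -/
theorem represents_of_names {α : Type*} [LinearOrder α] {X : List α}
    (σ : Equiv.Perm (Fin X.length)) (hσ : Monotone fun i => X.get (σ i)) {T key p : ℕ → ℕ}
    {code : α ↪ ℕ} (hp : ∀ i : Fin X.length, p i = σ i)
    (hkey : ∀ i : Fin X.length, key i = code (X.get (σ i)))
    (hT : ∀ i < X.length, T (p i) = names key i) (hz : ∀ i, X.length ≤ i → T i = 0) :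
    Represents T X ∧ ∀ i, T i ≤ X.length := by
  rcases Nat.eq_zero_or_pos X.length with h0 | h0
  · exact ⟨⟨⟨fun i hi => by omega, hz⟩, fun i hi => by omega⟩, fun i => by
      rw [hz i (by omega)]; omega⟩
  let key' : ℕ → α := fun i => if h : i < X.length then X.get (σ ⟨i, h⟩) else X.get ⟨0, h0⟩
  have hkey' : ∀ (i : ℕ) (h : i < X.length), key' i = X.get (σ ⟨i, h⟩) := fun i h => dif_pos h
  have hn : ∀ i < X.length, names key i = names key' i := fun i hi => names_congr fun j hj => by
    rw [hkey' j (by omega), hkey' (j + 1) (by omega), hkey ⟨j, by omega⟩,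
      hkey ⟨j + 1, by omega⟩, code.injective.eq_iff]
  have hs : ∀ i j, i < j → j < X.length → key' i ≤ key' j := fun i j hij hj => by
    rw [hkey' j hj, hkey' i (by omega)]
    exact hσ (by simpa using hij.le)
  have hinv : ∀ (i : ℕ) (hi : i < X.length), ∃ j < X.length, T i = names key' j ∧
      key' j = X[i] := fun i hi => by
    refine ⟨σ.symm ⟨i, hi⟩, (σ.symm ⟨i, hi⟩).2, ?_, ?_⟩
    · rw [← hn _ (σ.symm ⟨i, hi⟩).2, ← hT _ (σ.symm ⟨i, hi⟩).2, hp]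
      simp
    · rw [hkey' _ (σ.symm ⟨i, hi⟩).2]
      simp
  refine ⟨⟨⟨fun i hi => ?_, hz⟩, fun i hi j hj => ?_⟩, fun i => ?_⟩
  · obtain ⟨k, hk, h1, h2⟩ := hinv i hi
    rw [h1]; exact names_pos _ _
  · obtain ⟨k, hk, h1, h2⟩ := hinv i hi
    obtain ⟨l, hl, h3, h4⟩ := hinv j hj
    rw [h1, h3, names_inj_iff hs hk hl, h2, h4, List.getElem?_eq_getElem hi,
      List.getElem?_eq_getElem hj, Option.some_inj]
  · rcases Nat.lt_or_ge i X.length with hi | hi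
    · obtain ⟨k, hk, h1, h2⟩ := hinv i hi
      have := names_le key' k
      omega
    · rw [hz i hi]; omega

/-- The encoder, given a program that sorts the positions by their symbols. -/
def encoder (h : ℕ) (p : Cmd) : Cmd :=
  copyInput ;; p.shift 40 ;; rankSymbols ;; 6 ≔ ♯0 ;; suffixArray ;; kasai ;; scanStack ;;
    leftmost ;; greedyScan h

theorem encoder_runs {α : Type*} [LinearOrder α] {w S S' t : ℕ} {h : ℕ} {p : Cmd} {X : List α}
    {code : α ↪ ℕ} (hw : 1 < wordCap w) (hS : S ≤ wordCap w) (hS' : S' ≤ S)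
    (hb : 100 * (X.length + 1) + h ≤ S) {s₁ : State}
    (hp : Exec w S' p (initState (X.map code)) t s₁) (hs₁ : IsSortOutput X s₁) :
    Runs w S (encoder h p) (initState (X.map code)) (t + 40000 * (X.length + 3))
      (IsEncodingOutput code (lzhb1 h X)) := by
  have hlen : (X.map code).length = X.length := List.length_map _
  refine Runs.seq (copyInput_runs hw hS (by omega)) (by omega) fun s1 f1 g1 => ?_
  obtain ⟨s2, x2, r2, v2, a2⟩ := Exec.shift hS' hp g1
  obtain ⟨σ, hσ, hmono⟩ := hs₁
  refine Runs.seq (P := fun s => s = s2) (t₁ := t) ⟨t, s2, x2, le_rfl, rfl⟩ (by omega) ?_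
  rintro s2 - rfl
  have v0 : s2.var 0 = X.length := by
    rw [v2 0 (by omega), f1.var 0 rfl]; simp [initState]
  have v3 : s2.var 3 = 0 := by rw [v2 3 (by omega), f1.var 3 rfl]; simp [initState]
  have hin : ∀ (i : ℕ) (hi : i < X.length), s2.arr 0 i = code X[i] := fun i hi => by
    rw [a2 0 (by omega), f1.arr 0 rfl]; simp [initState, hi]
  have hz : ∀ a i, a = 7 ∨ a = 16 ∨ a = 17 ∨ a = 21 → s2.arr a i = 0 := by
    rintro a i (rfl | rfl | rfl | rfl)
    all_goals rw [a2 _ (by omega), f1.arr _ rfl]; simp [initState]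
  have h41 : ∀ i : Fin X.length, s2.arr 41 i = σ i := fun i => by
    rw [← hσ i]; exact congrFun (r2.2 1) i
  refine Runs.seq (rankSymbols_runs hw hS v0 (by omega) (by omega) (fun i hi => ?_)
    fun i hi j hj hij => ?_) (by omega) fun s3 f3 g3 => ?_
  · rw [h41 ⟨i, hi⟩]; exact Fin.isLt _
  · rw [h41 ⟨i, hi⟩, h41 ⟨j, hj⟩, Fin.val_inj, σ.injective.eq_iff] at hij
    simpa using hij
  have hz3 : ∀ i, X.length ≤ i → s3.arr 7 i = 0 := fun i hi => by
    rw [g3.2 i hi, hz 7 i (by simp)]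
  have hT : s3.arr 7 = strAt (s3.arr 7) 0 X.length := by
    funext i
    have := strAt_of_zero (A := s3.arr 7) (o := 0) (n := X.length) (by simpa using hz3) i
    rwa [Nat.zero_add] at this
  obtain ⟨hrep, hle⟩ := represents_of_names (T := s3.arr 7) σ hmono h41
    (fun i => by rw [h41 i]; exact hin _ (σ i).2) g3.1 hz3
  generalize hTT : s3.arr 7 = T at *
  refine Runs.seq (P := fun s => s.var 6 = X.length) (t₁ := 2)
    (Cmd.wp.runs hw (by simp [Cmd.wp, f3.var 0 rfl, v0]) (by simp [Cmd.cost])) (by omega)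
    fun s4 f4 g4 => ?_
  have b7 : s4.arr 7 = T := by rw [f4.arr 7 rfl, hTT]
  refine Runs.seq (suffixArray_runs hw hS g4 (by omega) (by rw [b7, ← hT]; exact hrep.str)
    (by rw [b7, ← hT]; exact hle) (by rw [b7]; exact hz3)) (by omega) fun s5 f5 g5 => ?_
  rw [b7, ← hT] at g5
  refine Runs.seq (kasai_runs (T := T) hw hS (n := X.length) ?_ (by omega) hrep.str
    (fun i hi => g5.2 i (by omega)) g5.1) (by omega) fun s6 f6 g6 => ?_
  · rw [f5.var 0 rfl, f4.var 0 rfl, f3.var 0 rfl, v0]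
  have c0 : s6.var 0 = X.length := by
    rw [f6.var 0 rfl, f5.var 0 rfl, f4.var 0 rfl, f3.var 0 rfl, v0]
  have c10 : s6.arr 10 = s5.arr 10 := f6.arr 10 rfl
  refine Runs.seq (scanStack_runs (T := T) hw hS c0 (by omega) (by rw [c10]; exact g5.1)
    (by rw [c10]; exact g6) ?_ ?_) (by omega) fun s7 f7 g7 => ?_
  · rw [f6.arr 16 rfl, f5.arr 16 rfl, f4.arr 16 rfl, f3.arr 16 rfl, hz 16 0 (by simp)]
  · rw [f6.arr 17 rfl, f5.arr 17 rfl, f4.arr 17 rfl, f3.arr 17 rfl, hz 17 0 (by simp)]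
  have d0 : s7.var 0 = X.length := by rw [f7.var 0 rfl, c0]
  refine Runs.seq (leftmost_runs hw hS d0 (by omega) g7.1 g7.2.1 ?_ g7.2.2) (by omega)
    fun s8 f8 g8 => ?_
  · rw [f7.arr 21 rfl, f6.arr 21 rfl, f5.arr 21 rfl, f4.arr 21 rfl, f3.arr 21 rfl,
      hz 21 0 (by simp)]
  have e16 : s8.arr 16 = s7.arr 16 := f8.arr 16 rfl
  refine (greedyScan_runs hw hS (by rw [f8.var 0 rfl, d0]) (by omega) (fun i hi => ?_)
    ⟨fun b hb => ?_, fun b hb0 hb => ?_⟩).imp (by omega) fun _ _ h => h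
  · rw [f8.arr 0 rfl, f7.arr 0 rfl, f6.arr 0 rfl, f5.arr 0 rfl, f4.arr 0 rfl, f3.arr 0 rfl,
      hin i hi]
  · rw [e16]
    rcases Nat.eq_zero_or_pos b with rfl | hb0
    · rw [lpf_zero, g7.1]
    · exact hrep.lpf_eq hb (g7.2.2 b hb0 hb)
  · rw [e16]
    exact hrep.lmocc_eq hb (g8 b hb0 hb)

end HBLZ

theorem mainTheorem4 (h : ℕ) (A : ℕ → Type*) [∀ n, LinearOrder (A n)]
    (code : (n : ℕ) → A n ↪ ℕ) (hA : HBLZ.LinearlySortable A code) :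
    (∀ (n : ℕ) (T : List (A n)), HBLZ.IsHBounded h T (HBLZ.lzhb1 h T)) ∧
      HBLZ.LinearTimeSpace A code
        (fun n T s => HBLZ.IsEncodingOutput (code n) (HBLZ.lzhb1 h T) s) := by
  refine ⟨fun n T => HBLZ.isHBounded_lzhb1 h T, ?_⟩
  obtain ⟨p, c, hp⟩ := hA
  -- The summand `h` ensures that `h` is a machine word; the last one covers the time of the encoder
  -- apart from sorting.
  obtain ⟨C, hC⟩ : ∃ C, C = c + h + 120000 := ⟨_, rfl⟩
  refine ⟨HBLZ.encoder h p, C, fun n w X hX hw hcode => ?_⟩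
  have hmul : C * (n + 1) = c * (n + 1) + h * n + h + 120000 * (n + 1) := by rw [hC]; ring
  obtain ⟨t, s, hx, ht, hs⟩ := hp n w X hX (by omega) hcode
  obtain ⟨t', s', hx', ht', hs'⟩ := HBLZ.encoder_runs (h := h) (S := C * (n + 1))
    (show 1 < 2 ^ w by omega) hw (by omega) (by rw [hX]; omega) hx hs
  exact ⟨t', s', hx', by rw [hX] at ht'; omega, hs'⟩
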